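/- **Model.** Let $F_-$ and $F_+$ be probability distributions on $\{0,1,2,\dots\}$ and let $\gamma\sim F_-$, $\xi\sim F_+$, with $\mathbb E[\gamma^2]<\infty$, $\mathbb E[\xi^2]<\infty$ and $\mathbb E[\gamma]=\mathbb E[\xi]>0$. Fix $\kappa_0\in(0,\tfrac12]$ and $\delta_0\in(0,\kappa_0)$. The Repeated directed Configuration Model (RCM) graph on the vertex set $V_n$, $|V_n|=n$, is generated as follows. 1. Sample i.i.d. copies $(\gamma_v)_{v\in V_n}$ of $\gamma$ and, independently, i.i.d. copies $(\xi_v)_{v\in V_n}$ of $\xi$; put $\Delta_n=\sum_v\gamma_v-\sum_v\xi_v$. Repeat this step until $|\Delta_n|\le n^{1-\kappa_0+\delta_0}$. 2. Choose $|\Delta_n|$ vertices uniformly without replacement. Vertex $v$ gets $\gamma_v$ inbound and $\xi_v$ outbound stubs; each chosen vertex gets one further stub, outbound if $\Delta_n\ge 0$ and inbound if $\Delta_n<0$. 3. Pair the outbound stubs with the inbound stubs uniformly at random, and repeat the pairing until the resulting directed graph is simple (no self-loops, no multiple edges). Stub sequences that have no simple pairing are discarded and sampled anew. **Rank correlations.**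 For a simple directed graph with edge set $E\subseteq V^2$ let $D^+(v)$, $D^-(v)$ be the out- and in-degree of $v$, and for $e=(v,w)$ let $\pi_*e=v$, $\pi^*e=w$. Let $\alpha,\beta\in\{+,-\}$ and let $(U_e)_{e\in V^2}$, $(W_e)_{e\in V^2}$ be independent uniform variables on $[0,1)$, independent of the graph. Put $$R^\alpha\pi_*e=\sum_{f\in E}\mathbf 1\{D^\alpha\pi_*f+U_f\ge D^\alpha\pi_*e+U_e\},\qquad R^\beta\pi^*e=\sum_{f\in E}\mathbf 1\{D^\beta\pi^*f+W_f\ge D^\beta\pi^*e+W_e\},$$ $$\overline R^\alpha\pi e=\tfrac12+\sum_{f\in E}\Big(\mathbf 1\{D^\alpha\pi f>D^\alpha\pi e\}+\tfrac12\mathbf 1\{D^\alpha\pi f=D^\alpha\pi e\}\Big)\qquad(\pi\in\{\pi_*,\pi^*\}),$$ $$\rho_\alpha^\beta=\frac{12\sum_{e\in E}R^\alpha\pi_*e\,R^\beta\pi^*e-3|E|(|E|+1)^2}{|E|^3-|E|},$$ $$\overline\rho_\alpha^\beta=\frac{4\sum_{e\in E}\overline R^\alpha\pi_*e\,\overline R^\beta\pi^*e-|E|(|E|+1)^2}{\sqrt{4\sum_{e\in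 E}(\overline R^\alpha\pi_*e)^2-|E|(|E|+1)^2}\,\sqrt{4\sum_{e\in E}(\overline R^\beta\pi^*e)^2-|E|(|E|+1)^2}},$$ $$\tau_\alpha^\beta=\frac{2(\mathcal N_C-\mathcal N_D)}{|E|(|E|-1)},$$ where $\mathcal N_C$ (resp. $\mathcal N_D$) is the number of unordered pairs $\{e,f\}$ of edges for which $(D^\alpha\pi_*e-D^\alpha\pi_*f)(D^\beta\pi^*e-D^\beta\pi^*f)$ is positive (resp. negative). A quotient with denominator $0$ is read as $0$. **Theorem.** For all sufficiently large $n$ the procedure above ends almost surely, so that the RCM graph is well defined. Let $G_n=(V_n,E_n)$, $n\to\infty$, be random graphs on one probability space such that, for all large $n$, $G_n$ is an RCM graph with $|V_n|=n$. Then for all $\alpha,\beta\in\{+,-\}$, as $n\to\infty$, $$\rho_\alpha^\beta(G_n)\to0,\qquad\overline\rho_\alpha^\beta(G_n)\to0,\qquad\tau_\alpha^\beta(G_n)\to0\qquad\text{in probability.}$$ Moreover, for all integers $k,l\ge0$, $$\frac{|\{e\in E_n:\ D^\alpha\pi_*e=k,\ D^\beta\pi^*e=l\}|}{|E_n|}\to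 p_\alpha(k)\,q_\beta(l)\qquad\text{in probability,}$$ where $p_+(k)=k\,\mathbb P(\xi=k)/\mathbb E[\xi]$, $p_-(k)=\mathbb P(\gamma=k)$, $q_+(l)=\mathbb P(\xi=l)$ and $q_-(l)=l\,\mathbb P(\gamma=l)/\mathbb E[\gamma]$. -/

import Mathlib

open MeasureTheory ProbabilityTheory Filter Topology
open scoped ENNReal

noncomputable section

namespace RCM

/-! ### Directed graphs, degrees at the end points of edges -/

/-- The type of a degree: `plus` is the out-degree, `minus` is the in-degree. -/
inductive DegType where
  | plus
  | minus

/-- The edge set `E ⊆ V²` of a directed graph without multiple edges on the vertex set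
`V = {0, …, n - 1}`.  The edge `(v, w)` has source `v` and target `w`. -/
abbrev Edges (n : ℕ) := Finset (Fin n × Fin n)

/-- `D^α(v)` in the graph with edge set `E`. -/
def degree {n : ℕ} (E : Edges n) (α : DegType) (v : Fin n) : ℕ :=
  match α with
  | .plus => (E.filter fun e => e.1 = v).card
  | .minus => (E.filter fun e => e.2 = v).card

/-- `D^α π_* e`: the degree of type `α` of the source of `e`. -/
def srcDegree {n : ℕ} (E : Edges n) (α : DegType) (e : Fin n × Fin n) : ℕ := degree E α e.1

/-- `D^β π^* e`: the degree of type `β` of the target of `e`. -/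
def tgtDegree {n : ℕ} (E : Edges n) (β : DegType) (e : Fin n × Fin n) : ℕ := degree E β e.2

/-- The conditional probability, given the graph, that a uniformly sampled edge has a source with
`α`-degree `k` and a target with `β`-degree `l`. -/
def empiricalJoint {n : ℕ} (α β : DegType) (k l : ℕ) (E : Edges n) : ℝ :=
  ((E.filter fun e => srcDegree E α e = k ∧ tgtDegree E β e = l).card : ℝ) / (E.card : ℝ)

/-! ### Ranks and rank correlations -/

/-- The rank of `e` among the edges when the values `a` are put in decreasing order and ties are
resolved by the additional marks `u`. -/
def randomRank {n : ℕ} (E : Edges n) (a : Fin n × Fin n → ℕ) (u : Fin n × Fin n → ℝ)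
    (e : Fin n × Fin n) : ℝ :=
  ∑ f ∈ E, if (a f : ℝ) + u f ≥ (a e : ℝ) + u e then 1 else 0

/-- The rank of `e` among the edges when the values `a` are put in decreasing order and tied
values get their average rank. -/
def averageRank {n : ℕ} (E : Edges n) (a : Fin n × Fin n → ℕ) (e : Fin n × Fin n) : ℝ :=
  1 / 2 + ∑ f ∈ E, ((if a f > a e then 1 else 0) + 1 / 2 * (if a f = a e then 1 else 0))

/-- Spearman's rho with ties resolved by the marks `u` (sources) and `w` (targets). -/
def spearman {n : ℕ} (α β : DegType) (E : Edges n) (u w : Fin n × Fin n → ℝ) : ℝ :=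
  (12 * ∑ e ∈ E, randomRank E (srcDegree E α) u e * randomRank E (tgtDegree E β) w e
      - 3 * (E.card : ℝ) * ((E.card : ℝ) + 1) ^ 2)
    / ((E.card : ℝ) ^ 3 - (E.card : ℝ))

/-- The normalization `√(4 ∑ R̄(e)² - |E| (|E| + 1)²)` of Spearman's rho with average ranks. -/
def averageRankScale {n : ℕ} (E : Edges n) (a : Fin n × Fin n → ℕ) : ℝ :=
  Real.sqrt (4 * ∑ e ∈ E, averageRank E a e ^ 2 - (E.card : ℝ) * ((E.card : ℝ) + 1) ^ 2)

/-- Spearman's rho with average ranks. -/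
def spearmanAverage {n : ℕ} (α β : DegType) (E : Edges n) : ℝ :=
  (4 * ∑ e ∈ E, averageRank E (srcDegree E α) e * averageRank E (tgtDegree E β) e
      - (E.card : ℝ) * ((E.card : ℝ) + 1) ^ 2)
    / (averageRankScale E (srcDegree E α) * averageRankScale E (tgtDegree E β))

/-- For two edges, the product of the differences of their source `α`-degrees and of their
target `β`-degrees: positive for a concordant pair, negative for a discordant one. -/
def concordance {n : ℕ} (α β : DegType) (E : Edges n) (p : (Fin n × Fin n) × (Fin n × Fin n)) :
    ℤ :=
  ((srcDegree E α p.1 : ℤ) - srcDegree E α p.2) * ((tgtDegree E β p.1 : ℤ) - tgtDegree E β p.2)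

/-- The number of concordant (unordered) pairs of edges; every one of them is counted twice
among the ordered pairs. -/
def concordantPairs {n : ℕ} (α β : DegType) (E : Edges n) : ℝ :=
  (((E ×ˢ E).filter fun p => 0 < concordance α β E p).card : ℝ) / 2

/-- The number of discordant (unordered) pairs of edges. -/
def discordantPairs {n : ℕ} (α β : DegType) (E : Edges n) : ℝ :=
  (((E ×ˢ E).filter fun p => concordance α β E p < 0).card : ℝ) / 2

/-- Kendall's tau. -/
def kendall {n : ℕ} (α β : DegType) (E : Edges n) : ℝ :=
  2 * (concordantPairs α β E - discordantPairs α β E) / ((E.card : ℝ) * ((E.card : ℝ) - 1))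

/-! ### The bi-degree sequence

A bi-degree sequence is a pair `d`, where `d.1 v` is the number of inbound stubs and `d.2 v` the
number of outbound stubs of the vertex `v`. -/

/-- Bi-degree sequences on `n` vertices, in-degrees first. -/
abbrev BiSeq (n : ℕ) := (Fin n → ℕ) × (Fin n → ℕ)

/-- The law of `f a` when `a` is uniformly distributed on the finite set `s`. -/
def uniformImage {A B : Type*} [MeasurableSpace B] (s : Finset A) (f : A → B) : Measure B :=
  (s.card : ℝ≥0∞)⁻¹ • ∑ a ∈ s, Measure.dirac (f a)

/-- `Δ = ∑ γ_v - ∑ ξ_v`. -/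
def imbalance {n : ℕ} (d : BiSeq n) : ℤ := (∑ v, (d.1 v : ℤ)) - ∑ v, (d.2 v : ℤ)

/-- The sampled sequences that are accepted: `|Δ| ≤ n ^ (1 - κ + δ)`. -/
def accepted (κ δ : ℝ) (n : ℕ) : Set (BiSeq n) :=
  {d | |(imbalance d : ℝ)| ≤ (n : ℝ) ^ (1 - κ + δ)}

/-- One stub is added at every vertex of `S`: an outbound one if `Δ ≥ 0`, an inbound one if
`Δ < 0`. -/
def addStubs {n : ℕ} (d : BiSeq n) (S : Finset (Fin n)) : BiSeq n :=
  (fun v => d.1 v + if imbalance d < 0 ∧ v ∈ S then 1 else 0,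
   fun v => d.2 v + if 0 ≤ imbalance d ∧ v ∈ S then 1 else 0)

/-- The law of the accepted sample: independent in-degrees with law `Fminus` and, independently,
independent out-degrees with law `Fplus`, sampled anew until the sample is accepted. -/
def sampleLaw (Fminus Fplus : Measure ℕ) (κ δ : ℝ) (n : ℕ) : Measure (BiSeq n) :=
  ProbabilityTheory.cond
    ((Measure.pi fun _ : Fin n => Fminus).prod (Measure.pi fun _ : Fin n => Fplus))
    (accepted κ δ n)

/-- The law of the bi-degree sequence: `|Δ|` vertices are chosen uniformly without replacement,
and each of them gets one additional stub, so that the numbers of in- and outbound stubs agree. -/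
def biSeqLaw (Fminus Fplus : Measure ℕ) (κ δ : ℝ) (n : ℕ) : Measure (BiSeq n) :=
  (sampleLaw Fminus Fplus κ δ n).bind fun d =>
    uniformImage (Finset.univ.powersetCard (imbalance d).natAbs) (addStubs d)

/-! ### Pairing the stubs -/

/-- A pairing of all outbound stubs with all inbound stubs. -/
abbrev Pairing {n : ℕ} (d : BiSeq n) :=
  ((v : Fin n) × Fin (d.2 v)) ≃ ((v : Fin n) × Fin (d.1 v))

/-- The edge, a pair of vertices, that leaves through the outbound stub `s`. -/
def stubEdge {n : ℕ} {d : BiSeq n} (σ : Pairing d) (s : (v : Fin n) × Fin (d.2 v)) :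
    Fin n × Fin n := (s.1, (σ s).1)

/-- The multigraph that results from the pairing has no self-loops and no multiple edges. -/
def IsSimple {n : ℕ} {d : BiSeq n} (σ : Pairing d) : Prop :=
  (∀ s, (stubEdge σ s).1 ≠ (stubEdge σ s).2) ∧ Function.Injective (stubEdge σ)

/-- The edge set of the graph that results from the pairing. -/
def pairingEdges {n : ℕ} {d : BiSeq n} (σ : Pairing d) : Edges n :=
  Finset.univ.image (stubEdge σ)

open Classical in
/-- All pairings of the stubs that give a simple graph. -/
def simplePairings {n : ℕ} (d : BiSeq n) : Finset (Pairing d) :=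
  Finset.univ.filter fun σ => IsSimple σ

/-- The bi-degree sequences for which repeated pairing can end with a simple graph. -/
def graphical (n : ℕ) : Set (BiSeq n) := {d | (simplePairings d).Nonempty}

/-- The law of the graph in the Repeated directed Configuration Model: the bi-degree sequence is
kept, and its stubs are paired uniformly at random, again and again until the result is simple;
the pairing that is reached is uniform among the simple ones.  Bi-degree sequences
without any simple pairing, for which the procedure would never end, are discarded. -/
def rcmLaw (Fminus Fplus : Measure ℕ) (κ δ : ℝ) (n : ℕ) : Measure (Edges n) :=
  (ProbabilityTheory.cond (biSeqLaw Fminus Fplus κ δ n) (graphical n)).bind fun d =>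
    uniformImage (simplePairings d) pairingEdges

/-- The law of a vector, indexed by `V²`, of independent uniform variables on `[0, 1)`. -/
def marksLaw (n : ℕ) : Measure (Fin n × Fin n → ℝ) :=
  Measure.pi fun _ => volume.restrict (Set.Ico (0 : ℝ) 1)

/-! ### The limiting degree distributions -/

/-- The mean of a distribution on `ℕ`. -/
def mean (F : Measure ℕ) : ℝ := ∫ k, (k : ℝ) ∂F

/-- The limiting distribution of the `α`-degree of the source of a uniformly sampled edge:
size-biased out-degree for `+`, plain in-degree for `-`. -/
def srcLimit (Fminus Fplus : Measure ℕ) (α : DegType) (k : ℕ) : ℝ :=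
  match α with
  | .plus => (k : ℝ) * Fplus.real {k} / mean Fplus
  | .minus => Fminus.real {k}

/-- The limiting distribution of the `β`-degree of the target of a uniformly sampled edge:
plain out-degree for `+`, size-biased in-degree for `-`. -/
def tgtLimit (Fminus Fplus : Measure ℕ) (β : DegType) (l : ℕ) : ℝ :=
  match β with
  | .plus => Fplus.real {l}
  | .minus => (l : ℝ) * Fminus.real {l} / mean Fminus

end RCM

end

/-! Fix the bi-degree sequence, with m stubs of each kind and all degrees at most D. In a simple
graph distinct stubs are distinct edges, so the degrees at the two ends of an edge are functions of
the two stubs that are joined. The average-rank coefficient and the joint degree counts then reduce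
to sums `∑ s, f s * g (σ s)` over a uniform simple pairing `σ`, and the task is to show that these
sums concentrate.

Concentration follows from upper bounds 1 / L and 1 / L ^ 2 for the one- and two-point probabilities
of `σ`, with L = m - (2D(D+1) + 1). They are obtained directly among simple pairings: exchanging the
partners of two stubs keeps the pairing simple for all but 2D(D+1) choices of the second stub, and
the exchange can be undone (`card_simpleEquivs_filter_insert_le`). No estimate of the probability
that a pairing is simple is needed, only D ^ 2 = o(m). The same switching removes loops and multiple
edges one bad stub at a time, so simple pairings exist (`simpleEquivs_nonempty`). For centred g,
upper bounds alone control the second moment (`sum_sq_sum_mul_le`): the constant 1 / L ^ 2 drops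
out, and the nonnegative deficits have small sums because probabilities add up to one. The result is
a factor `covBound` times (∑ f²)(∑ g²), which matches the normalization of the correlation with
average ranks exactly.

For the degree sequence, finite second moments give a maximal degree o(√n), laws of large numbers
for the weighted degree counts, and acceptance with probability tending to one, since the threshold
exceeds √n by a power of n. The correction touches at most n ^ (1 - (κ - δ)) vertices; by
Cauchy–Schwarz these carry only o(n) stubs, whichever vertices they are (`whp_biSeqLaw_typical`).

The four statistics: the average-rank coefficient tends to zero by Chebyshev; the empirical joint
law is close to the product of its marginals, which converge by the law of large numbers. Kendall's
tau is, up to normalization, a bounded quadratic form in the empirical joint law that vanishes at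
product laws (`abs_kendall_le`). Spearman's rho with random ranks differs from its average-rank
analogue by sums of antisymmetric comparisons of marks, uncorrelated for disjoint pairs of edges
(`integral_sq_sum_rank_le`). -/

noncomputable section

namespace RCM

set_option linter.unusedSectionVars false

/-! ### Switchings: existence of simple pairings and upper bounds for their point probabilities. -/

section Switching

open Classical

variable {V S T : Type*}

/-- The stub `s` is part of a self-loop or of a multiple edge. -/
def IsBadStub (src : S → V) (tgt : T → V) (σ : S ≃ T) (s : S) : Prop :=
  src s = tgt (σ s) ∨ ∃ x, x ≠ s ∧ src x = src s ∧ tgt (σ x) = tgt (σ s)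

/-- Sufficient conditions on `r` for the two edges that arise by exchanging the partners of `s`
and `r` to be simple. -/
def IsSwitch (src : S → V) (tgt : T → V) (σ : S ≃ T) (s r : S) : Prop :=
  (tgt (σ r) ≠ src s ∧ ∀ x, src x = src s → tgt (σ x) ≠ tgt (σ r)) ∧
  (src r ≠ tgt (σ s) ∧ ∀ x, tgt (σ x) = tgt (σ s) → src x ≠ src r)

/-- The pairing in which the partners of `s` and `r` are exchanged. -/
def switch (σ : S ≃ T) (s r : S) : S ≃ T := (Equiv.swap s r).trans σ

lemma switch_left (σ : S ≃ T) (s r : S) : switch σ s r s = σ r := by simp [switch]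

lemma switch_right (σ : S ≃ T) (s r : S) : switch σ s r r = σ s := by simp [switch]

lemma switch_of_ne (σ : S ≃ T) {s r x : S} (h₁ : x ≠ s) (h₂ : x ≠ r) :
    switch σ s r x = σ x := by simp [switch, Equiv.swap_apply_of_ne_of_ne h₁ h₂]

lemma switch_switch (σ : S ≃ T) (s r : S) : switch (switch σ s r) s r = σ := by
  ext x; simp [switch]

lemma IsSwitch.ne {src : S → V} {tgt : T → V} {σ : S ≃ T} {s r : S}
    (h : IsSwitch src tgt σ s r) : r ≠ s := by
  rintro rfl
  exact h.2.2 r rfl rfl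

/-- The two new edges are neither loops nor parallel to any edge, so a switch cannot spoil another
stub: a conflict of `y` with `s` or `r` would make that stub bad too. Hence a switch repairs `s` and
creates no new bad stub. This serves both the existence proof and the counting. -/
lemma IsBadStub.of_switch {src : S → V} {tgt : T → V} {σ : S ≃ T} {s r : S}
    (h : IsSwitch src tgt σ s r) {y : S} (hy : IsBadStub src tgt (switch σ s r) y) :
    y ≠ s ∧ IsBadStub src tgt σ y := by
  have hrs := h.ne
  obtain ⟨⟨h1, h2⟩, h3, h4⟩ := h
  have hs : ¬ IsBadStub src tgt (switch σ s r) s := by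
    rintro (hl | ⟨x, hx, hx1, hx2⟩)
    · rw [switch_left] at hl; exact h1 hl.symm
    · rw [switch_left] at hx2
      by_cases hxr : x = r
      · subst hxr; exact h4 s rfl hx1.symm
      · rw [switch_of_ne σ hx hxr] at hx2; exact h2 x hx1 hx2
  have hr : ¬ IsBadStub src tgt (switch σ s r) r := by
    rintro (hl | ⟨x, hx, hx1, hx2⟩)
    · rw [switch_right] at hl; exact h3 hl
    · rw [switch_right] at hx2
      by_cases hxs : x = s
      · subst hxs; exact h4 x rfl hx1
      · rw [switch_of_ne σ hxs hx] at hx2; exact h4 x hx2 hx1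
  have hys : y ≠ s := by rintro rfl; exact hs hy
  have hyr : y ≠ r := by rintro rfl; exact hr hy
  refine ⟨hys, ?_⟩
  rcases hy with hl | ⟨x, hx, hx1, hx2⟩
  · rw [switch_of_ne σ hys hyr] at hl; exact Or.inl hl
  · by_cases hxs : x = s
    · subst hxs
      exact absurd (Or.inr ⟨y, hx.symm, hx1.symm, hx2.symm⟩) hs
    by_cases hxr : x = r
    · subst hxr
      exact absurd (Or.inr ⟨y, hx.symm, hx1.symm, hx2.symm⟩) hr
    rw [switch_of_ne σ hys hyr, switch_of_ne σ hxs hxr] at hx2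
    exact Or.inr ⟨x, hx, hx1, hx2⟩

variable [Fintype S] [Fintype T]

/-- The stubs that are part of a self-loop or of a multiple edge. -/
def badStubs (src : S → V) (tgt : T → V) (σ : S ≃ T) : Finset S :=
  Finset.univ.filter fun s => IsBadStub src tgt σ s

/-- The pairings without self-loops and multiple edges. -/
def simpleEquivs (src : S → V) (tgt : T → V) : Finset (S ≃ T) :=
  Finset.univ.filter fun σ => ∀ s, ¬ IsBadStub src tgt σ s

/-- Few stubs are excluded as partners for a switch. -/
lemma card_not_isSwitch_le (src : S → V) (tgt : T → V) (D : ℕ)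
    (hs : ∀ v, (Finset.univ.filter fun s => src s = v).card ≤ D)
    (ht : ∀ v, (Finset.univ.filter fun t => tgt t = v).card ≤ D) (σ : S ≃ T) (s : S) :
    (Finset.univ.filter fun r => ¬ IsSwitch src tgt σ s r).card ≤ 2 * D * (D + 1) := by
  have ht' : ∀ v, (Finset.univ.filter fun x => tgt (σ x) = v).card ≤ D := by
    intro v
    refine le_trans (le_of_eq ?_) (ht v)
    refine Finset.card_bij (fun x _ => σ x) ?_ ?_ ?_
    · intro x hx; simpa using hx
    · intro x _ y _ h; exact σ.injective h
    · intro t h; exact ⟨σ.symm t, by simpa using h, by simp⟩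
  let N₁ : Finset V := insert (src s)
    ((Finset.univ.filter fun x => src x = src s).image fun x => tgt (σ x))
  let N₂ : Finset V := insert (tgt (σ s))
    ((Finset.univ.filter fun x => tgt (σ x) = tgt (σ s)).image fun x => src x)
  have hN₁ : N₁.card ≤ D + 1 := (Finset.card_insert_le _ _).trans
    (Nat.succ_le_succ (Finset.card_image_le.trans (hs _)))
  have hN₂ : N₂.card ≤ D + 1 := (Finset.card_insert_le _ _).trans
    (Nat.succ_le_succ (Finset.card_image_le.trans (ht' _)))
  have hsub : (Finset.univ.filter fun r => ¬ IsSwitch src tgt σ s r) ⊆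
      (N₁.biUnion fun v => Finset.univ.filter fun x => tgt (σ x) = v) ∪
      (N₂.biUnion fun v => Finset.univ.filter fun x => src x = v) := by
    intro r hr
    simp only [Finset.mem_filter, Finset.mem_univ, true_and, IsSwitch, not_and_or] at hr
    simp only [Finset.mem_union, Finset.mem_biUnion, Finset.mem_filter, Finset.mem_univ, true_and,
      exists_eq_right', N₁, N₂, Finset.mem_insert, Finset.mem_image]
    push Not at hr
    rcases hr with (h | ⟨x, h, h'⟩) | (h | ⟨x, h, h'⟩)
    · exact Or.inl (Or.inl h)
    · exact Or.inl (Or.inr ⟨x, h, h'⟩)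
    · exact Or.inr (Or.inl h)
    · exact Or.inr (Or.inr ⟨x, h, h'⟩)
  refine (Finset.card_le_card hsub).trans ((Finset.card_union_le _ _).trans ?_)
  have e1 := Finset.card_biUnion_le_card_mul N₁
    (fun v => Finset.univ.filter fun x => tgt (σ x) = v) D (fun v _ => ht' v)
  have e2 := Finset.card_biUnion_le_card_mul N₂
    (fun v => Finset.univ.filter fun x => src x = v) D (fun v _ => hs v)
  nlinarith [Nat.mul_le_mul_right D hN₁, Nat.mul_le_mul_right D hN₂]

lemma exists_isSwitch (src : S → V) (tgt : T → V) (D : ℕ)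
    (hs : ∀ v, (Finset.univ.filter fun s => src s = v).card ≤ D)
    (ht : ∀ v, (Finset.univ.filter fun t => tgt t = v).card ≤ D)
    (hD : 2 * D * (D + 1) < Fintype.card S) (σ : S ≃ T) (s : S) :
    ∃ r, IsSwitch src tgt σ s r := by
  by_contra! h
  have := card_not_isSwitch_le src tgt D hs ht σ s
  rw [Finset.filter_true_of_mem (fun r _ => h r), Finset.card_univ] at this
  omega

/-- If the degrees are small compared to the number of stubs, a simple pairing exists. -/
lemma simpleEquivs_nonempty (src : S → V) (tgt : T → V) (D : ℕ)
    (hs : ∀ v, (Finset.univ.filter fun s => src s = v).card ≤ D)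
    (ht : ∀ v, (Finset.univ.filter fun t => tgt t = v).card ≤ D)
    (hD : 2 * D * (D + 1) < Fintype.card S) (hST : Fintype.card S = Fintype.card T) :
    (simpleEquivs src tgt).Nonempty := by
  have key : ∀ (N : ℕ) (σ : S ≃ T), (badStubs src tgt σ).card ≤ N →
      (simpleEquivs src tgt).Nonempty := by
    intro N
    induction N with
    | zero =>
      intro σ h
      refine ⟨σ, ?_⟩
      simp only [simpleEquivs, Finset.mem_filter, Finset.mem_univ, true_and]
      intro s hbad
      have : s ∈ badStubs src tgt σ := by simp [badStubs, hbad]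
      simp_all
    | succ N ih =>
      intro σ h
      by_cases hne : (badStubs src tgt σ).Nonempty
      · obtain ⟨s, hsb⟩ := hne
        obtain ⟨r, hr⟩ := exists_isSwitch src tgt D hs ht hD σ s
        refine ih (switch σ s r) ?_
        have hlt : badStubs src tgt (switch σ s r) ⊂ badStubs src tgt σ := by
          rw [Finset.ssubset_iff_of_subset]
          · refine ⟨s, hsb, fun h' => ?_⟩
            exact (IsBadStub.of_switch hr (Finset.mem_filter.1 h').2).1 rfl
          · intro y hy
            exact Finset.mem_filter.2 ⟨Finset.mem_univ _,
              (IsBadStub.of_switch hr (Finset.mem_filter.1 hy).2).2⟩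
        have := Finset.card_lt_card hlt
        omega
      · rw [Finset.not_nonempty_iff_eq_empty] at hne
        exact ih σ (by simp [hne])
  exact key _ (Fintype.equivOfCardEq hST) le_rfl

/-- Prescribing one further partner makes simple pairings rarer by about the number of stubs. -/
lemma card_simpleEquivs_filter_insert_le (src : S → V) (tgt : T → V) (D : ℕ)
    (hs : ∀ v, (Finset.univ.filter fun s => src s = v).card ≤ D)
    (ht : ∀ v, (Finset.univ.filter fun t => tgt t = v).card ≤ D)
    (R : Finset S) (τ : S → T) (s : S) (hsR : s ∉ R) (t : T) :
    ((simpleEquivs src tgt).filter fun σ => σ s = t ∧ ∀ x ∈ R, σ x = τ x).card *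
      (Fintype.card S - (2 * D * (D + 1) + R.card)) ≤
    ((simpleEquivs src tgt).filter fun σ => ∀ x ∈ R, σ x = τ x).card := by
  set A := (simpleEquivs src tgt).filter fun σ => σ s = t ∧ ∀ x ∈ R, σ x = τ x with hA
  let good : (S ≃ T) → Finset S := fun σ =>
    Finset.univ.filter fun r => IsSwitch src tgt σ s r ∧ r ∉ R
  have hgood : ∀ σ, Fintype.card S - (2 * D * (D + 1) + R.card) ≤ (good σ).card := by
    intro σ
    have h1 : (Finset.univ : Finset S) ⊆
        good σ ∪ ((Finset.univ.filter fun r => ¬ IsSwitch src tgt σ s r) ∪ R) := by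
      intro r _
      by_cases h : IsSwitch src tgt σ s r <;> by_cases h' : r ∈ R <;> simp [good, h, h']
    have h2 := Finset.card_le_card h1
    have h3 := Finset.card_union_le (good σ)
      ((Finset.univ.filter fun r => ¬ IsSwitch src tgt σ s r) ∪ R)
    have h4 := Finset.card_union_le (Finset.univ.filter fun r => ¬ IsSwitch src tgt σ s r) R
    have h5 := card_not_isSwitch_le src tgt D hs ht σ s
    rw [Finset.card_univ] at h2
    omega
  calc A.card * (Fintype.card S - (2 * D * (D + 1) + R.card))
      ≤ ∑ σ ∈ A, (good σ).card := by
        rw [← smul_eq_mul]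
        exact Finset.card_nsmul_le_sum _ _ _ fun σ _ => hgood σ
    _ = (A.sigma good).card := (Finset.card_sigma _ _).symm
    _ ≤ _ := by
        refine Finset.card_le_card_of_injOn (fun p => switch p.1 s p.2) ?_ ?_
        · rintro ⟨σ, r⟩ hp
          simp only [Finset.coe_sigma, Set.mem_sigma_iff, Finset.mem_coe] at hp
          obtain ⟨hσ, hr⟩ := hp
          simp only [hA, simpleEquivs, Finset.mem_filter, Finset.mem_univ, true_and] at hσ
          simp only [good, Finset.mem_filter, Finset.mem_univ, true_and] at hr
          simp only [Finset.coe_filter, simpleEquivs, Finset.mem_filter, Finset.mem_univ, true_and,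
            Set.mem_ofPred_eq]
          refine ⟨fun y hy => hσ.1 y (IsBadStub.of_switch hr.1 hy).2, fun x hx => ?_⟩
          have hxs : x ≠ s := fun h => hsR (h ▸ hx)
          have hxr : x ≠ r := fun h => hr.2 (h ▸ hx)
          rw [switch_of_ne σ hxs hxr]
          exact hσ.2.2 x hx
        · rintro ⟨σ, r⟩ hp ⟨σ', r'⟩ hp' heq
          simp only [Finset.coe_sigma, Set.mem_sigma_iff, Finset.mem_coe] at hp hp'
          have h1 : σ s = t := (Finset.mem_filter.1 hp.1).2.1
          have h1' : σ' s = t := (Finset.mem_filter.1 hp'.1).2.1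
          simp only at heq
          have hrr : r = r' := by
            apply (switch σ s r).injective
            rw [switch_right, heq, switch_right, h1, h1']
          subst hrr
          have : σ = σ' := by rw [← switch_switch σ s r, heq, switch_switch]
          subst this
          rfl

/-- A single prescribed partner. -/
lemma card_simpleEquivs_filter_le (src : S → V) (tgt : T → V) (D : ℕ)
    (hs : ∀ v, (Finset.univ.filter fun s => src s = v).card ≤ D)
    (ht : ∀ v, (Finset.univ.filter fun t => tgt t = v).card ≤ D) (s : S) (t : T) :
    (((simpleEquivs src tgt).filter fun σ => σ s = t).card : ℝ) *
      ((Fintype.card S : ℝ) - (2 * D * (D + 1) + 1)) ≤ ((simpleEquivs src tgt).card : ℝ) := by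
  have h := card_simpleEquivs_filter_insert_le src tgt D hs ht ∅ (fun _ => t) s (by simp) t
  simp only [Finset.notMem_empty, false_imp_iff, implies_true, and_true, Finset.card_empty,
    add_zero, Finset.filter_true] at h
  have h' : (((simpleEquivs src tgt).filter fun σ => σ s = t).card : ℝ) *
      ((Fintype.card S - (2 * D * (D + 1)) : ℕ) : ℝ) ≤ ((simpleEquivs src tgt).card : ℝ) := by
    exact_mod_cast h
  -- With no other prescribed partner the extra 1 is superfluous; giving it away lets the one- and
  -- two-point bounds share the same L.
  refine le_trans (mul_le_mul_of_nonneg_left ?_ (Nat.cast_nonneg _)) h'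
  have : ((Fintype.card S : ℕ) : ℝ) ≤
      ((Fintype.card S - (2 * D * (D + 1)) + (2 * D * (D + 1)) : ℕ) : ℝ) := by
    exact_mod_cast le_tsub_add
  push_cast at this
  linarith

/-- Two prescribed partners. -/
lemma card_simpleEquivs_filter_and_le (src : S → V) (tgt : T → V) (D : ℕ)
    (hs : ∀ v, (Finset.univ.filter fun s => src s = v).card ≤ D)
    (ht : ∀ v, (Finset.univ.filter fun t => tgt t = v).card ≤ D)
    (hD : (2 * D * (D + 1) + 1 : ℝ) < Fintype.card S) {s s' : S} (hss : s ≠ s') (t t' : T) :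
    (((simpleEquivs src tgt).filter fun σ => σ s = t ∧ σ s' = t').card : ℝ) *
      ((Fintype.card S : ℝ) - (2 * D * (D + 1) + 1)) ^ 2 ≤ ((simpleEquivs src tgt).card : ℝ) := by
  have h := card_simpleEquivs_filter_insert_le src tgt D hs ht {s'} (fun _ => t') s (by simpa) t
  simp only [Finset.mem_singleton, forall_eq, Finset.card_singleton] at h
  have h' : (((simpleEquivs src tgt).filter fun σ => σ s = t ∧ σ s' = t').card : ℝ) *
      ((Fintype.card S - (2 * D * (D + 1) + 1) : ℕ) : ℝ) ≤
      (((simpleEquivs src tgt).filter fun σ => σ s' = t').card : ℝ) := by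
    exact_mod_cast h
  have hD' : 2 * D * (D + 1) + 1 ≤ Fintype.card S := by
    have : ((2 * D * (D + 1) + 1 : ℕ) : ℝ) < Fintype.card S := by push_cast; exact hD
    exact_mod_cast this.le
  rw [Nat.cast_sub hD'] at h'
  push_cast at h'
  rw [pow_two, ← mul_assoc]
  exact (mul_le_mul_of_nonneg_right h' (by linarith)).trans
    (card_simpleEquivs_filter_le src tgt D hs ht s' t')

end Switching

/-! ### Second moment of a centred sum over a random pairing. -/

section SecondMoment

variable {S T : Type*} [Fintype S] [Fintype T] [DecidableEq S] [DecidableEq T]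

/-- Second moment of `∑ f s * g (σ s)` for centred `g` and a random pairing `σ` whose one- and
two-point probabilities are at most `1 / L` and `1 / L ^ 2`. -/
lemma sum_sq_sum_mul_le (Q : Finset (S ≃ T)) {L : ℝ} (hL : 0 < L)
    (h₁ : ∀ s t, ((Q.filter fun σ => σ s = t).card : ℝ) * L ≤ Q.card)
    (h₂ : ∀ s s', s ≠ s' → ∀ t t',
      ((Q.filter fun σ => σ s = t ∧ σ s' = t').card : ℝ) * L ^ 2 ≤ Q.card)
    (hcard : Fintype.card S = Fintype.card T)
    (f : S → ℝ) (g : T → ℝ) (hg : ∑ t, g t = 0) :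
    ∑ σ ∈ Q, (∑ s, f s * g (σ s)) ^ 2 ≤
      Q.card * (2 / L + (Fintype.card S : ℝ) ^ 2 / L ^ 2 - 1) *
        ((∑ s, f s ^ 2) * ∑ t, g t ^ 2) := by
  set m : ℝ := (Fintype.card S : ℝ) with hm
  set q : ℝ := (Q.card : ℝ) with hq
  let N : S → S → T → T → ℝ := fun s s' t t' =>
    ((Q.filter fun σ => σ s = t ∧ σ s' = t').card : ℝ)
  let M : S → T → ℝ := fun s t => ((Q.filter fun σ => σ s = t).card : ℝ)
  have hM : ∀ s t, M s t ≤ q / L := fun s t => (le_div_iff₀ hL).2 (h₁ s t)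
  have hN : ∀ s s', s ≠ s' → ∀ t t', N s s' t t' ≤ q / L ^ 2 := fun s s' h t t' =>
    (le_div_iff₀ (by positivity)).2 (h₂ s s' h t t')
  have hexp : ∑ σ ∈ Q, (∑ s, f s * g (σ s)) ^ 2 =
      (∑ s, ∑ t, f s ^ 2 * g t ^ 2 * M s t) +
      ∑ s, ∑ s' ∈ Finset.univ.erase s, ∑ t, ∑ t', f s * f s' * (g t * g t') * N s s' t t' := by
    have e1 : ∀ s, ∑ σ ∈ Q, f s * g (σ s) * (f s * g (σ s)) = ∑ t, f s ^ 2 * g t ^ 2 * M s t := by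
      intro s
      rw [← Finset.sum_fiberwise Q (fun σ => σ s)]
      refine Finset.sum_congr rfl fun t _ => ?_
      rw [Finset.sum_congr rfl (g := fun _ => f s ^ 2 * g t ^ 2)]
      · simp [M, mul_comm]
      · intro σ hσ; rw [(Finset.mem_filter.1 hσ).2]; ring
    have e2 : ∀ s s', ∑ σ ∈ Q, f s * g (σ s) * (f s' * g (σ s')) =
        ∑ t, ∑ t', f s * f s' * (g t * g t') * N s s' t t' := by
      intro s s'
      rw [← Finset.sum_product', ← Finset.sum_fiberwise Q (fun σ => (σ s, σ s'))]
      refine Finset.sum_congr rfl fun p _ => ?_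
      rw [Finset.sum_congr rfl (g := fun _ => f s * f s' * (g p.1 * g p.2))]
      · simp only [Finset.sum_const, nsmul_eq_mul, N]
        rw [mul_comm]
        congr 4
        ext σ
        simp [Prod.ext_iff]
      · intro σ hσ
        have := (Finset.mem_filter.1 hσ).2
        subst this
        ring
    calc ∑ σ ∈ Q, (∑ s, f s * g (σ s)) ^ 2
        = ∑ s, ∑ s', ∑ σ ∈ Q, f s * g (σ s) * (f s' * g (σ s')) := by
          simp_rw [pow_two, Finset.sum_mul_sum]
          rw [Finset.sum_comm]
          refine Finset.sum_congr rfl fun s _ => Finset.sum_comm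
      _ = _ := by
          rw [← Finset.sum_add_distrib]
          refine Finset.sum_congr rfl fun s _ => ?_
          rw [← Finset.add_sum_erase _ _ (Finset.mem_univ s), e1]
          congr 1
          exact Finset.sum_congr rfl fun s' _ => e2 s s'
  set A : ℝ := ∑ s, f s ^ 2 with hA
  set B : ℝ := ∑ t, g t ^ 2 with hB
  have hdiag : (∑ s, ∑ t, f s ^ 2 * g t ^ 2 * M s t) ≤ q / L * (A * B) := by
    rw [hA, hB, Finset.sum_mul_sum, Finset.mul_sum]
    refine Finset.sum_le_sum fun s _ => ?_
    rw [Finset.mul_sum]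
    refine Finset.sum_le_sum fun t _ => ?_
    rw [mul_comm]
    exact mul_le_mul_of_nonneg_right (hM s t) (by positivity)
  -- The deficit of the two-point counts below their upper bound. As `g` sums to zero, replacing `N`
  -- by `-δ` does not change the off-diagonal sum.
  let δ : S → S → T → T → ℝ := fun s s' t t' => q / L ^ 2 - N s s' t t'
  have hoff : ∑ s, ∑ s' ∈ Finset.univ.erase s, ∑ t, ∑ t', f s * f s' * (g t * g t') * N s s' t t' =
      - ∑ s, ∑ s' ∈ Finset.univ.erase s, ∑ t, ∑ t', f s * f s' * (g t * g t') * δ s s' t t' := by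
    rw [eq_neg_iff_add_eq_zero, ← Finset.sum_add_distrib]
    refine Finset.sum_eq_zero fun s _ => ?_
    rw [← Finset.sum_add_distrib]
    refine Finset.sum_eq_zero fun s' _ => ?_
    rw [← Finset.sum_add_distrib]
    have : ∀ t, ∑ t', f s * f s' * (g t * g t') * N s s' t t' +
        ∑ t', f s * f s' * (g t * g t') * δ s s' t t' =
        f s * f s' * g t * (q / L ^ 2) * ∑ t', g t' := by
      intro t
      rw [← Finset.sum_add_distrib, Finset.mul_sum]
      refine Finset.sum_congr rfl fun t' _ => ?_
      simp only [δ]; ring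
    simp [this, hg]
  -- The squares are paired crosswise, `f s` with `g t'`, so that the remaining sum of `δ` runs over
  -- `s'` and `t`. The corresponding sum of `N` has a lower bound because every `t'` has a partner;
  -- keeping `s` and `t` fixed would require a lower bound for a one-point count.
  have hpair : ∀ s s', s' ∈ Finset.univ.erase s → ∀ t t',
      - (f s * f s' * (g t * g t') * δ s s' t t') ≤
      (1 / 2) * (f s ^ 2 * g t' ^ 2 * δ s s' t t') + (1 / 2) * (f s' ^ 2 * g t ^ 2 * δ s s' t t') := by
    intro s s' hs t t'
    have hδ : 0 ≤ δ s s' t t' := sub_nonneg.2 (hN s s' (Finset.ne_of_mem_erase hs).symm t t')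
    nlinarith [mul_nonneg (sq_nonneg (f s * g t' + f s' * g t)) hδ]
  have hNsum : ∀ s t', q - q / L ≤ ∑ s' ∈ Finset.univ.erase s, ∑ t, N s s' t t' := by
    intro s t'
    have e1 : ∀ s', ∑ t, N s s' t t' = M s' t' := by
      intro s'
      simp only [N, M]
      rw [← Nat.cast_sum, Finset.card_eq_sum_card_fiberwise (f := fun σ : S ≃ T => σ s)
        (t := Finset.univ) (fun _ _ => by simp)]
      simp only [Finset.filter_filter, and_comm]
    have e2 : ∑ s', M s' t' = q := by
      simp only [M, hq]
      rw [← Nat.cast_sum, Finset.card_eq_sum_card_fiberwise (f := fun σ : S ≃ T => σ.symm t')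
        (s := Q) (t := Finset.univ) (fun _ _ => by simp)]
      congr 1
      refine Finset.sum_congr rfl fun s' _ => ?_
      congr 1
      ext σ
      have : σ.symm t' = s' ↔ σ s' = t' := by rw [Equiv.symm_apply_eq, eq_comm]
      simp [this]
    rw [Finset.sum_congr rfl (fun s' _ => e1 s')]
    have := hM s t'
    rw [← Finset.add_sum_erase _ _ (Finset.mem_univ s)] at e2
    linarith
  have hδsum : ∀ s t', ∑ s' ∈ Finset.univ.erase s, ∑ t, δ s s' t t' ≤
      q * (1 / L + m ^ 2 / L ^ 2 - 1) := by
    intro s t'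
    have : ∑ s' ∈ Finset.univ.erase s, ∑ t, δ s s' t t' =
        ((Finset.univ.erase s).card : ℝ) * (m * (q / L ^ 2)) -
        ∑ s' ∈ Finset.univ.erase s, ∑ t, N s s' t t' := by
      simp only [δ, Finset.sum_sub_distrib, Finset.sum_const, Finset.card_univ, nsmul_eq_mul, hm,
        hcard]
    rw [this]
    have hc : ((Finset.univ.erase s).card : ℝ) ≤ m := by
      rw [hm, ← Finset.card_univ]; exact_mod_cast Finset.card_le_card (Finset.erase_subset _ _)
    have h3 := mul_le_mul_of_nonneg_right hc (show 0 ≤ m * (q / L ^ 2) by positivity)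
    have h4 := hNsum s t'
    have : q * (1 / L + m ^ 2 / L ^ 2 - 1) = m * (m * (q / L ^ 2)) - (q - q / L) := by
      field_simp; ring
    linarith
  have hδsum' : ∀ s' t, ∑ s ∈ Finset.univ.erase s', ∑ t', δ s s' t t' ≤
      q * (1 / L + m ^ 2 / L ^ 2 - 1) := by
    intro s' t
    refine le_trans (le_of_eq ?_) (hδsum s' t)
    refine Finset.sum_congr rfl fun s _ => Finset.sum_congr rfl fun t' _ => ?_
    simp only [δ, N, and_comm]
  have hswap : ∀ F : S → S → ℝ, ∑ s, ∑ s' ∈ Finset.univ.erase s, F s s' =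
      ∑ s', ∑ s ∈ Finset.univ.erase s', F s s' := by
    intro F
    refine Finset.sum_comm' fun s s' => ?_
    simp [eq_comm]
  have hbound1 : ∑ s, ∑ s' ∈ Finset.univ.erase s, ∑ t, ∑ t', f s ^ 2 * g t' ^ 2 * δ s s' t t' ≤
      q * (1 / L + m ^ 2 / L ^ 2 - 1) * (A * B) := by
    rw [hA, hB, Finset.sum_mul_sum, Finset.mul_sum]
    refine Finset.sum_le_sum fun s _ => ?_
    rw [Finset.mul_sum]
    have : ∑ s' ∈ Finset.univ.erase s, ∑ t, ∑ t', f s ^ 2 * g t' ^ 2 * δ s s' t t' =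
        ∑ t', f s ^ 2 * g t' ^ 2 * ∑ s' ∈ Finset.univ.erase s, ∑ t, δ s s' t t' := by
      simp_rw [Finset.mul_sum]
      rw [Finset.sum_comm]
      conv_rhs => rw [Finset.sum_comm]
      rw [Finset.sum_comm]
      refine Finset.sum_congr rfl fun s' _ => Finset.sum_comm
    rw [this]
    refine Finset.sum_le_sum fun t' _ => ?_
    rw [mul_comm]
    exact mul_le_mul_of_nonneg_right (hδsum s t') (by positivity)
  have hbound2 : ∑ s, ∑ s' ∈ Finset.univ.erase s, ∑ t, ∑ t', f s' ^ 2 * g t ^ 2 * δ s s' t t' ≤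
      q * (1 / L + m ^ 2 / L ^ 2 - 1) * (A * B) := by
    rw [hswap, hA, hB, Finset.sum_mul_sum, Finset.mul_sum]
    refine Finset.sum_le_sum fun s' _ => ?_
    rw [Finset.mul_sum, Finset.sum_comm]
    refine Finset.sum_le_sum fun t _ => ?_
    simp_rw [← Finset.mul_sum]
    rw [mul_comm]
    exact mul_le_mul_of_nonneg_right (hδsum' s' t) (by positivity)
  have hoff' : ∑ s, ∑ s' ∈ Finset.univ.erase s, ∑ t, ∑ t', f s * f s' * (g t * g t') * N s s' t t' ≤
      q * (1 / L + m ^ 2 / L ^ 2 - 1) * (A * B) := by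
    rw [hoff]
    simp_rw [← Finset.sum_neg_distrib]
    have : ∑ s, ∑ s' ∈ Finset.univ.erase s, ∑ t, ∑ t',
        -(f s * f s' * (g t * g t') * δ s s' t t') ≤
        ∑ s, ∑ s' ∈ Finset.univ.erase s, ∑ t, ∑ t',
        ((1 / 2) * (f s ^ 2 * g t' ^ 2 * δ s s' t t') +
          (1 / 2) * (f s' ^ 2 * g t ^ 2 * δ s s' t t')) :=
      Finset.sum_le_sum fun s _ => Finset.sum_le_sum fun s' hs' => Finset.sum_le_sum fun t _ =>
        Finset.sum_le_sum fun t' _ => hpair s s' hs' t t'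
    refine this.trans ?_
    have h3 : ∑ s, ∑ s' ∈ Finset.univ.erase s, ∑ t, ∑ t',
        ((1 / 2) * (f s ^ 2 * g t' ^ 2 * δ s s' t t') +
          (1 / 2) * (f s' ^ 2 * g t ^ 2 * δ s s' t t')) =
        (1 / 2) * (∑ s, ∑ s' ∈ Finset.univ.erase s, ∑ t, ∑ t', f s ^ 2 * g t' ^ 2 * δ s s' t t') +
        (1 / 2) *
          ∑ s, ∑ s' ∈ Finset.univ.erase s, ∑ t, ∑ t', f s' ^ 2 * g t ^ 2 * δ s s' t t' := by
      simp only [Finset.sum_add_distrib, Finset.mul_sum]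
    rw [h3]
    linarith
  rw [hexp]
  have : q * (2 / L + m ^ 2 / L ^ 2 - 1) * (A * B) =
      q / L * (A * B) + q * (1 / L + m ^ 2 / L ^ 2 - 1) * (A * B) := by ring
  linarith

end SecondMoment

/-! ### From stubs to edges: degrees and edge sums of a simple pairing. -/

section Pairings

variable {n : ℕ}

/-- The degree of type `α` that a bi-degree sequence prescribes at `v`. -/
def seqDegree (α : DegType) (d : BiSeq n) (v : Fin n) : ℕ :=
  match α with
  | .plus => d.2 v
  | .minus => d.1 v

lemma card_sigma_fin_fiber (g : Fin n → ℕ) (v : Fin n) :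
    (Finset.univ.filter fun s : (v : Fin n) × Fin (g v) => s.1 = v).card = g v := by
  have : (Finset.univ.filter fun s : (v : Fin n) × Fin (g v) => s.1 = v) =
      Finset.univ.map (Function.Embedding.sigmaMk v) := by
    ext ⟨w, i⟩
    simp only [Finset.mem_filter, Finset.mem_univ, true_and, Finset.mem_map,
      Function.Embedding.sigmaMk_apply]
    constructor
    · rintro rfl; exact ⟨i, rfl⟩
    · rintro ⟨j, h⟩; exact (congrArg Sigma.fst h).symm
  rw [this]; simp

lemma sum_sigma_fin (g : Fin n → ℕ) (F : Fin n → ℝ) :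
    ∑ s : (v : Fin n) × Fin (g v), F s.1 = ∑ v, (g v : ℝ) * F v := by
  rw [Fintype.sum_sigma]
  simp

variable {d : BiSeq n}

lemma mem_simplePairings {σ : Pairing d} : σ ∈ simplePairings d ↔ IsSimple σ := by
  simp [simplePairings]

lemma simplePairings_eq (d : BiSeq n) : simplePairings d =
    simpleEquivs (fun s : (v : Fin n) × Fin (d.2 v) => s.1)
      (fun t : (v : Fin n) × Fin (d.1 v) => t.1) := by
  ext σ
  simp only [mem_simplePairings, simpleEquivs, Finset.mem_filter, Finset.mem_univ, true_and,
    IsSimple, IsBadStub, stubEdge, not_or, forall_and, Function.Injective, Prod.mk.injEq]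
  refine and_congr Iff.rfl ⟨fun h s ⟨x, hx, h1, h2⟩ => hx (h ⟨h1, h2⟩), fun h x y hxy => ?_⟩
  by_contra hne
  exact h y ⟨x, hne, hxy.1, hxy.2⟩

lemma sum_pairingEdges {σ : Pairing d} (hσ : IsSimple σ) {M : Type*} [AddCommMonoid M]
    (F : Fin n × Fin n → M) : ∑ e ∈ pairingEdges σ, F e = ∑ s, F (stubEdge σ s) := by
  rw [pairingEdges, Finset.sum_image]
  exact fun x _ y _ h => hσ.2 h

/-- Simplicity makes stubs and edges correspond one to one, so no stub is lost when the multigraph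
is read as an edge set. -/
lemma degree_pairingEdges {σ : Pairing d} (hσ : IsSimple σ) (α : DegType) (v : Fin n) :
    degree (pairingEdges σ) α v = seqDegree α d v := by
  cases α
  · simp only [degree, seqDegree]
    rw [Finset.card_filter, sum_pairingEdges hσ, ← Finset.card_filter]
    exact card_sigma_fin_fiber d.2 v
  · simp only [degree, seqDegree]
    rw [Finset.card_filter, sum_pairingEdges hσ]
    refine (Equiv.sum_comp σ
      (fun t : (v : Fin n) × Fin (d.1 v) => if t.1 = v then 1 else 0)).trans ?_
    rw [← Finset.card_filter]
    exact card_sigma_fin_fiber d.1 v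

lemma srcDegree_stubEdge {σ : Pairing d} (hσ : IsSimple σ) (α : DegType)
    (s : (v : Fin n) × Fin (d.2 v)) :
    srcDegree (pairingEdges σ) α (stubEdge σ s) = seqDegree α d s.1 :=
  degree_pairingEdges hσ α _

lemma tgtDegree_stubEdge {σ : Pairing d} (hσ : IsSimple σ) (β : DegType)
    (s : (v : Fin n) × Fin (d.2 v)) :
    tgtDegree (pairingEdges σ) β (stubEdge σ s) = seqDegree β d (σ s).1 :=
  degree_pairingEdges hσ β _

lemma sum_pairingEdges_degrees {σ : Pairing d} (hσ : IsSimple σ) (α β : DegType)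
    (F : ℕ → ℕ → ℝ) :
    ∑ e ∈ pairingEdges σ,
      F (srcDegree (pairingEdges σ) α e) (tgtDegree (pairingEdges σ) β e) =
    ∑ s, F (seqDegree α d s.1) (seqDegree β d (σ s).1) := by
  rw [sum_pairingEdges hσ]
  simp only [srcDegree_stubEdge hσ, tgtDegree_stubEdge hσ]

/-- A vertex is the source of as many edges as it has outbound stubs. Consequently one-sided edge
sums, and with them average ranks and their normalization, depend on `d` alone and not on the
pairing. -/
lemma sum_pairingEdges_srcDegree {σ : Pairing d} (hσ : IsSimple σ) (α : DegType) (F : ℕ → ℝ) :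
    ∑ e ∈ pairingEdges σ, F (srcDegree (pairingEdges σ) α e) =
    ∑ v, (d.2 v : ℝ) * F (seqDegree α d v) := by
  rw [sum_pairingEdges_degrees hσ α α (fun a _ => F a),
    sum_sigma_fin d.2 (fun v => F (seqDegree α d v))]

lemma sum_pairingEdges_tgtDegree {σ : Pairing d} (hσ : IsSimple σ) (β : DegType) (F : ℕ → ℝ) :
    ∑ e ∈ pairingEdges σ, F (tgtDegree (pairingEdges σ) β e) =
    ∑ v, (d.1 v : ℝ) * F (seqDegree β d v) := by
  rw [sum_pairingEdges_degrees hσ β β (fun _ b => F b),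
    Equiv.sum_comp σ (fun t : (v : Fin n) × Fin (d.1 v) => F (seqDegree β d t.1)),
    sum_sigma_fin d.1 (fun v => F (seqDegree β d v))]

lemma card_pairingEdges {σ : Pairing d} (hσ : IsSimple σ) :
    (pairingEdges σ).card = ∑ v, d.2 v := by
  rw [pairingEdges, Finset.card_image_of_injective _ hσ.2]
  simp

/-- The bound for the second moment of a normalized covariance between the end points of the edges
of a simple random pairing of `m` stubs, when the degrees are at most `D`. -/
def covBound (m D : ℝ) : ℝ :=
  2 / (m - (2 * D * (D + 1) + 1)) + m ^ 2 / (m - (2 * D * (D + 1) + 1)) ^ 2 - 1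

/-- Second moment of the covariance of functions of the degrees at the end points of the edges. -/
lemma sum_simplePairings_sq_le (d : BiSeq n) (D : ℕ) (h₁ : ∀ v, d.1 v ≤ D) (h₂ : ∀ v, d.2 v ≤ D)
    (hbal : ∑ v, d.1 v = ∑ v, d.2 v)
    (hD : (2 * D * (D + 1) + 1 : ℝ) < ((∑ v, d.2 v : ℕ) : ℝ)) (α β : DegType) (x y : ℕ → ℝ)
    (hy : ∑ v, (d.1 v : ℝ) * y (seqDegree β d v) = 0) :
    ∑ σ ∈ simplePairings d, (∑ e ∈ pairingEdges σ,
        x (srcDegree (pairingEdges σ) α e) * y (tgtDegree (pairingEdges σ) β e)) ^ 2 ≤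
      (simplePairings d).card * covBound ((∑ v, d.2 v : ℕ) : ℝ) D *
        ((∑ v, (d.2 v : ℝ) * x (seqDegree α d v) ^ 2) *
          ∑ v, (d.1 v : ℝ) * y (seqDegree β d v) ^ 2) := by
  classical
  have hS : Fintype.card ((v : Fin n) × Fin (d.2 v)) = ∑ v, d.2 v := by simp
  have hT : Fintype.card ((v : Fin n) × Fin (d.1 v)) = ∑ v, d.2 v := by simp [hbal]
  rw [Finset.sum_congr rfl (g := fun σ : Pairing d =>
    (∑ s : (v : Fin n) × Fin (d.2 v), x (seqDegree α d s.1) * y (seqDegree β d (σ s).1)) ^ 2)]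
  swap
  · intro σ hσ
    rw [sum_pairingEdges_degrees (mem_simplePairings.1 hσ) α β (fun a b => x a * y b)]
  rw [← sum_sigma_fin d.2 (fun v => x (seqDegree α d v) ^ 2),
    ← sum_sigma_fin d.1 (fun v => y (seqDegree β d v) ^ 2)]
  have hs : ∀ v, (Finset.univ.filter fun s : (v : Fin n) × Fin (d.2 v) => s.1 = v).card ≤ D :=
    fun v => (card_sigma_fin_fiber d.2 v).trans_le (h₂ v)
  have ht : ∀ v, (Finset.univ.filter fun s : (v : Fin n) × Fin (d.1 v) => s.1 = v).card ≤ D :=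
    fun v => (card_sigma_fin_fiber d.1 v).trans_le (h₁ v)
  have key := sum_sq_sum_mul_le (simplePairings d)
    (L := ((∑ v, d.2 v : ℕ) : ℝ) - (2 * D * (D + 1) + 1)) (by linarith)
    (fun s t => by
      have := card_simpleEquivs_filter_le (fun s : (v : Fin n) × Fin (d.2 v) => s.1)
        (fun t : (v : Fin n) × Fin (d.1 v) => t.1) D (by convert hs) (by convert ht) s t
      rw [hS, ← simplePairings_eq] at this
      convert this)
    (fun s s' hss t t' => by
      have := card_simpleEquivs_filter_and_le (fun s : (v : Fin n) × Fin (d.2 v) => s.1)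
        (fun t : (v : Fin n) × Fin (d.1 v) => t.1) D (by convert hs) (by convert ht)
        (by rw [hS]; exact hD) hss t t'
      rw [hS, ← simplePairings_eq] at this
      convert this)
    (hS.trans hT.symm) (fun s => x (seqDegree α d s.1)) (fun t => y (seqDegree β d t.1))
    (by rw [sum_sigma_fin d.1 (fun v => y (seqDegree β d v)), hy])
  rw [hS] at key
  exact key

lemma mem_graphical_of_degree_le (d : BiSeq n) (D : ℕ) (h₁ : ∀ v, d.1 v ≤ D)
    (h₂ : ∀ v, d.2 v ≤ D) (hbal : ∑ v, d.1 v = ∑ v, d.2 v)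
    (hD : 2 * D * (D + 1) < ∑ v, d.2 v) : d ∈ graphical n := by
  classical
  change (simplePairings d).Nonempty
  rw [simplePairings_eq]
  refine simpleEquivs_nonempty _ _ D ?_ ?_ (by simpa using hD) (by simp [hbal])
  · intro v
    convert (card_sigma_fin_fiber d.2 v).trans_le (h₂ v)
  · intro v
    convert (card_sigma_fin_fiber d.1 v).trans_le (h₁ v)

end Pairings

/-! ### Average ranks, their centring and the correlation written as a normalized covariance. -/

section Ranks

variable {n : ℕ}

/-- For two edges the contributions of each to the rank of the other add up to one, whether or not
they are tied; the double sum is therefore half of |E|². -/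
lemma sum_averageRank (E : Edges n) (a : Fin n × Fin n → ℕ) :
    ∑ e ∈ E, averageRank E a e = (E.card : ℝ) * ((E.card : ℝ) + 1) / 2 := by
  have h1 : ∑ e ∈ E, ∑ f ∈ E,
      ((if a f > a e then (1 : ℝ) else 0) + 1 / 2 * (if a f = a e then 1 else 0)) =
      ∑ e ∈ E, ∑ f ∈ E,
      ((if a e > a f then (1 : ℝ) else 0) + 1 / 2 * (if a e = a f then 1 else 0)) :=
    Finset.sum_comm
  have h2 : ∑ e ∈ E, ∑ f ∈ E,
      ((if a f > a e then (1 : ℝ) else 0) + 1 / 2 * (if a f = a e then 1 else 0)) +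
      ∑ e ∈ E, ∑ f ∈ E,
      ((if a e > a f then (1 : ℝ) else 0) + 1 / 2 * (if a e = a f then 1 else 0)) =
      (E.card : ℝ) * E.card := by
    rw [← Finset.sum_add_distrib]
    simp_rw [← Finset.sum_add_distrib]
    have : ∀ e f, ((if a f > a e then (1 : ℝ) else 0) + 1 / 2 * (if a f = a e then 1 else 0)) +
      ((if a e > a f then (1 : ℝ) else 0) + 1 / 2 * (if a e = a f then 1 else 0)) = 1 := by
      intro e f
      rcases lt_trichotomy (a e) (a f) with h | h | h
      · simp [h, h.ne, h.ne', h.le]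
      · simp [h]; norm_num
      · simp [h, h.ne, h.ne', h.le]
    simp only [this, Finset.sum_const, nsmul_eq_mul, mul_one]
  simp only [averageRank]
  rw [Finset.sum_add_distrib]
  simp only [Finset.sum_const, nsmul_eq_mul]
  linarith

/-- The average rank, centred. -/
def centeredRank (E : Edges n) (a : Fin n × Fin n → ℕ) (e : Fin n × Fin n) : ℝ :=
  averageRank E a e - ((E.card : ℝ) + 1) / 2

lemma sum_centeredRank (E : Edges n) (a : Fin n × Fin n → ℕ) :
    ∑ e ∈ E, centeredRank E a e = 0 := by
  simp only [centeredRank, Finset.sum_sub_distrib, sum_averageRank, Finset.sum_const, nsmul_eq_mul]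
  ring

lemma averageRank_mem (E : Edges n) (a : Fin n × Fin n → ℕ) (e : Fin n × Fin n) :
    1 / 2 ≤ averageRank E a e ∧ averageRank E a e ≤ 1 / 2 + (E.card : ℝ) := by
  have h : ∀ f, 0 ≤ ((if a f > a e then (1 : ℝ) else 0) + 1 / 2 * (if a f = a e then 1 else 0)) ∧
      ((if a f > a e then (1 : ℝ) else 0) + 1 / 2 * (if a f = a e then 1 else 0)) ≤ 1 := by
    intro f
    by_cases h1 : a f > a e
    · simp [h1, h1.ne']
    · by_cases h2 : a f = a e
      · simp [h2]; norm_num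
      · simp [h1, h2]
  have h0 := Finset.sum_nonneg fun f (_ : f ∈ E) => (h f).1
  have h1 := Finset.sum_le_sum fun f (_ : f ∈ E) => (h f).2
  simp only [Finset.sum_const, nsmul_eq_mul, mul_one] at h1
  simp only [averageRank]
  constructor <;> linarith

lemma abs_centeredRank_le (E : Edges n) (a : Fin n × Fin n → ℕ) (e : Fin n × Fin n) :
    |centeredRank E a e| ≤ E.card := by
  have := averageRank_mem E a e
  have h0 : (0 : ℝ) ≤ E.card := Nat.cast_nonneg _
  rw [abs_le, centeredRank]
  constructor <;> linarith

lemma four_mul_sum_averageRank_mul (E : Edges n) (a b : Fin n × Fin n → ℕ) :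
    4 * ∑ e ∈ E, averageRank E a e * averageRank E b e - (E.card : ℝ) * ((E.card : ℝ) + 1) ^ 2 =
      4 * ∑ e ∈ E, centeredRank E a e * centeredRank E b e := by
  have : ∀ e, averageRank E a e * averageRank E b e =
      centeredRank E a e * centeredRank E b e + ((E.card : ℝ) + 1) / 2 * centeredRank E a e +
      ((E.card : ℝ) + 1) / 2 * centeredRank E b e + (((E.card : ℝ) + 1) / 2) ^ 2 := by
    intro e; simp only [centeredRank]; ring
  simp only [this, Finset.sum_add_distrib, ← Finset.mul_sum, sum_centeredRank, Finset.sum_const,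
    nsmul_eq_mul]
  ring

lemma averageRankScale_eq (E : Edges n) (a : Fin n × Fin n → ℕ) :
    averageRankScale E a = 2 * Real.sqrt (∑ e ∈ E, centeredRank E a e ^ 2) := by
  have := four_mul_sum_averageRank_mul E a a
  simp only [← pow_two] at this
  rw [averageRankScale, this, Real.sqrt_mul (by norm_num)]
  congr 1
  rw [show (4 : ℝ) = 2 ^ 2 by norm_num, Real.sqrt_sq (by norm_num)]

lemma spearmanAverage_eq (α β : DegType) (E : Edges n) :
    spearmanAverage α β E =
      (∑ e ∈ E, centeredRank E (srcDegree E α) e * centeredRank E (tgtDegree E β) e) /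
        (Real.sqrt (∑ e ∈ E, centeredRank E (srcDegree E α) e ^ 2) *
          Real.sqrt (∑ e ∈ E, centeredRank E (tgtDegree E β) e ^ 2)) := by
  rw [spearmanAverage, four_mul_sum_averageRank_mul, averageRankScale_eq, averageRankScale_eq,
    show ∀ x y : ℝ, 2 * x * (2 * y) = 4 * (x * y) by intros; ring,
    mul_div_mul_left _ _ (by norm_num)]

/-- Spearman's rho with every random rank replaced by its mean, the average rank. -/
def meanSpearman (α β : DegType) (E : Edges n) : ℝ :=
  (12 * ∑ e ∈ E, averageRank E (srcDegree E α) e * averageRank E (tgtDegree E β) e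
      - 3 * (E.card : ℝ) * ((E.card : ℝ) + 1) ^ 2)
    / ((E.card : ℝ) ^ 3 - (E.card : ℝ))

lemma sum_centeredRank_sq_le (E : Edges n) (a : Fin n × Fin n → ℕ) :
    ∑ e ∈ E, centeredRank E a e ^ 2 ≤ (E.card : ℝ) ^ 3 := by
  calc ∑ e ∈ E, centeredRank E a e ^ 2 ≤ ∑ e ∈ E, (E.card : ℝ) ^ 2 :=
        Finset.sum_le_sum fun e _ => sq_le_sq' (by
          have := abs_le.1 (abs_centeredRank_le E a e); linarith) (abs_le.1 (abs_centeredRank_le E a e)).2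
    _ = _ := by simp; ring

/-- Both coefficients are multiples of the same covariance T. The product of the two square roots is
at most m³, which is at most 2(m³ - m) for m ≥ 2; with the prefactor 12 this gives 24. If that
product is zero, Cauchy–Schwarz forces T = 0, so the quotient read as zero does no harm. -/
lemma abs_meanSpearman_le (α β : DegType) (E : Edges n) (hE : 2 ≤ E.card) :
    |meanSpearman α β E| ≤ 24 * |spearmanAverage α β E| := by
  set T := ∑ e ∈ E, centeredRank E (srcDegree E α) e * centeredRank E (tgtDegree E β) e with hT
  set A := ∑ e ∈ E, centeredRank E (srcDegree E α) e ^ 2 with hA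
  set B := ∑ e ∈ E, centeredRank E (tgtDegree E β) e ^ 2 with hB
  set m : ℝ := (E.card : ℝ) with hm
  have hm2 : (2 : ℝ) ≤ m := by rw [hm]; exact_mod_cast hE
  have hA0 : 0 ≤ A := Finset.sum_nonneg fun _ _ => sq_nonneg _
  have hB0 : 0 ≤ B := Finset.sum_nonneg fun _ _ => sq_nonneg _
  have hcs : T ^ 2 ≤ A * B := Finset.sum_mul_sq_le_sq_mul_sq _ _ _
  have hms : meanSpearman α β E = 12 * T / (m ^ 3 - m) := by
    have := four_mul_sum_averageRank_mul E (srcDegree E α) (tgtDegree E β)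
    rw [meanSpearman]
    congr 1
    linarith
  have hden : m ^ 3 / 2 ≤ m ^ 3 - m := by 
    nlinarith [mul_nonneg (by linarith : 0 ≤ m) (by nlinarith : 0 ≤ m ^ 2 - 4)]
  have hm3 : 0 < m ^ 3 := by positivity
  rw [hms, spearmanAverage_eq, ← hT, ← hA, ← hB, abs_div, abs_div, abs_mul,
    abs_of_pos (by linarith : 0 < m ^ 3 - m), abs_of_nonneg (by positivity : 0 ≤ √A * √B)]
  by_cases hAB : √A * √B = 0
  · have : A * B = 0 := by
      rw [← Real.sqrt_mul hA0] at hAB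
      exact (Real.sqrt_eq_zero (mul_nonneg hA0 hB0)).1 hAB
    have hT0 : T = 0 := by
      rw [this] at hcs
      exact pow_eq_zero_iff (two_ne_zero) |>.1 (le_antisymm hcs (sq_nonneg _))
    simp [hT0]
  · have hpos : 0 < √A * √B := lt_of_le_of_ne (by positivity) (Ne.symm hAB)
    have hle : √A * √B ≤ m ^ 3 := by
      rw [← Real.sqrt_mul hA0]
      refine Real.sqrt_le_iff.2 ⟨hm3.le, ?_⟩
      have h1 := sum_centeredRank_sq_le E (srcDegree E α)
      have h2 := sum_centeredRank_sq_le E (tgtDegree E β)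
      calc A * B ≤ m ^ 3 * m ^ 3 := mul_le_mul h1 h2 hB0 hm3.le
        _ = _ := by ring
    rw [div_le_iff₀ (by linarith), show |(12 : ℝ)| = 12 by norm_num]
    have h5 : |T| = |T| / (√A * √B) * (√A * √B) := (div_mul_cancel₀ _ hAB).symm
    have h6 : 0 ≤ |T| / (√A * √B) := by positivity
    calc 12 * |T| = 12 * (|T| / (√A * √B) * (√A * √B)) := by rw [← h5]
      _ ≤ 12 * (|T| / (√A * √B) * (2 * (m ^ 3 - m))) := by
        have : √A * √B ≤ 2 * (m ^ 3 - m) := by linarith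
        gcongr
      _ = _ := by ring

end Ranks

/-! ### Second moments of the statistics, given the bi-degree sequence. -/

section PairingStatistics

variable {n : ℕ}

lemma covBound_nonneg {m D : ℝ} (hD₀ : 0 ≤ D) (hD : 2 * D * (D + 1) + 1 < m) :
    0 ≤ covBound m D := by
  have h1 : 0 < m - (2 * D * (D + 1) + 1) := by linarith
  have h2 : m - (2 * D * (D + 1) + 1) ≤ m := by nlinarith
  have h3 : 1 ≤ m ^ 2 / (m - (2 * D * (D + 1) + 1)) ^ 2 := by
    rw [one_le_div (by positivity)]
    exact pow_le_pow_left₀ h1.le h2 2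
  have h4 : 0 ≤ 2 / (m - (2 * D * (D + 1) + 1)) := by positivity
  rw [covBound]
  linarith

/-- Second moment of Spearman's rho with average ranks. -/
lemma sum_spearmanAverage_sq_le (d : BiSeq n) (D : ℕ) (h₁ : ∀ v, d.1 v ≤ D) (h₂ : ∀ v, d.2 v ≤ D)
    (hbal : ∑ v, d.1 v = ∑ v, d.2 v)
    (hD : (2 * D * (D + 1) + 1 : ℝ) < ((∑ v, d.2 v : ℕ) : ℝ)) (α β : DegType) :
    ∑ σ ∈ simplePairings d, spearmanAverage α β (pairingEdges σ) ^ 2 ≤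
      (simplePairings d).card * covBound ((∑ v, d.2 v : ℕ) : ℝ) D := by
  set m : ℝ := ((∑ v, d.2 v : ℕ) : ℝ) with hm
  -- The centred rank of an edge as a function of the degree at its end point. It is the same
  -- function for all simple pairings, so `A * B` is a constant that cancels.
  let x : ℕ → ℝ := fun k => 1 / 2 + ∑ v, (d.2 v : ℝ) *
    ((if seqDegree α d v > k then 1 else 0) + 1 / 2 * (if seqDegree α d v = k then 1 else 0)) -
    (m + 1) / 2
  let y : ℕ → ℝ := fun k => 1 / 2 + ∑ v, (d.1 v : ℝ) *
    ((if seqDegree β d v > k then 1 else 0) + 1 / 2 * (if seqDegree β d v = k then 1 else 0)) -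
    (m + 1) / 2
  have hx : ∀ σ ∈ simplePairings d, ∀ e, centeredRank (pairingEdges σ)
      (srcDegree (pairingEdges σ) α) e = x (srcDegree (pairingEdges σ) α e) := by
    intro σ hσ e
    rw [mem_simplePairings] at hσ
    simp only [centeredRank, averageRank, x]
    rw [sum_pairingEdges_srcDegree hσ α (fun a =>
      (if a > srcDegree (pairingEdges σ) α e then (1 : ℝ) else 0) +
        1 / 2 * (if a = srcDegree (pairingEdges σ) α e then 1 else 0)), card_pairingEdges hσ]
  have hy : ∀ σ ∈ simplePairings d, ∀ e, centeredRank (pairingEdges σ)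
      (tgtDegree (pairingEdges σ) β) e = y (tgtDegree (pairingEdges σ) β e) := by
    intro σ hσ e
    rw [mem_simplePairings] at hσ
    simp only [centeredRank, averageRank, y]
    rw [sum_pairingEdges_tgtDegree hσ β (fun a =>
      (if a > tgtDegree (pairingEdges σ) β e then (1 : ℝ) else 0) +
        1 / 2 * (if a = tgtDegree (pairingEdges σ) β e then 1 else 0)), card_pairingEdges hσ]
  set A := ∑ v, (d.2 v : ℝ) * x (seqDegree α d v) ^ 2 with hA
  set B := ∑ v, (d.1 v : ℝ) * y (seqDegree β d v) ^ 2 with hB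
  have hA0 : 0 ≤ A := Finset.sum_nonneg fun _ _ => by positivity
  have hB0 : 0 ≤ B := Finset.sum_nonneg fun _ _ => by positivity
  have hform : ∀ σ ∈ simplePairings d, spearmanAverage α β (pairingEdges σ) ^ 2 =
      (∑ e ∈ pairingEdges σ, x (srcDegree (pairingEdges σ) α e) *
        y (tgtDegree (pairingEdges σ) β e)) ^ 2 / (A * B) := by
    intro σ hσ
    have hσ' := mem_simplePairings.1 hσ
    rw [spearmanAverage_eq]
    simp only [hx σ hσ, hy σ hσ]
    rw [sum_pairingEdges_srcDegree hσ' α (fun a => x a ^ 2),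
      sum_pairingEdges_tgtDegree hσ' β (fun a => y a ^ 2), ← hA, ← hB, div_pow, mul_pow,
      Real.sq_sqrt hA0, Real.sq_sqrt hB0]
  rw [Finset.sum_congr rfl hform]
  by_cases hne : (simplePairings d).Nonempty
  swap
  · rw [Finset.not_nonempty_iff_eq_empty] at hne
    simp [hne]
  -- Centring is an identity about `d`, but it is read off from the ranks in any one simple pairing.
  have hysum : ∑ v, (d.1 v : ℝ) * y (seqDegree β d v) = 0 := by
    obtain ⟨σ, hσ⟩ := hne
    rw [← sum_pairingEdges_tgtDegree (mem_simplePairings.1 hσ) β y]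
    simp only [← hy σ hσ]
    exact sum_centeredRank _ _
  have hc := covBound_nonneg (Nat.cast_nonneg D) hD
  rw [← Finset.sum_div]
  have key := sum_simplePairings_sq_le d D h₁ h₂ hbal hD α β x y hysum
  exact div_le_of_le_mul₀ (mul_nonneg hA0 hB0) (by positivity) key

/-- The fraction of the edges whose source has `α`-degree `k`. -/
def srcFraction (α : DegType) (k : ℕ) (d : BiSeq n) : ℝ :=
  (∑ v, (d.2 v : ℝ) * if seqDegree α d v = k then 1 else 0) / ∑ v, (d.2 v : ℝ)

/-- The fraction of the edges whose target has `β`-degree `l`. -/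
def tgtFraction (β : DegType) (l : ℕ) (d : BiSeq n) : ℝ :=
  (∑ v, (d.1 v : ℝ) * if seqDegree β d v = l then 1 else 0) / ∑ v, (d.2 v : ℝ)

/-- Second moment of the empirical joint distribution around the product of its marginals. -/
lemma sum_empiricalJoint_sub_sq_le (d : BiSeq n) (D : ℕ) (h₁ : ∀ v, d.1 v ≤ D)
    (h₂ : ∀ v, d.2 v ≤ D) (hbal : ∑ v, d.1 v = ∑ v, d.2 v)
    (hD : (2 * D * (D + 1) + 1 : ℝ) < ((∑ v, d.2 v : ℕ) : ℝ)) (α β : DegType) (k l : ℕ) :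
    ∑ σ ∈ simplePairings d, (empiricalJoint α β k l (pairingEdges σ) -
        srcFraction α k d * tgtFraction β l d) ^ 2 ≤
      (simplePairings d).card * covBound ((∑ v, d.2 v : ℕ) : ℝ) D := by
  set m : ℝ := ((∑ v, d.2 v : ℕ) : ℝ) with hm
  have hm' : ∑ v, (d.2 v : ℝ) = m := by simp [hm]
  have hm'' : ∑ v, (d.1 v : ℝ) = m := by rw [hm, ← hbal]; simp
  have hm0 : 0 < m := lt_of_le_of_lt (by positivity) hD
  set A := ∑ v, (d.2 v : ℝ) * (if seqDegree α d v = k then 1 else 0) with hA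
  set B := ∑ v, (d.1 v : ℝ) * (if seqDegree β d v = l then 1 else 0) with hB
  let x : ℕ → ℝ := fun a => if a = k then 1 else 0
  -- Centring the target indicator alone suffices: the sum of `x` over the edges is `A`, so the
  -- covariance is the joint count minus `A * B / m`.
  let y : ℕ → ℝ := fun b => (if b = l then 1 else 0) - B / m
  have hysum : ∑ v, (d.1 v : ℝ) * y (seqDegree β d v) = 0 := by
    simp only [y, mul_sub, Finset.sum_sub_distrib, ← hB, ← Finset.sum_mul, hm'']
    field_simp
    ring
  have hform : ∀ σ ∈ simplePairings d, (empiricalJoint α β k l (pairingEdges σ) -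
        srcFraction α k d * tgtFraction β l d) ^ 2 =
      (∑ e ∈ pairingEdges σ, x (srcDegree (pairingEdges σ) α e) *
        y (tgtDegree (pairingEdges σ) β e)) ^ 2 / m ^ 2 := by
    intro σ hσ
    have hσ' := mem_simplePairings.1 hσ
    have e1 : ∑ e ∈ pairingEdges σ, x (srcDegree (pairingEdges σ) α e) = A :=
      sum_pairingEdges_srcDegree hσ' α x
    have e2 : ∑ e ∈ pairingEdges σ, x (srcDegree (pairingEdges σ) α e) *
        y (tgtDegree (pairingEdges σ) β e) =
        ((pairingEdges σ).filter fun e => srcDegree (pairingEdges σ) α e = k ∧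
          tgtDegree (pairingEdges σ) β e = l).card - A * (B / m) := by
      simp only [y, mul_sub, Finset.sum_sub_distrib, ← Finset.sum_mul, e1]
      congr 1
      rw [Finset.card_filter]
      push_cast
      refine Finset.sum_congr rfl fun e _ => ?_
      simp only [x, ite_and, mul_ite, mul_one, mul_zero]
      split_ifs <;> rfl
    rw [e2, ← div_pow, empiricalJoint, srcFraction, tgtFraction, hm', ← hA, ← hB,
      card_pairingEdges hσ', ← hm]
    congr 1
    field_simp
  rw [Finset.sum_congr rfl hform, ← Finset.sum_div]
  have hc := covBound_nonneg (Nat.cast_nonneg D) hD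
  have key := sum_simplePairings_sq_le d D h₁ h₂ hbal hD α β x y hysum
  have hxs : ∑ v, (d.2 v : ℝ) * x (seqDegree α d v) ^ 2 ≤ m := by
    rw [← hm']
    refine Finset.sum_le_sum fun v _ => ?_
    have : x (seqDegree α d v) ^ 2 ≤ 1 := by simp only [x]; split_ifs <;> norm_num
    nlinarith [(Nat.cast_nonneg (d.2 v) : (0 : ℝ) ≤ d.2 v)]
  have hB1 : 0 ≤ B / m := div_nonneg
    (Finset.sum_nonneg fun v _ => mul_nonneg (Nat.cast_nonneg _) (by split_ifs <;> norm_num)) hm0.le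
  have hB2 : B / m ≤ 1 := by
    rw [div_le_one hm0, ← hm'']
    refine Finset.sum_le_sum fun v _ => ?_
    split_ifs <;> simp
  have hys : ∑ v, (d.1 v : ℝ) * y (seqDegree β d v) ^ 2 ≤ m := by
    rw [← hm'']
    refine Finset.sum_le_sum fun v _ => ?_
    have : y (seqDegree β d v) ^ 2 ≤ 1 := by simp only [y]; split_ifs <;> nlinarith
    nlinarith [(Nat.cast_nonneg (d.1 v) : (0 : ℝ) ≤ d.1 v)]
  refine div_le_of_le_mul₀ (by positivity) (by positivity) (key.trans ?_)
  refine mul_le_mul_of_nonneg_left ?_ (by positivity)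
  rw [pow_two]
  exact mul_le_mul hxs hys (Finset.sum_nonneg fun v _ => by positivity) hm0.le

end PairingStatistics

/-! ### Uniform choice from a finite set. -/

section UniformImage

lemma uniformImage_apply {A B : Type*} [MeasurableSpace B] (s : Finset A) (f : A → B)
    (X : Set B) (hX : MeasurableSet X) [DecidablePred fun a => f a ∈ X] :
    uniformImage s f X = (s.card : ℝ≥0∞)⁻¹ * ((s.filter fun a => f a ∈ X).card : ℝ≥0∞) := by
  simp only [uniformImage, Measure.smul_apply, Measure.finsetSum_apply, smul_eq_mul]
  congr 1
  rw [Finset.card_filter]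
  push_cast
  refine Finset.sum_congr rfl fun a _ => ?_
  rw [Measure.dirac_apply' _ hX, Set.indicator_apply]
  simp

lemma isProbabilityMeasure_uniformImage {A B : Type*} [MeasurableSpace B] (s : Finset A)
    (hs : s.Nonempty) (f : A → B) : IsProbabilityMeasure (uniformImage s f) := by
  classical
  constructor
  rw [uniformImage_apply s f _ MeasurableSet.univ]
  simp only [Set.mem_univ, Finset.filter_true]
  exact ENNReal.inv_mul_cancel (by simpa using hs.ne_empty) (by simp)

lemma uniformImage_eq_zero {A B : Type*} [MeasurableSpace B] (s : Finset A)
    (f : A → B) (X : Set B) (hX : MeasurableSet X) (h : ∀ a ∈ s, f a ∉ X) :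
    uniformImage s f X = 0 := by
  classical
  rw [uniformImage_apply s f X hX, Finset.filter_false_of_mem h]
  simp

/-- Chebyshev's inequality for the uniform distribution. -/
lemma uniformImage_abs_ge_le {A B : Type*} [MeasurableSpace B] [DiscreteMeasurableSpace B]
    (s : Finset A) (f : A → B) (X : B → ℝ) {C ε : ℝ} (hε : 0 < ε)
    (h : ∑ a ∈ s, X (f a) ^ 2 ≤ s.card * C) :
    uniformImage s f {b | ε ≤ |X b|} ≤ ENNReal.ofReal (C / ε ^ 2) := by
  classical
  rw [uniformImage_apply s f _ (MeasurableSet.of_discrete)]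
  rcases s.eq_empty_or_nonempty with rfl | hs
  · simp
  have hcard : (0 : ℝ) < s.card := by exact_mod_cast hs.card_pos
  have h1 : ((s.filter fun a => f a ∈ {b | ε ≤ |X b|}).card : ℝ) * ε ^ 2 ≤ s.card * C := by
    refine le_trans ?_ h
    rw [← nsmul_eq_mul]
    refine (Finset.card_nsmul_le_sum (s.filter fun a => f a ∈ {b | ε ≤ |X b|})
      (fun a => X (f a) ^ 2) _ ?_).trans
      (Finset.sum_le_sum_of_subset_of_nonneg (Finset.filter_subset _ _) fun _ _ _ => sq_nonneg _)
    intro a ha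
    have : ε ≤ |X (f a)| := (Finset.mem_filter.1 ha).2
    rw [← sq_abs (X (f a))]
    exact pow_le_pow_left₀ hε.le this 2
  have h2 : ((s.filter fun a => f a ∈ {b | ε ≤ |X b|}).card : ℝ) / s.card ≤ C / ε ^ 2 := by
    rw [div_le_div_iff₀ hcard (by positivity)]
    linarith
  refine le_trans (le_of_eq ?_) (ENNReal.ofReal_le_ofReal h2)
  rw [ENNReal.ofReal_div_of_pos hcard, ENNReal.ofReal_natCast, ENNReal.ofReal_natCast, mul_comm,
    div_eq_mul_inv]

end UniformImage

/-! ### Events with probability tending to one, and conditioning on them. -/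

section WithHighProbability

/-- The events `A n` have a probability that tends to one. -/
def Whp {X : ℕ → Type*} [∀ n, MeasurableSpace (X n)] (ν : ∀ n, Measure (X n))
    (A : ∀ n, Set (X n)) : Prop :=
  Tendsto (fun n => ν n (A n)ᶜ) atTop (𝓝 0)

variable {X : ℕ → Type*} [∀ n, MeasurableSpace (X n)] {ν : ∀ n, Measure (X n)}
  {A B : ∀ n, Set (X n)}

lemma Whp.mono (h : Whp ν A) (hAB : ∀ᶠ n in atTop, A n ⊆ B n) : Whp ν B :=
  tendsto_of_tendsto_of_tendsto_of_le_of_le' tendsto_const_nhds h (Eventually.of_forall fun _ => zero_le)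
    (hAB.mono fun _ h => measure_mono (Set.compl_subset_compl.2 h))

lemma Whp.inter (hA : Whp ν A) (hB : Whp ν B) : Whp ν fun n => A n ∩ B n := by
  have := Tendsto.add hA hB
  rw [add_zero] at this
  refine tendsto_of_tendsto_of_tendsto_of_le_of_le tendsto_const_nhds this (fun _ => zero_le) fun n => ?_
  simp only [Set.compl_inter]
  exact measure_union_le _ _

lemma Whp.tendsto_one (hν : ∀ᶠ n in atTop, IsProbabilityMeasure (ν n)) (hA : Whp ν A)
    (hm : ∀ n, MeasurableSet (A n)) : Tendsto (fun n => ν n (A n)) atTop (𝓝 1) := by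
  have h : ∀ᶠ n in atTop, 1 - ν n (A n)ᶜ = ν n (A n) := hν.mono fun n hn => by
    rw [prob_compl_eq_one_sub (hm n), ENNReal.sub_sub_cancel ENNReal.one_ne_top prob_le_one]
  have := ENNReal.Tendsto.sub (tendsto_const_nhds (x := (1 : ℝ≥0∞)) (f := atTop)) hA
    (Or.inl ENNReal.one_ne_top)
  rw [tsub_zero] at this
  exact this.congr' h

lemma Whp.isProbabilityMeasure_cond (hν : ∀ᶠ n in atTop, IsProbabilityMeasure (ν n))
    (hA : Whp ν A) (hm : ∀ n, MeasurableSet (A n)) :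
    ∀ᶠ n in atTop, IsProbabilityMeasure (ProbabilityTheory.cond (ν n) (A n)) := by
  filter_upwards [hν, (hA.tendsto_one hν hm).eventually_ne one_ne_zero] with n h1 h2
  exact cond_isProbabilityMeasure h2

/-- Conditioning multiplies probabilities by at most 1 / ν(A), which tends to 1. Both the rejection
of samples and the discarding of non-graphical sequences are handled this way. -/
lemma Whp.cond (hν : ∀ᶠ n in atTop, IsProbabilityMeasure (ν n)) (hA : Whp ν A)
    (hm : ∀ n, MeasurableSet (A n)) (hB : Whp ν B) :
    Whp (fun n => ProbabilityTheory.cond (ν n) (A n)) B := by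
  have h1 := ENNReal.Tendsto.mul (tendsto_inv_iff.2 (hA.tendsto_one hν hm))
    (by simp) hB (by simp)
  rw [mul_zero] at h1
  refine tendsto_of_tendsto_of_tendsto_of_le_of_le tendsto_const_nhds h1 (fun _ => zero_le)
    fun n => ?_
  simp only [cond_apply (hm n)]
  gcongr
  exact Set.inter_subset_right

end WithHighProbability

/-! ### The unconditioned sample: laws of large numbers, maximal degree, acceptance. -/

section Sampling

variable (Fminus Fplus : Measure ℕ)

/-- The law of the degree pairs before the acceptance step. -/
def rawLaw (n : ℕ) : Measure (BiSeq n) :=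
  (Measure.pi fun _ : Fin n => Fminus).prod (Measure.pi fun _ : Fin n => Fplus)

variable [IsProbabilityMeasure Fminus] [IsProbabilityMeasure Fplus]

instance (n : ℕ) : IsProbabilityMeasure (rawLaw Fminus Fplus n) := by
  unfold rawLaw; infer_instance

lemma measurePreserving_rawLaw (n : ℕ) :
    MeasurePreserving (MeasurableEquiv.arrowProdEquivProdArrow ℕ ℕ (Fin n))
      (Measure.pi fun _ : Fin n => Fminus.prod Fplus) (rawLaw Fminus Fplus n) :=
  measurePreserving_arrowProdEquivProdArrow ℕ ℕ (Fin n) (fun _ => Fminus) (fun _ => Fplus)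

variable {Fminus Fplus}

/-- Regrouping the two independent vectors by vertex turns the sample into n i.i.d. pairs, so that
sums over vertices have variances that add. -/
lemma rawLaw_eq (n : ℕ) (A : Set (BiSeq n)) : rawLaw Fminus Fplus n A =
    Measure.pi (fun _ : Fin n => Fminus.prod Fplus)
      {ω | (fun v => (ω v).1, fun v => (ω v).2) ∈ A} :=
  ((measurePreserving_rawLaw Fminus Fplus n).measure_preimage_equiv A).symm

lemma rawLaw_chebyshev (n : ℕ) {h : ℕ × ℕ → ℝ} (hh : MemLp h 2 (Fminus.prod Fplus)) {c : ℝ}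
    (hc : 0 < c) :
    rawLaw Fminus Fplus n {d | c ≤ |∑ v, h (d.1 v, d.2 v) - n * ∫ x, h x ∂(Fminus.prod Fplus)|} ≤
      ENNReal.ofReal (n * Var[h; Fminus.prod Fplus] / c ^ 2) := by
  rw [rawLaw_eq]
  have hmem : ∀ v : Fin n, MemLp (fun ω : Fin n → ℕ × ℕ => h (ω v)) 2
      (Measure.pi fun _ : Fin n => Fminus.prod Fplus) := fun v =>
    hh.comp_measurePreserving (measurePreserving_eval (fun _ : Fin n => Fminus.prod Fplus) v)
  have hsum : MemLp (∑ v : Fin n, fun ω : Fin n → ℕ × ℕ => h (ω v)) 2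
      (Measure.pi fun _ : Fin n => Fminus.prod Fplus) := memLp_finsetSum' _ fun v _ => hmem v
  have hvar := variance_sum_pi (μ := fun _ : Fin n => Fminus.prod Fplus)
    (X := fun _ => h) (fun _ => hh)
  have hint : ∫ ω, (∑ v : Fin n, fun ω : Fin n → ℕ × ℕ => h (ω v)) ω
      ∂(Measure.pi fun _ : Fin n => Fminus.prod Fplus) = n * ∫ x, h x ∂(Fminus.prod Fplus) := by
    simp only [Finset.sum_apply]
    rw [integral_finsetSum _ fun v _ => (hmem v).integrable (by norm_num)]
    have : ∀ v : Fin n, ∫ ω, h (ω v) ∂(Measure.pi fun _ : Fin n => Fminus.prod Fplus) =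
        ∫ x, h x ∂(Fminus.prod Fplus) := fun v =>
      integral_comp_eval (μ := fun _ : Fin n => Fminus.prod Fplus) hh.aestronglyMeasurable
    simp [this]
  have := meas_ge_le_variance_div_sq hsum hc
  rw [hvar, hint] at this
  simpa using this

lemma rawLaw_markov (n : ℕ) {h : ℕ × ℕ → ℝ} (hh : Integrable h (Fminus.prod Fplus))
    (h0 : ∀ x, 0 ≤ h x) {c : ℝ} (hc : 0 < c) :
    rawLaw Fminus Fplus n {d | c ≤ ∑ v, h (d.1 v, d.2 v)} ≤
      ENNReal.ofReal (n * (∫ x, h x ∂(Fminus.prod Fplus)) / c) := by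
  rw [rawLaw_eq]
  have hmem : ∀ v : Fin n, Integrable (fun ω : Fin n → ℕ × ℕ => h (ω v))
      (Measure.pi fun _ : Fin n => Fminus.prod Fplus) := fun v =>
    (measurePreserving_eval (fun _ : Fin n => Fminus.prod Fplus) v).integrable_comp_of_integrable hh
  have hint : ∫ ω, (∑ v : Fin n, h (ω v))
      ∂(Measure.pi fun _ : Fin n => Fminus.prod Fplus) = n * ∫ x, h x ∂(Fminus.prod Fplus) := by
    rw [integral_finsetSum _ fun v _ => hmem v]
    have : ∀ v : Fin n, ∫ ω, h (ω v) ∂(Measure.pi fun _ : Fin n => Fminus.prod Fplus) =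
        ∫ x, h x ∂(Fminus.prod Fplus) := fun v =>
      integral_comp_eval (μ := fun _ : Fin n => Fminus.prod Fplus) hh.aestronglyMeasurable
    simp [this]
  have := mul_meas_ge_le_integral_of_nonneg
    (μ := Measure.pi fun _ : Fin n => Fminus.prod Fplus)
    (f := fun ω => ∑ v : Fin n, h (ω v))
    (Eventually.of_forall fun ω => Finset.sum_nonneg fun v _ => h0 _)
    (integrable_finsetSum _ fun v _ => hmem v) c
  rw [hint] at this
  rw [← ENNReal.ofReal_toReal (measure_ne_top _ _)]
  refine ENNReal.ofReal_le_ofReal ?_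
  rw [le_div_iff₀ hc, mul_comm]
  exact this

/-- Weak law of large numbers. -/
lemma whp_rawLaw_sum {h : ℕ × ℕ → ℝ} (hh : MemLp h 2 (Fminus.prod Fplus)) {η : ℝ} (hη : 0 < η) :
    Whp (rawLaw Fminus Fplus) fun n =>
      {d | |∑ v, h (d.1 v, d.2 v) - n * ∫ x, h x ∂(Fminus.prod Fplus)| ≤ η * n} := by
  set V := Var[h; Fminus.prod Fplus]
  have hlim : Tendsto (fun n : ℕ => ENNReal.ofReal (V / η ^ 2 / n)) atTop (𝓝 0) := by
    rw [← ENNReal.ofReal_zero]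
    exact ENNReal.tendsto_ofReal (tendsto_const_div_atTop_nhds_zero_nat _)
  refine tendsto_of_tendsto_of_tendsto_of_le_of_le' tendsto_const_nhds hlim
    (Eventually.of_forall fun _ => zero_le) ?_
  filter_upwards [eventually_gt_atTop 0] with n hn
  have hn' : (0 : ℝ) < n := by exact_mod_cast hn
  refine (measure_mono ?_).trans ((rawLaw_chebyshev n hh (mul_pos hη hn')).trans (le_of_eq ?_))
  · intro d hd
    simp only [Set.mem_compl_iff, Set.mem_ofPred_eq, not_le] at hd ⊢
    exact hd.le
  · congr 1
    change n * V / (η * n) ^ 2 = V / η ^ 2 / n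
    field_simp

/-- The function n · 1{ηn < k²} is dominated by k² / η and vanishes eventually for each k. Through a
union bound over the vertices this makes the maximal degree o(√n) from a second moment alone. -/
lemma tendsto_mul_measure_sq_gt {F : Measure ℕ} [IsProbabilityMeasure F]
    (hF : Integrable (fun k : ℕ => (k : ℝ) ^ 2) F) {η : ℝ} (hη : 0 < η) :
    Tendsto (fun n : ℕ => (n : ℝ≥0∞) * F {k | η * n < (k : ℝ) ^ 2}) atTop (𝓝 0) := by
  have h1 : ∀ n : ℕ, (n : ℝ≥0∞) * F {k | η * n < (k : ℝ) ^ 2} =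
      ∫⁻ k, Set.indicator {k : ℕ | η * n < (k : ℝ) ^ 2} (fun _ => (n : ℝ≥0∞)) k ∂F := by
    intro n
    rw [lintegral_indicator_const MeasurableSet.of_discrete]
  simp only [h1]
  have := tendsto_lintegral_of_dominated_convergence (μ := F)
    (F := fun n : ℕ => Set.indicator {k : ℕ | η * n < (k : ℝ) ^ 2} (fun _ => (n : ℝ≥0∞)))
    (f := fun _ => 0) (fun k => ENNReal.ofReal ((k : ℝ) ^ 2 / η))
    (fun n => measurable_of_countable _) (fun n => Eventually.of_forall fun k => ?_) ?_
    (Eventually.of_forall fun k => ?_)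
  · simpa using this
  · simp only [Set.indicator_apply]
    split_ifs with h
    · rw [← ENNReal.ofReal_natCast]
      refine ENNReal.ofReal_le_ofReal ?_
      rw [le_div_iff₀ hη, mul_comm]
      exact h.le
    · exact zero_le
  · exact (hF.div_const η).lintegral_lt_top.ne
  · refine tendsto_const_nhds.congr' ?_
    obtain ⟨N, hN⟩ := exists_nat_gt ((k : ℝ) ^ 2 / η)
    filter_upwards [eventually_ge_atTop N] with n hn
    rw [Set.indicator_of_notMem]
    simp only [Set.mem_ofPred_eq, not_lt]
    rw [div_lt_iff₀ hη] at hN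
    have : (N : ℝ) ≤ n := by exact_mod_cast hn
    nlinarith

/-- The squared degrees are of smaller order than `n`. -/
lemma whp_rawLaw_degree_sq_le (hminus : Integrable (fun k : ℕ => (k : ℝ) ^ 2) Fminus)
    (hplus : Integrable (fun k : ℕ => (k : ℝ) ^ 2) Fplus) {η : ℝ} (hη : 0 < η) :
    Whp (rawLaw Fminus Fplus) fun n =>
      {d | ∀ v, ((d.1 v : ℝ)) ^ 2 ≤ η * n ∧ ((d.2 v : ℝ)) ^ 2 ≤ η * n} := by
  have hlim := (tendsto_mul_measure_sq_gt hminus hη).add (tendsto_mul_measure_sq_gt hplus hη)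
  rw [add_zero] at hlim
  refine tendsto_of_tendsto_of_tendsto_of_le_of_le tendsto_const_nhds hlim (fun _ => zero_le) ?_
  intro n
  have hsub : {d : BiSeq n | ∀ v, ((d.1 v : ℝ)) ^ 2 ≤ η * n ∧ ((d.2 v : ℝ)) ^ 2 ≤ η * n}ᶜ ⊆
      (⋃ v : Fin n, {d : BiSeq n | η * n < (d.1 v : ℝ) ^ 2}) ∪
      ⋃ v : Fin n, {d : BiSeq n | η * n < (d.2 v : ℝ) ^ 2} := by
    intro d hd
    simp only [Set.mem_compl_iff, Set.mem_ofPred_eq, not_forall, not_and_or, not_le] at hd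
    obtain ⟨v, h | h⟩ := hd
    · exact Or.inl (Set.mem_iUnion.2 ⟨v, h⟩)
    · exact Or.inr (Set.mem_iUnion.2 ⟨v, h⟩)
  refine (measure_mono hsub).trans ((measure_union_le _ _).trans (add_le_add ?_ ?_))
  · refine (measure_iUnion_fintype_le _ _).trans (le_of_eq ?_)
    have : ∀ v : Fin n, rawLaw Fminus Fplus n {d : BiSeq n | η * n < (d.1 v : ℝ) ^ 2} =
        Fminus {k | η * n < (k : ℝ) ^ 2} := by
      intro v
      have h := ((measurePreserving_eval (fun _ : Fin n => Fminus) v).comp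
        (measurePreserving_fst (μ := Measure.pi fun _ : Fin n => Fminus)
          (ν := Measure.pi fun _ : Fin n => Fplus)))
      exact h.measure_preimage
        (MeasurableSet.of_discrete (s := {k : ℕ | η * n < (k : ℝ) ^ 2})).nullMeasurableSet
    simp [this]
  · refine (measure_iUnion_fintype_le _ _).trans (le_of_eq ?_)
    have : ∀ v : Fin n, rawLaw Fminus Fplus n {d : BiSeq n | η * n < (d.2 v : ℝ) ^ 2} =
        Fplus {k | η * n < (k : ℝ) ^ 2} := by
      intro v
      have h := ((measurePreserving_eval (fun _ : Fin n => Fplus) v).comp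
        (measurePreserving_snd (μ := Measure.pi fun _ : Fin n => Fminus)
          (ν := Measure.pi fun _ : Fin n => Fplus)))
      exact h.measure_preimage
        (MeasurableSet.of_discrete (s := {k : ℕ | η * n < (k : ℝ) ^ 2})).nullMeasurableSet
    simp [this]

lemma memLp_natCast {F : Measure ℕ} (hF : Integrable (fun k : ℕ => (k : ℝ) ^ 2) F) :
    MemLp (fun k : ℕ => (k : ℝ)) 2 F :=
  (memLp_two_iff_integrable_sq (measurable_of_countable _).aestronglyMeasurable).2 hF

lemma memLp_fst (hminus : Integrable (fun k : ℕ => (k : ℝ) ^ 2) Fminus) :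
    MemLp (fun x : ℕ × ℕ => (x.1 : ℝ)) 2 (Fminus.prod Fplus) :=
  (memLp_natCast hminus).comp_measurePreserving measurePreserving_fst

lemma memLp_snd (hplus : Integrable (fun k : ℕ => (k : ℝ) ^ 2) Fplus) :
    MemLp (fun x : ℕ × ℕ => (x.2 : ℝ)) 2 (Fminus.prod Fplus) :=
  (memLp_natCast hplus).comp_measurePreserving measurePreserving_snd

lemma integral_fst : ∫ x : ℕ × ℕ, (x.1 : ℝ) ∂(Fminus.prod Fplus) = mean Fminus := by
  rw [integral_fun_fst (fun k : ℕ => (k : ℝ))]; simp [mean]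

lemma integral_snd : ∫ x : ℕ × ℕ, (x.2 : ℝ) ∂(Fminus.prod Fplus) = mean Fplus := by
  rw [integral_fun_snd (fun k : ℕ => (k : ℝ))]; simp [mean]

/-- The sampled sequence is accepted with high probability. -/
lemma whp_rawLaw_accepted (hminus : Integrable (fun k : ℕ => (k : ℝ) ^ 2) Fminus)
    (hplus : Integrable (fun k : ℕ => (k : ℝ) ^ 2) Fplus)
    (hmean : mean Fminus = mean Fplus) {κ δ : ℝ} (hκ : κ ≤ 1 / 2) (hδ : 0 < δ) :
    Whp (rawLaw Fminus Fplus) (accepted κ δ) := by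
  have hh : MemLp (fun x : ℕ × ℕ => (x.1 : ℝ) - x.2) 2 (Fminus.prod Fplus) :=
    (memLp_fst hminus).sub (memLp_snd hplus)
  have hint : ∫ x : ℕ × ℕ, ((x.1 : ℝ) - x.2) ∂(Fminus.prod Fplus) = 0 := by
    rw [integral_sub ((memLp_fst hminus).integrable (by norm_num))
      ((memLp_snd hplus).integrable (by norm_num)), integral_fst, integral_snd, hmean, sub_self]
  set V := Var[fun x : ℕ × ℕ => (x.1 : ℝ) - x.2; Fminus.prod Fplus] with hV
  -- Chebyshev gives n V / n ^ (2(1 - κ + δ)); the exponent 1 - 2κ + 2δ is positive because κ ≤ 1/2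
  -- and δ > 0.
  have hlim : Tendsto (fun n : ℕ => ENNReal.ofReal (V * (n : ℝ) ^ (-(1 - 2 * κ + 2 * δ))))
      atTop (𝓝 0) := by
    rw [← ENNReal.ofReal_zero]
    refine ENNReal.tendsto_ofReal ?_
    have := ((tendsto_rpow_neg_atTop (y := 1 - 2 * κ + 2 * δ) (by linarith)).comp
      tendsto_natCast_atTop_atTop).const_mul V
    simpa using this
  refine tendsto_of_tendsto_of_tendsto_of_le_of_le' tendsto_const_nhds hlim
    (Eventually.of_forall fun _ => zero_le) ?_
  filter_upwards [eventually_gt_atTop 0] with n hn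
  have hn' : (0 : ℝ) < n := by exact_mod_cast hn
  refine (measure_mono ?_).trans ((rawLaw_chebyshev n hh
    (Real.rpow_pos_of_pos hn' (1 - κ + δ))).trans (le_of_eq ?_))
  · intro d hd
    simp only [accepted, imbalance, Set.mem_compl_iff, Set.mem_ofPred_eq, not_le] at hd ⊢
    push_cast at hd
    rw [hint, mul_zero, sub_zero, Finset.sum_sub_distrib]
    exact hd.le
  · congr 1
    rw [← hV, ← Real.rpow_natCast, ← Real.rpow_mul hn'.le, mul_comm (n : ℝ) V, mul_div_assoc]
    congr 1
    nth_rewrite 1 [← Real.rpow_one (n : ℝ)]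
    rw [← Real.rpow_sub hn']
    congr 1
    push_cast
    ring

/-- The sum of the squared degrees is of smaller order than `n ^ (1 + (κ - δ))`. -/
lemma whp_rawLaw_sum_sq_le (hminus : Integrable (fun k : ℕ => (k : ℝ) ^ 2) Fminus)
    (hplus : Integrable (fun k : ℕ => (k : ℝ) ^ 2) Fplus) {s η : ℝ} (hs : 0 < s) (hη : 0 < η) :
    Whp (rawLaw Fminus Fplus) fun n =>
      {d | ∑ v, ((d.1 v : ℝ) ^ 2 + (d.2 v : ℝ) ^ 2) ≤ η * (n : ℝ) ^ (1 + s)} := by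
  have hh : Integrable (fun x : ℕ × ℕ => (x.1 : ℝ) ^ 2 + (x.2 : ℝ) ^ 2) (Fminus.prod Fplus) :=
    (memLp_fst hminus).integrable_sq.add (memLp_snd hplus).integrable_sq
  set C := ∫ x : ℕ × ℕ, ((x.1 : ℝ) ^ 2 + (x.2 : ℝ) ^ 2) ∂(Fminus.prod Fplus) with hC
  have hlim : Tendsto (fun n : ℕ => ENNReal.ofReal (C / η * (n : ℝ) ^ (-s))) atTop (𝓝 0) := by
    rw [← ENNReal.ofReal_zero]
    refine ENNReal.tendsto_ofReal ?_
    have := ((tendsto_rpow_neg_atTop hs).comp tendsto_natCast_atTop_atTop).const_mul (C / η)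
    simpa using this
  refine tendsto_of_tendsto_of_tendsto_of_le_of_le' tendsto_const_nhds hlim
    (Eventually.of_forall fun _ => zero_le) ?_
  filter_upwards [eventually_gt_atTop 0] with n hn
  have hn' : (0 : ℝ) < n := by exact_mod_cast hn
  -- Squared degrees are merely integrable, so Markov's inequality is used, at the price of the
  -- factor n ^ s.
  refine (measure_mono ?_).trans ((rawLaw_markov n hh (fun x => by positivity)
    (mul_pos hη (Real.rpow_pos_of_pos hn' (1 + s)))).trans (le_of_eq ?_))
  · intro d hd
    simp only [Set.mem_compl_iff, Set.mem_ofPred_eq, not_le] at hd ⊢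
    exact hd.le
  · congr 1
    rw [← hC, Real.rpow_add hn', Real.rpow_one, Real.rpow_neg hn'.le]
    have := Real.rpow_pos_of_pos hn' s
    field_simp

end Sampling

/-! ### Passing through acceptance, added stubs and pairing. -/

section Transfer

variable {Fminus Fplus : Measure ℕ} [IsProbabilityMeasure Fminus] [IsProbabilityMeasure Fplus]
  {κ δ : ℝ}

lemma uniformImage_le_one {A B : Type*} [MeasurableSpace B] (s : Finset A) (f : A → B)
    (X : Set B) : uniformImage s f X ≤ 1 := by
  rcases s.eq_empty_or_nonempty with rfl | hs
  · simp [uniformImage]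
  · have := isProbabilityMeasure_uniformImage s hs f
    exact prob_le_one

/-- Ensures that there are enough vertices to choose |Δ| of them, so that the uniform choice is not
from an empty family. -/
lemma natAbs_imbalance_le (hδκ : δ < κ) {n : ℕ} (hn : 0 < n) {d : BiSeq n}
    (hd : d ∈ accepted κ δ n) : (imbalance d).natAbs ≤ n := by
  have h1 : |(imbalance d : ℝ)| ≤ (n : ℝ) ^ (1 - κ + δ) := hd
  have h2 : (n : ℝ) ^ (1 - κ + δ) ≤ (n : ℝ) ^ (1 : ℝ) :=
    Real.rpow_le_rpow_of_exponent_le (by exact_mod_cast hn) (by linarith)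
  rw [Real.rpow_one] at h2
  have h3 : (((imbalance d).natAbs : ℕ) : ℝ) ≤ n := by
    rw [Nat.cast_natAbs]
    push_cast
    exact h1.trans h2
  exact_mod_cast h3

lemma eventually_isProbabilityMeasure_sampleLaw
    (hacc : Whp (rawLaw Fminus Fplus) (accepted κ δ)) :
    ∀ᶠ n in atTop, IsProbabilityMeasure (sampleLaw Fminus Fplus κ δ n) :=
  Whp.isProbabilityMeasure_cond (ν := rawLaw Fminus Fplus)
    (Eventually.of_forall fun _ => inferInstance) hacc fun _ => MeasurableSet.of_discrete

lemma sampleLaw_compl_accepted (n : ℕ) :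
    sampleLaw Fminus Fplus κ δ n (accepted κ δ n)ᶜ = 0 := by
  rw [sampleLaw, cond_apply MeasurableSet.of_discrete]
  simp

lemma eventually_isProbabilityMeasure_biSeqLaw (hδκ : δ < κ)
    (hacc : Whp (rawLaw Fminus Fplus) (accepted κ δ)) :
    ∀ᶠ n in atTop, IsProbabilityMeasure (biSeqLaw Fminus Fplus κ δ n) := by
  filter_upwards [eventually_isProbabilityMeasure_sampleLaw hacc, eventually_gt_atTop 0] with n h hn
  constructor
  rw [biSeqLaw, Measure.bind_apply MeasurableSet.univ (measurable_of_countable _).aemeasurable]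
  have : ∀ᵐ d ∂(sampleLaw Fminus Fplus κ δ n),
      uniformImage (Finset.univ.powersetCard (imbalance d).natAbs) (addStubs d) Set.univ = 1 := by
    have h0 : ∀ᵐ d ∂(sampleLaw Fminus Fplus κ δ n), d ∈ accepted κ δ n :=
      sampleLaw_compl_accepted n
    filter_upwards [h0] with d hd
    have hne : ((Finset.univ : Finset (Fin n)).powersetCard (imbalance d).natAbs).Nonempty := by
      rw [Finset.powersetCard_nonempty]
      simpa using natAbs_imbalance_le hδκ hn hd
    have := isProbabilityMeasure_uniformImage _ hne (addStubs d)
    exact measure_univ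
  rw [lintegral_congr_ae this]
  simp

/-- The implication is required for every vertex set of the right size, so the random choice of that
set needs no probabilistic estimate. -/
lemma Whp.biSeqLaw (hacc : Whp (rawLaw Fminus Fplus) (accepted κ δ))
    {X Y : ∀ n, Set (BiSeq n)} (hX : Whp (rawLaw Fminus Fplus) X)
    (hXY : ∀ᶠ n in atTop, ∀ d ∈ X n, d ∈ accepted κ δ n → ∀ S : Finset (Fin n),
      S.card = (imbalance d).natAbs → addStubs d S ∈ Y n) :
    Whp (biSeqLaw Fminus Fplus κ δ) Y := by
  have h1 : Whp (sampleLaw Fminus Fplus κ δ) fun n => X n ∩ accepted κ δ n :=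
    Whp.cond (ν := rawLaw Fminus Fplus) (Eventually.of_forall fun _ => inferInstance) hacc
      (fun _ => MeasurableSet.of_discrete) (hX.inter hacc)
  refine tendsto_of_tendsto_of_tendsto_of_le_of_le' tendsto_const_nhds h1
    (Eventually.of_forall fun _ => zero_le) ?_
  filter_upwards [hXY] with n hn
  rw [RCM.biSeqLaw, Measure.bind_apply MeasurableSet.of_discrete
    (measurable_of_countable _).aemeasurable]
  refine (lintegral_mono (g := Set.indicator (X n ∩ accepted κ δ n)ᶜ fun _ => 1) fun d => ?_).trans
    (lintegral_indicator_const MeasurableSet.of_discrete 1 |>.trans (one_mul _)).le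
  by_cases hd : d ∈ X n ∩ accepted κ δ n
  · rw [Set.indicator_of_notMem (by simpa using hd), uniformImage_eq_zero _ _ _
      MeasurableSet.of_discrete]
    intro S hS
    simpa using hn d hd.1 hd.2 S (Finset.mem_powersetCard.1 hS).2
  · rw [Set.indicator_of_mem hd]
    exact uniformImage_le_one _ _ _

lemma eventually_isProbabilityMeasure_rcmLaw (hδκ : δ < κ)
    (hacc : Whp (rawLaw Fminus Fplus) (accepted κ δ))
    (hgr : Whp (biSeqLaw Fminus Fplus κ δ) graphical) :
    ∀ᶠ n in atTop, IsProbabilityMeasure (rcmLaw Fminus Fplus κ δ n) := by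
  filter_upwards [Whp.isProbabilityMeasure_cond
    (eventually_isProbabilityMeasure_biSeqLaw hδκ hacc) hgr
    fun _ => MeasurableSet.of_discrete] with n h
  constructor
  rw [rcmLaw, Measure.bind_apply MeasurableSet.univ (measurable_of_countable _).aemeasurable]
  have : ∀ᵐ d ∂(ProbabilityTheory.cond (biSeqLaw Fminus Fplus κ δ n) (graphical n)),
      uniformImage (simplePairings d) pairingEdges Set.univ = 1 := by
    have h0 : ∀ᵐ d ∂(ProbabilityTheory.cond (biSeqLaw Fminus Fplus κ δ n) (graphical n)),
        d ∈ graphical n := ae_cond_mem MeasurableSet.of_discrete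
    filter_upwards [h0] with d hd
    have := isProbabilityMeasure_uniformImage _ hd (pairingEdges (d := d))
    exact measure_univ
  rw [lintegral_congr_ae this]
  simp

/-- The graph law is a mixture over bi-degree sequences: a uniform bound on the conditional
probability over a set of sequences of probability tending to one suffices. -/
lemma tendsto_rcmLaw_zero (hδκ : δ < κ)
    (hacc : Whp (rawLaw Fminus Fplus) (accepted κ δ))
    (hgr : Whp (biSeqLaw Fminus Fplus κ δ) graphical) {B : ∀ n, Set (Edges n)}
    (hB : ∀ ε : ℝ, 0 < ε → ∃ Y : ∀ n, Set (BiSeq n), Whp (biSeqLaw Fminus Fplus κ δ) Y ∧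
      ∀ᶠ n in atTop, ∀ d ∈ Y n,
        uniformImage (simplePairings d) pairingEdges (B n) ≤ ENNReal.ofReal ε) :
    Tendsto (fun n => rcmLaw Fminus Fplus κ δ n (B n)) atTop (𝓝 0) := by
  rw [ENNReal.tendsto_nhds_zero]
  intro ε hε
  obtain ⟨ε', hε', hεε⟩ : ∃ ε' : ℝ, 0 < ε' ∧ ENNReal.ofReal ε' + ENNReal.ofReal ε' ≤ ε := by
    rcases eq_or_ne ε ⊤ with rfl | htop
    · exact ⟨1, one_pos, le_top⟩
    · refine ⟨ε.toReal / 2, half_pos (ENNReal.toReal_pos hε.ne' htop), ?_⟩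
      rw [← ENNReal.ofReal_add (by positivity) (by positivity), add_halves,
        ENNReal.ofReal_toReal htop]
  obtain ⟨Y, hY, hYB⟩ := hB ε' hε'
  have hp := eventually_isProbabilityMeasure_biSeqLaw hδκ hacc
  have h1 : Whp (fun n => ProbabilityTheory.cond (biSeqLaw Fminus Fplus κ δ n) (graphical n)) Y :=
    Whp.cond hp hgr (fun _ => MeasurableSet.of_discrete) hY
  filter_upwards [hYB, ENNReal.tendsto_nhds_zero.1 h1 _ (ENNReal.ofReal_pos.2 hε'),
    Whp.isProbabilityMeasure_cond hp hgr fun _ => MeasurableSet.of_discrete] with n hn hn' hpr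
  rw [rcmLaw, Measure.bind_apply MeasurableSet.of_discrete
    (measurable_of_countable _).aemeasurable]
  refine (lintegral_mono (g := fun d => ENNReal.ofReal ε' +
    Set.indicator (Y n)ᶜ (fun _ => 1) d) fun d => ?_).trans ?_
  · by_cases hd : d ∈ Y n
    · exact (hn d hd).trans le_self_add
    · simp only [Set.indicator_of_mem (Set.mem_compl hd)]
      exact (uniformImage_le_one _ _ _).trans le_add_self
  · rw [lintegral_add_left measurable_const,
      lintegral_indicator_const MeasurableSet.of_discrete, lintegral_const, measure_univ, mul_one,
      one_mul]
    exact (add_le_add_right hn' _).trans hεε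

end Transfer

/-! ### Effect of the additional stubs. -/

section AddStubs

variable {n : ℕ}

lemma imbalance_addStubs (d : BiSeq n) (S : Finset (Fin n))
    (hS : S.card = (imbalance d).natAbs) :
    ∑ v, (addStubs d S).1 v = ∑ v, (addStubs d S).2 v := by
  have h1 : ((∑ v, (d.1 v : ℤ)) - ∑ v, (d.2 v : ℤ)) = imbalance d := rfl
  simp only [addStubs, Finset.sum_add_distrib]
  zify
  by_cases h : imbalance d < 0
  · have h' : ¬ (0 ≤ imbalance d) := by omega
    simp only [h, h', true_and, false_and, if_false, Finset.sum_const_zero, add_zero,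
      Finset.sum_ite_mem, Finset.univ_inter, Finset.sum_const, nsmul_eq_mul, mul_one]
    rw [hS, Int.natCast_natAbs, abs_of_neg h]
    omega
  · have h' : 0 ≤ imbalance d := by omega
    simp only [h, h', true_and, false_and, if_false, Finset.sum_const_zero, add_zero,
      Finset.sum_ite_mem, Finset.univ_inter, Finset.sum_const, nsmul_eq_mul, mul_one]
    rw [hS, Int.natCast_natAbs, abs_of_nonneg h']
    omega

lemma addStubs_fst_of_notMem (d : BiSeq n) {S : Finset (Fin n)} {v : Fin n} (h : v ∉ S) :
    (addStubs d S).1 v = d.1 v := by simp [addStubs, h]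

lemma addStubs_snd_of_notMem (d : BiSeq n) {S : Finset (Fin n)} {v : Fin n} (h : v ∉ S) :
    (addStubs d S).2 v = d.2 v := by simp [addStubs, h]

lemma addStubs_fst_le (d : BiSeq n) (S : Finset (Fin n)) (v : Fin n) :
    (addStubs d S).1 v ≤ d.1 v + 1 := by
  simp only [addStubs]; split_ifs <;> omega

lemma addStubs_snd_le (d : BiSeq n) (S : Finset (Fin n)) (v : Fin n) :
    (addStubs d S).2 v ≤ d.2 v + 1 := by
  simp only [addStubs]; split_ifs <;> omega

lemma seqDegree_addStubs_of_notMem (α : DegType) (d : BiSeq n) {S : Finset (Fin n)} {v : Fin n}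
    (h : v ∉ S) : seqDegree α (addStubs d S) v = seqDegree α d v := by
  cases α
  · exact addStubs_snd_of_notMem d h
  · exact addStubs_fst_of_notMem d h

/-- Changing a weighted count at the vertices of `S` only. -/
lemma abs_sum_mul_ite_sub_le (S : Finset (Fin n)) (a a' : Fin n → ℕ) (p p' : Fin n → Prop)
    [DecidablePred p] [DecidablePred p'] (ha : ∀ v ∉ S, a' v = a v) (hp : ∀ v ∉ S, p' v ↔ p v)
    (hle : ∀ v, a' v ≤ a v + 1) :
    |(∑ v, (a' v : ℝ) * if p' v then 1 else 0) - ∑ v, (a v : ℝ) * if p v then 1 else 0| ≤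
      S.card + ∑ v ∈ S, (a v : ℝ) := by
  rw [← Finset.sum_sub_distrib, ← Finset.sum_subset (Finset.subset_univ S)]
  · refine (Finset.abs_sum_le_sum_abs _ _).trans ?_
    calc ∑ v ∈ S, |((a' v : ℝ) * if p' v then 1 else 0) - (a v : ℝ) * if p v then 1 else 0|
        ≤ ∑ v ∈ S, (1 + (a v : ℝ)) := by
          refine Finset.sum_le_sum fun v _ => ?_
          have h1 : (a' v : ℝ) ≤ a v + 1 := by exact_mod_cast hle v
          have h2 : (0 : ℝ) ≤ a' v := Nat.cast_nonneg _
          have h3 : (0 : ℝ) ≤ a v := Nat.cast_nonneg _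
          rw [abs_le]
          split_ifs <;> constructor <;> linarith
      _ = _ := by simp [Finset.sum_add_distrib]
  · intro v _ hv
    simp only [ha v hv, hp v hv]
    simp

/-- Cauchy–Schwarz over `S`: few vertices carry few stubs as long as the sum of all squared degrees
is under control. -/
lemma sum_le_of_sum_sq_le (S : Finset (Fin n)) (a : Fin n → ℝ) {x y z : ℝ} (hz : 0 ≤ z)
    (hS : (S.card : ℝ) ≤ x) (ha : ∑ v, a v ^ 2 ≤ y) (hxy : x * y ≤ z ^ 2) :
    ∑ v ∈ S, a v ≤ z := by
  have h1 : (∑ v ∈ S, a v) ^ 2 ≤ S.card * ∑ v ∈ S, a v ^ 2 := sq_sum_le_card_mul_sum_sq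
  have h2 : ∑ v ∈ S, a v ^ 2 ≤ y :=
    (Finset.sum_le_sum_of_subset_of_nonneg (Finset.subset_univ _) fun _ _ _ => sq_nonneg _).trans ha
  have h3 : (S.card : ℝ) * ∑ v ∈ S, a v ^ 2 ≤ x * y :=
    mul_le_mul hS h2 (Finset.sum_nonneg fun _ _ => sq_nonneg _)
      ((Nat.cast_nonneg _).trans hS)
  exact le_of_sq_le_sq (h1.trans (h3.trans hxy)) hz

end AddStubs

/-! ### Typical bi-degree sequences. -/

section Typical

variable (Fminus Fplus : Measure ℕ)

/-- Balanced bi-degree sequences with small degrees and with the expected numbers of stubs, of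
outbound stubs at vertices of `α`-degree `k` and of inbound stubs at vertices of `β`-degree `l`. -/
def typical (η : ℝ) (α β : DegType) (k l n : ℕ) : Set (BiSeq n) :=
  {d | ∑ v, d.1 v = ∑ v, d.2 v ∧
    (∀ v, (d.1 v : ℝ) ^ 2 ≤ η * n ∧ (d.2 v : ℝ) ^ 2 ≤ η * n) ∧
    |∑ v, (d.2 v : ℝ) - n * mean Fplus| ≤ η * n ∧
    |(∑ v, (d.2 v : ℝ) * if seqDegree α d v = k then 1 else 0) -
      n * (mean Fplus * srcLimit Fminus Fplus α k)| ≤ η * n ∧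
    |(∑ v, (d.1 v : ℝ) * if seqDegree β d v = l then 1 else 0) -
      n * (mean Fminus * tgtLimit Fminus Fplus β l)| ≤ η * n}

/-- The degree of type `α` in a pair of an in-degree and an out-degree. -/
def pairDegree (α : DegType) (x : ℕ × ℕ) : ℕ :=
  match α with
  | .plus => x.2
  | .minus => x.1

lemma pairDegree_mk {n : ℕ} (α : DegType) (d : BiSeq n) (v : Fin n) :
    pairDegree α (d.1 v, d.2 v) = seqDegree α d v := by
  cases α <;> rfl

variable {Fminus Fplus} [IsProbabilityMeasure Fminus] [IsProbabilityMeasure Fplus]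

lemma integral_natCast_mul_ite (F : Measure ℕ) [IsProbabilityMeasure F] (k : ℕ) :
    ∫ x, (x : ℝ) * (if x = k then 1 else 0) ∂F = k * F.real {k} := by
  have : (fun x : ℕ => (x : ℝ) * (if x = k then 1 else 0)) =
      Set.indicator {k} fun _ => (k : ℝ) := by
    ext x
    by_cases h : x = k <;> simp [h]
  rw [this, integral_indicator_const _ MeasurableSet.of_discrete, smul_eq_mul, mul_comm]

lemma integral_ite_eq (F : Measure ℕ) [IsProbabilityMeasure F] (k : ℕ) :
    ∫ x, (if x = k then (1 : ℝ) else 0) ∂F = F.real {k} := by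
  have : (fun x : ℕ => (if x = k then (1 : ℝ) else 0)) = Set.indicator {k} fun _ => (1 : ℝ) := by
    ext x
    by_cases h : x = k <;> simp [h]
  rw [this, integral_indicator_const _ MeasurableSet.of_discrete, smul_eq_mul, mul_one]

/-- Every outbound stub is the start of an edge, hence the weight `x.2`. For the out-degree this
produces the size bias; for the in-degree, independence makes the weight factor out. -/
lemma integral_src (hpos : 0 < mean Fplus) (α : DegType) (k : ℕ) :
    ∫ x : ℕ × ℕ, (x.2 : ℝ) * (if pairDegree α x = k then 1 else 0) ∂(Fminus.prod Fplus) =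
      mean Fplus * srcLimit Fminus Fplus α k := by
  cases α
  · refine (integral_fun_snd (fun y : ℕ => (y : ℝ) * (if y = k then 1 else 0))).trans ?_
    rw [integral_natCast_mul_ite, srcLimit, mul_div_cancel₀ _ hpos.ne']
    simp
  · refine Eq.trans (integral_congr_ae (Eventually.of_forall fun x => mul_comm _ _))
      ((integral_prod_mul (fun x : ℕ => if x = k then (1 : ℝ) else 0)
        (fun y : ℕ => (y : ℝ))).trans ?_)
    rw [integral_ite_eq, mul_comm]
    rfl

lemma integral_tgt (hpos : 0 < mean Fminus) (β : DegType) (l : ℕ) :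
    ∫ x : ℕ × ℕ, (x.1 : ℝ) * (if pairDegree β x = l then 1 else 0) ∂(Fminus.prod Fplus) =
      mean Fminus * tgtLimit Fminus Fplus β l := by
  cases β
  · refine (integral_prod_mul (fun x : ℕ => (x : ℝ))
      (fun y : ℕ => if y = l then (1 : ℝ) else 0)).trans ?_
    rw [integral_ite_eq]
    rfl
  · refine (integral_fun_fst (fun y : ℕ => (y : ℝ) * (if y = l then 1 else 0))).trans ?_
    rw [integral_natCast_mul_ite, tgtLimit, mul_div_cancel₀ _ hpos.ne']
    simp

lemma memLp_mul_ite {f : ℕ × ℕ → ℝ} (hf : MemLp f 2 (Fminus.prod Fplus)) (p : ℕ × ℕ → Prop)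
    [DecidablePred p] :
    MemLp (fun x => f x * if p x then 1 else 0) 2 (Fminus.prod Fplus) := by
  refine hf.mono (measurable_of_countable _).aestronglyMeasurable (Eventually.of_forall fun x => ?_)
  split_ifs <;> simp

variable {κ δ : ℝ}

/-- An error budget in quarters of ηn: one for the fluctuation of the sample, one for the number of
corrected vertices, and one for the stubs that these vertices already had. -/
lemma whp_biSeqLaw_typical (hminus : Integrable (fun k : ℕ => (k : ℝ) ^ 2) Fminus)
    (hplus : Integrable (fun k : ℕ => (k : ℝ) ^ 2) Fplus)
    (hmean : mean Fminus = mean Fplus) (hpos : 0 < mean Fminus) (hδκ : δ < κ)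
    (hacc : Whp (rawLaw Fminus Fplus) (accepted κ δ)) {η : ℝ} (hη : 0 < η)
    (α β : DegType) (k l : ℕ) :
    Whp (biSeqLaw Fminus Fplus κ δ) (typical Fminus Fplus η α β k l) := by
  have hη4 : 0 < η / 4 := by positivity
  have hs : 0 < κ - δ := by linarith
  have W1 := whp_rawLaw_sum (Fminus := Fminus) (memLp_snd hplus) hη4
  have W2 := whp_rawLaw_sum (memLp_mul_ite (Fminus := Fminus) (memLp_snd hplus)
    (fun x => pairDegree α x = k)) hη4
  have W3 := whp_rawLaw_sum (memLp_mul_ite (Fplus := Fplus) (memLp_fst hminus)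
    (fun x => pairDegree β x = l)) hη4
  have W4 := whp_rawLaw_degree_sq_le hminus hplus hη4
  have W5 := whp_rawLaw_sum_sq_le hminus hplus hs (show 0 < (η / 4) ^ 2 by positivity)
  rw [integral_snd] at W1
  rw [integral_src (hmean ▸ hpos)] at W2
  rw [integral_tgt hpos] at W3
  refine Whp.biSeqLaw hacc (W1.inter (W2.inter (W3.inter (W4.inter W5)))) ?_
  have hlim : Tendsto (fun n : ℕ => (n : ℝ) ^ (-(κ - δ))) atTop (𝓝 0) :=
    (tendsto_rpow_neg_atTop hs).comp tendsto_natCast_atTop_atTop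
  filter_upwards [hlim.eventually_le_const hη4, eventually_gt_atTop 0,
    (tendsto_natCast_atTop_atTop (R := ℝ)).eventually_ge_atTop (4 / η)] with n hn1 hn0 hn2
  rintro d ⟨h1, h2, h3, h4, h5⟩ hd S hS
  simp only [Set.mem_ofPred_eq, pairDegree_mk] at h1 h2 h3 h4 h5
  have hn : (0 : ℝ) < n := by exact_mod_cast hn0
  have hcard : (S.card : ℝ) ≤ (n : ℝ) ^ (1 - (κ - δ)) := by
    have : |(imbalance d : ℝ)| ≤ (n : ℝ) ^ (1 - κ + δ) := hd
    rw [hS, Nat.cast_natAbs]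
    push_cast
    convert this using 2
    ring
  have hcard' : (S.card : ℝ) ≤ η / 4 * n := by
    refine hcard.trans ?_
    rw [sub_eq_add_neg, Real.rpow_add hn, Real.rpow_one, mul_comm]
    exact mul_le_mul_of_nonneg_right hn1 hn.le
  -- The exponents are matched: the power lost in Markov's inequality for the squares is the power
  -- gained from the size of `S`, and the product is exactly of order n².
  have hprod : (n : ℝ) ^ (1 - (κ - δ)) * ((η / 4) ^ 2 * (n : ℝ) ^ (1 + (κ - δ))) ≤
      (η / 4 * n) ^ 2 := by
    refine le_of_eq ?_
    rw [mul_left_comm, ← Real.rpow_add hn, mul_pow, ← Real.rpow_natCast (n : ℝ)]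
    congr 2
    push_cast
    ring
  have hS1 : ∑ v ∈ S, (d.1 v : ℝ) ≤ η / 4 * n :=
    sum_le_of_sum_sq_le S _ (by positivity) hcard ((Finset.sum_le_sum fun v _ =>
      le_add_of_nonneg_right (sq_nonneg _)).trans h5) hprod
  have hS2 : ∑ v ∈ S, (d.2 v : ℝ) ≤ η / 4 * n :=
    sum_le_of_sum_sq_le S _ (by positivity) hcard ((Finset.sum_le_sum fun v _ =>
      le_add_of_nonneg_left (sq_nonneg _)).trans h5) hprod
  have hηn : 1 ≤ η / 4 * n := by
    rw [div_le_iff₀ hη] at hn2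
    linarith
  -- From (a + 1)² ≤ 2a² + 2, where both a² and 1 are at most ηn / 4.
  have hdeg : ∀ a a' : ℕ, a' ≤ a + 1 → (a : ℝ) ^ 2 ≤ η / 4 * n → (a' : ℝ) ^ 2 ≤ η * n := by
    intro a a' h h'
    have h0 : (a' : ℝ) ≤ a + 1 := by exact_mod_cast h
    have h6 : (a' : ℝ) ^ 2 ≤ ((a : ℝ) + 1) ^ 2 := pow_le_pow_left₀ (Nat.cast_nonneg _) h0 2
    nlinarith [sq_nonneg ((a : ℝ) - 1)]
  refine ⟨imbalance_addStubs d S hS, fun v => ⟨hdeg _ _ (addStubs_fst_le d S v) (h4 v).1,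
    hdeg _ _ (addStubs_snd_le d S v) (h4 v).2⟩, ?_, ?_, ?_⟩
  · have := abs_sum_mul_ite_sub_le S d.2 (addStubs d S).2 (fun _ => True) (fun _ => True)
      (fun v => addStubs_snd_of_notMem d) (fun _ _ => Iff.rfl) (addStubs_snd_le d S)
    simp only [if_true, mul_one] at this
    rw [abs_le] at this h1 ⊢
    constructor <;> linarith [this.1, this.2, h1.1, h1.2]
  · have := abs_sum_mul_ite_sub_le S d.2 (addStubs d S).2 (fun v => seqDegree α d v = k)
      (fun v => seqDegree α (addStubs d S) v = k)
      (fun v => addStubs_snd_of_notMem d)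
      (fun v hv => by rw [seqDegree_addStubs_of_notMem α d hv]) (addStubs_snd_le d S)
    rw [abs_le] at this h2 ⊢
    constructor <;> linarith [this.1, this.2, h2.1, h2.2]
  · have := abs_sum_mul_ite_sub_le S d.1 (addStubs d S).1 (fun v => seqDegree β d v = l)
      (fun v => seqDegree β (addStubs d S) v = l)
      (fun v => addStubs_fst_of_notMem d)
      (fun v hv => by rw [seqDegree_addStubs_of_notMem β d hv]) (addStubs_fst_le d S)
    rw [abs_le] at this h3 ⊢
    constructor <;> linarith [this.1, this.2, h3.1, h3.2]

end Typical

/-! ### Convergence in probability of the pairing statistics. -/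

section Convergence

/-- With F = 2D(D+1) + 1 ≤ θm, the first summand is at most 4θ, since m - F ≥ m / 2 and 1 ≤ θm. The
second is at most 1 / (1 - θ)² ≤ 1 + 8θ. -/
lemma covBound_le {m D θ : ℝ} (hθ : θ ≤ 1 / 2) (hm : 0 < m)
    (hm' : 1 ≤ θ * m) (hF : 2 * D * (D + 1) + 1 ≤ θ * m) :
    2 * D * (D + 1) + 1 < m ∧ covBound m D ≤ 12 * θ := by
  set F := 2 * D * (D + 1) + 1 with hFdef
  have hθ0 : 0 < θ := by
    by_contra h
    nlinarith
  have h1 : F ≤ m / 2 := by nlinarith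
  have hL : 0 < m - F := by linarith
  refine ⟨by linarith, ?_⟩
  rw [covBound, ← hFdef]
  have h2 : 2 / (m - F) ≤ 4 * θ := by
    rw [div_le_iff₀ hL]
    nlinarith
  have h3 : m ^ 2 / (m - F) ^ 2 ≤ 1 + 8 * θ := by
    rw [div_le_iff₀ (by positivity)]
    have h4 : (1 - θ) * m ≤ m - F := by linarith
    have h5 : ((1 - θ) * m) ^ 2 ≤ (m - F) ^ 2 :=
      pow_le_pow_left₀ (mul_nonneg (by linarith) hm.le) h4 2
    have h6 : 1 ≤ (1 + 8 * θ) * (1 - θ) ^ 2 := by nlinarith [mul_pos hθ0 hθ0]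
    nlinarith [sq_nonneg m, mul_le_mul_of_nonneg_right h6 (sq_nonneg m)]
  linarith

lemma exists_covBound_le {μ ε : ℝ} (hμ : 0 < μ) (hε : 0 < ε) :
    ∃ η : ℝ, 0 < η ∧ ∀ᶠ n : ℕ in atTop, ∀ m : ℝ, μ * n / 2 ≤ m → ∀ D : ℕ,
      (D : ℝ) ^ 2 ≤ η * n → 2 * (D : ℝ) * (D + 1) + 1 < m ∧ covBound m D ≤ ε := by
  set θ := min (1 / 2) (ε / 12) with hθ
  have hθ0 : 0 < θ := by positivity
  -- As D ≤ D² for natural D, 2D(D+1) + 1 ≤ 4D² + 1 ≤ θμn / 4 + 1, which is at most θμn / 2 once θμn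
  -- ≥ 4.
  refine ⟨θ * μ / 16, by positivity, ?_⟩
  filter_upwards [(tendsto_natCast_atTop_atTop (R := ℝ)).eventually_ge_atTop (4 / (θ * μ))]
    with n hn m hm D hD
  rw [div_le_iff₀ (by positivity)] at hn
  have hDD : (D : ℝ) ≤ (D : ℝ) ^ 2 := by
    rcases Nat.eq_zero_or_pos D with rfl | h
    · simp
    · have : (1 : ℝ) ≤ D := by exact_mod_cast h
      nlinarith
  have h1 : θ * (μ * n / 2) ≤ θ * m := mul_le_mul_of_nonneg_left hm hθ0.le
  have hm0 : 0 < m := by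
    by_contra h
    nlinarith
  obtain ⟨h2, h3⟩ := covBound_le (m := m) (D := D) (θ := θ) (min_le_left _ _)
    hm0 (by linarith) (by nlinarith)
  exact ⟨h2, h3.trans (by linarith [min_le_right (1 / 2) (ε / 12)])⟩

variable {Fminus Fplus : Measure ℕ} [IsProbabilityMeasure Fminus] [IsProbabilityMeasure Fplus]
  {κ δ : ℝ}

/-- What typicality means for the simple pairings. -/
lemma exists_typical_covBound_le (hpos : 0 < mean Fplus) {ε : ℝ} (hε : 0 < ε) :
    ∃ η₀ : ℝ, 0 < η₀ ∧ ∀ η : ℝ, 0 < η → η ≤ η₀ → ∀ᶠ n : ℕ in atTop, ∀ α β : DegType, ∀ k l : ℕ,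
      ∀ d ∈ typical Fminus Fplus η α β k l n,
      mean Fplus * n / 2 ≤ ((∑ v, d.2 v : ℕ) : ℝ) ∧
      ∃ D : ℕ, (∀ v, d.1 v ≤ D) ∧ (∀ v, d.2 v ≤ D) ∧
        (2 * D * (D + 1) + 1 : ℝ) < ((∑ v, d.2 v : ℕ) : ℝ) ∧
        covBound ((∑ v, d.2 v : ℕ) : ℝ) D ≤ ε := by
  obtain ⟨η₁, hη₁, h⟩ := exists_covBound_le hpos hε
  refine ⟨min η₁ (mean Fplus / 2), by positivity, fun η hη hηη => ?_⟩
  filter_upwards [h] with n hn α β k l d hd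
  obtain ⟨h1, h2, h3, -, -⟩ := hd
  have hn0 : (0 : ℝ) ≤ n := Nat.cast_nonneg n
  have hm : mean Fplus * n / 2 ≤ ((∑ v, d.2 v : ℕ) : ℝ) := by
    push_cast
    have h4 : η * n ≤ mean Fplus / 2 * n :=
      mul_le_mul_of_nonneg_right (hηη.trans (min_le_right _ _)) hn0
    linarith [(abs_le.1 h3).1]
  have h5 : η * n ≤ η₁ * n := mul_le_mul_of_nonneg_right (hηη.trans (min_le_left _ _)) hn0
  refine ⟨hm, ⌊√(η₁ * n)⌋₊, fun v => ?_, fun v => ?_, hn _ hm _ ?_⟩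
  · exact Nat.le_floor (Real.le_sqrt_of_sq_le ((h2 v).1.trans h5))
  · exact Nat.le_floor (Real.le_sqrt_of_sq_le ((h2 v).2.trans h5))
  · have h6 : (⌊√(η₁ * n)⌋₊ : ℝ) ≤ √(η₁ * n) := Nat.floor_le (Real.sqrt_nonneg _)
    calc (⌊√(η₁ * n)⌋₊ : ℝ) ^ 2 ≤ √(η₁ * n) ^ 2 := pow_le_pow_left₀ (Nat.cast_nonneg _) h6 2
      _ = η₁ * n := Real.sq_sqrt (by positivity)

lemma whp_graphical (hminus : Integrable (fun k : ℕ => (k : ℝ) ^ 2) Fminus)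
    (hplus : Integrable (fun k : ℕ => (k : ℝ) ^ 2) Fplus)
    (hmean : mean Fminus = mean Fplus) (hpos : 0 < mean Fminus)
    (hκ : κ ≤ 1 / 2) (hδ : 0 < δ) (hδκ : δ < κ) : Whp (biSeqLaw Fminus Fplus κ δ) graphical := by
  have hacc := whp_rawLaw_accepted hminus hplus hmean hκ hδ
  obtain ⟨η, hη, h⟩ := exists_typical_covBound_le (Fminus := Fminus) (hmean ▸ hpos) one_pos
  refine (whp_biSeqLaw_typical hminus hplus hmean hpos hδκ hacc hη .plus .plus 0 0).mono ?_
  filter_upwards [h η hη le_rfl] with n hn d hd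
  obtain ⟨-, D, hD1, hD2, hD3, -⟩ := hn _ _ _ _ d hd
  refine mem_graphical_of_degree_le d D hD1 hD2 hd.1 ?_
  have h1 : ((2 * D * (D + 1) : ℕ) : ℝ) < ((∑ v, d.2 v : ℕ) : ℝ) := by
    push_cast at hD3 ⊢
    linarith
  exact_mod_cast h1

lemma tendsto_rcmLaw_spearmanAverage (hminus : Integrable (fun k : ℕ => (k : ℝ) ^ 2) Fminus)
    (hplus : Integrable (fun k : ℕ => (k : ℝ) ^ 2) Fplus)
    (hmean : mean Fminus = mean Fplus) (hpos : 0 < mean Fminus)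
    (hκ : κ ≤ 1 / 2) (hδ : 0 < δ) (hδκ : δ < κ)
    (α β : DegType) {ε : ℝ} (hε : 0 < ε) :
    Tendsto (fun n => rcmLaw Fminus Fplus κ δ n {E | ε ≤ |spearmanAverage α β E|}) atTop
      (𝓝 0) := by
  have hacc := whp_rawLaw_accepted hminus hplus hmean hκ hδ
  refine tendsto_rcmLaw_zero hδκ hacc
    (whp_graphical hminus hplus hmean hpos hκ hδ hδκ) fun ε' hε' => ?_
  -- The factor ε² is what Chebyshev's inequality divides by.
  obtain ⟨η, hη, h⟩ := exists_typical_covBound_le (Fminus := Fminus) (hmean ▸ hpos)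
    (show 0 < ε' * ε ^ 2 by positivity)
  refine ⟨_, whp_biSeqLaw_typical hminus hplus hmean hpos hδκ hacc hη .plus .plus 0 0, ?_⟩
  filter_upwards [h η hη le_rfl] with n hn d hd
  obtain ⟨-, D, hD1, hD2, hD3, hD4⟩ := hn _ _ _ _ d hd
  have h1 := uniformImage_abs_ge_le (simplePairings d) pairingEdges (spearmanAverage α β) hε
    (sum_spearmanAverage_sq_le d D hD1 hD2 hd.1 hD3 α β)
  refine h1.trans (ENNReal.ofReal_le_ofReal ?_)
  rw [div_le_iff₀ (by positivity)]
  exact hD4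

lemma tendsto_rcmLaw_card_lt (hminus : Integrable (fun k : ℕ => (k : ℝ) ^ 2) Fminus)
    (hplus : Integrable (fun k : ℕ => (k : ℝ) ^ 2) Fplus)
    (hmean : mean Fminus = mean Fplus) (hpos : 0 < mean Fminus)
    (hκ : κ ≤ 1 / 2) (hδ : 0 < δ) (hδκ : δ < κ)
    (M : ℕ) :
    Tendsto (fun n => rcmLaw Fminus Fplus κ δ n {E | E.card < M}) atTop (𝓝 0) := by
  have hacc := whp_rawLaw_accepted hminus hplus hmean hκ hδ
  refine tendsto_rcmLaw_zero hδκ hacc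
    (whp_graphical hminus hplus hmean hpos hκ hδ hδκ) fun ε' hε' => ?_
  have hpos' : 0 < mean Fplus := hmean ▸ hpos
  obtain ⟨η, hη, h⟩ := exists_typical_covBound_le (Fminus := Fminus) hpos' one_pos
  refine ⟨_, whp_biSeqLaw_typical hminus hplus hmean hpos hδκ hacc hη .plus .plus 0 0, ?_⟩
  filter_upwards [h η hη le_rfl, (tendsto_natCast_atTop_atTop (R := ℝ)).eventually_ge_atTop
    (2 * M / mean Fplus)] with n hn hn' d hd
  obtain ⟨hm, -⟩ := hn _ _ _ _ d hd
  rw [div_le_iff₀ hpos'] at hn'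
  rw [uniformImage_eq_zero]
  · exact zero_le
  · exact MeasurableSet.of_discrete
  · intro σ hσ
    simp only [Set.mem_ofPred_eq, not_lt, card_pairingEdges (mem_simplePairings.1 hσ)]
    have : (M : ℝ) ≤ ((∑ v, d.2 v : ℕ) : ℝ) := by linarith
    exact_mod_cast this

lemma tendsto_rcmLaw_meanSpearman (hminus : Integrable (fun k : ℕ => (k : ℝ) ^ 2) Fminus)
    (hplus : Integrable (fun k : ℕ => (k : ℝ) ^ 2) Fplus)
    (hmean : mean Fminus = mean Fplus) (hpos : 0 < mean Fminus)
    (hκ : κ ≤ 1 / 2) (hδ : 0 < δ) (hδκ : δ < κ)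
    (α β : DegType) {ε : ℝ} (hε : 0 < ε) :
    Tendsto (fun n => rcmLaw Fminus Fplus κ δ n {E | ε ≤ |meanSpearman α β E|}) atTop
      (𝓝 0) := by
  have h := (tendsto_rcmLaw_card_lt hminus hplus hmean hpos hκ hδ hδκ 2).add
    (tendsto_rcmLaw_spearmanAverage hminus hplus hmean hpos hκ hδ hδκ α β
      (show 0 < ε / 24 by positivity))
  rw [add_zero] at h
  refine tendsto_of_tendsto_of_tendsto_of_le_of_le tendsto_const_nhds h (fun _ => zero_le)
    fun n => (measure_mono fun E hE => ?_).trans (measure_union_le _ _)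
  by_cases hc : E.card < 2
  · exact Or.inl hc
  · refine Or.inr ?_
    have h1 := abs_meanSpearman_le α β E (not_lt.1 hc)
    have h2 : ε ≤ |meanSpearman α β E| := hE
    simp only [Set.mem_ofPred_eq]
    linarith

/-- Turns laws of large numbers for a weighted count and for the number of stubs into one for their
quotient, by splitting the error as (A - nμp) - p(m - nμ). -/
lemma abs_div_sub_le {A m p nμ t : ℝ} (hm : 0 < m) (hA : |A - nμ * p| ≤ t) (hnm : |m - nμ| ≤ t)
    (hp : 0 ≤ p) : |A / m - p| ≤ (1 + p) * t / m := by
  have : A / m - p = ((A - nμ * p) - p * (m - nμ)) / m := by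
    field_simp
    ring
  rw [this, abs_div, abs_of_pos hm]
  gcongr
  calc |(A - nμ * p) - p * (m - nμ)| ≤ |A - nμ * p| + |p * (m - nμ)| := abs_sub _ _
    _ ≤ t + p * t := by
      rw [abs_mul, abs_of_nonneg hp]
      gcongr
    _ = _ := by ring

lemma srcLimit_nonneg (hmean : mean Fminus = mean Fplus) (hpos : 0 < mean Fminus)
    (α : DegType) (k : ℕ) : 0 ≤ srcLimit Fminus Fplus α k := by
  have : 0 < mean Fplus := hmean ▸ hpos
  cases α <;> simp only [srcLimit] <;> positivity

lemma tgtLimit_nonneg (hpos : 0 < mean Fminus) (β : DegType) (l : ℕ) : 0 ≤ tgtLimit Fminus Fplus β l := by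
  cases β <;> simp only [tgtLimit] <;> positivity

lemma tendsto_rcmLaw_empiricalJoint (hminus : Integrable (fun k : ℕ => (k : ℝ) ^ 2) Fminus)
    (hplus : Integrable (fun k : ℕ => (k : ℝ) ^ 2) Fplus)
    (hmean : mean Fminus = mean Fplus) (hpos : 0 < mean Fminus)
    (hκ : κ ≤ 1 / 2) (hδ : 0 < δ) (hδκ : δ < κ)
    (α β : DegType) (k l : ℕ) {ε : ℝ} (hε : 0 < ε) :
    Tendsto (fun n => rcmLaw Fminus Fplus κ δ n {E | ε ≤ |empiricalJoint α β k l E -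
      srcLimit Fminus Fplus α k * tgtLimit Fminus Fplus β l|}) atTop (𝓝 0) := by
  have hacc := whp_rawLaw_accepted hminus hplus hmean hκ hδ
  refine tendsto_rcmLaw_zero hδκ hacc
    (whp_graphical hminus hplus hmean hpos hκ hδ hδκ) fun ε' hε' => ?_
  have hpos' : 0 < mean Fplus := hmean ▸ hpos
  have hp0 : 0 ≤ srcLimit Fminus Fplus α k := srcLimit_nonneg hmean hpos α k
  have hq0 : 0 ≤ tgtLimit Fminus Fplus β l := tgtLimit_nonneg hpos β l
  set p := srcLimit Fminus Fplus α k with hp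
  set q := tgtLimit Fminus Fplus β l with hq
  set μ := mean Fplus with hμ
  obtain ⟨η₀, hη₀, h⟩ := exists_typical_covBound_le (Fminus := Fminus) hpos'
    (show 0 < ε' * (ε / 2) ^ 2 by positivity)
  -- Errors t in the two marginals change their product by at most t² + tq + pt; with t ≤ 1 this is
  -- at most t(1 + p + q) ≤ ε / 2.
  set t := min 1 (ε / (2 * (1 + p + q))) with ht
  have ht0 : 0 < t := by positivity
  -- Chosen so that, with at least μn / 2 edges, an error ηn in the counts becomes an error of at
  -- most t in the fractions.
  set η := min η₀ (t * μ / (2 * (1 + p + q))) with hη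
  have hη0 : 0 < η := by positivity
  refine ⟨_, whp_biSeqLaw_typical hminus hplus hmean hpos hδκ hacc hη0 α β k l, ?_⟩
  filter_upwards [h η hη0 (min_le_left _ _), eventually_gt_atTop 0] with n hn hn0 d hd
  obtain ⟨hm, D, hD1, hD2, hD3, hD4⟩ := hn _ _ _ _ d hd
  have hn0' : (0 : ℝ) < n := by exact_mod_cast hn0
  have hμn : 0 < μ * n / 2 := by positivity
  have h1 := uniformImage_abs_ge_le (simplePairings d) pairingEdges
    (fun E => empiricalJoint α β k l E - srcFraction α k d * tgtFraction β l d) (half_pos hε)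
    (sum_empiricalJoint_sub_sq_le d D hD1 hD2 hd.1 hD3 α β k l)
  refine le_trans (measure_mono ?_) (h1.trans (ENNReal.ofReal_le_ofReal ?_))
  swap
  · rw [div_le_iff₀ (by positivity)]
    exact hD4
  obtain ⟨-, -, t1, t2, t3⟩ := hd
  have hm0 : 0 < ∑ v, (d.2 v : ℝ) := by
    have := lt_of_lt_of_le hμn hm
    push_cast at this
    exact this
  rw [← mul_assoc, ← hp] at t2
  rw [← mul_assoc, ← hq, hmean] at t3
  have hpq : 0 < 1 + p + q := by positivity
  have hηt : (1 + p + q) * (η * n) / ∑ v, (d.2 v : ℝ) ≤ t := by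
    rw [div_le_iff₀ hm0]
    push_cast at hm
    have h2 : η ≤ t * μ / (2 * (1 + p + q)) := min_le_right _ _
    rw [le_div_iff₀ (by positivity)] at h2
    calc (1 + p + q) * (η * n) = (η * (2 * (1 + p + q))) * n / 2 := by ring
      _ ≤ t * μ * n / 2 := by gcongr
      _ = t * (μ * n / 2) := by ring
      _ ≤ _ := by gcongr
  have hsrc : |srcFraction α k d - p| ≤ t := by
    refine (abs_div_sub_le hm0 t2 t1 hp0).trans (le_trans ?_ hηt)
    exact div_le_div_of_nonneg_right
      (mul_le_mul_of_nonneg_right (by linarith) (by positivity)) hm0.le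
  have htgt : |tgtFraction β l d - q| ≤ t := by
    refine (abs_div_sub_le hm0 t3 t1 hq0).trans (le_trans ?_ hηt)
    exact div_le_div_of_nonneg_right
      (mul_le_mul_of_nonneg_right (by linarith) (by positivity)) hm0.le
  have hprod : |srcFraction α k d * tgtFraction β l d - p * q| ≤ ε / 2 := by
    have h3 : srcFraction α k d * tgtFraction β l d - p * q =
        (srcFraction α k d - p) * (tgtFraction β l d - q) + (srcFraction α k d - p) * q +
        p * (tgtFraction β l d - q) := by ring
    rw [h3]
    refine (abs_add_three _ _ _).trans ?_
    rw [abs_mul, abs_mul, abs_mul, abs_of_nonneg hp0, abs_of_nonneg hq0]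
    have h4 : |srcFraction α k d - p| * |tgtFraction β l d - q| ≤ t * 1 :=
      mul_le_mul hsrc (htgt.trans (min_le_left _ _)) (abs_nonneg _) ht0.le
    have h5 : |srcFraction α k d - p| * q ≤ t * q := by gcongr
    have h6 : p * |tgtFraction β l d - q| ≤ p * t := by gcongr
    have h7 : t ≤ ε / (2 * (1 + p + q)) := min_le_right _ _
    rw [le_div_iff₀ (by positivity)] at h7
    linarith
  intro E hE
  have hE' : ε ≤ |empiricalJoint α β k l E - p * q| := hE
  have h8 := abs_sub_le (empiricalJoint α β k l E) (srcFraction α k d * tgtFraction β l d) (p * q)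
  simp only [Set.mem_ofPred_eq]
  linarith

end Convergence

/-! ### Random tie-breaking: ranks with marks against average ranks. -/

section Marks

variable {n : ℕ}

instance : IsProbabilityMeasure (volume.restrict (Set.Ico (0 : ℝ) 1)) :=
  ⟨by simp⟩

instance : IsProbabilityMeasure (marksLaw n) := by
  unfold marksLaw; infer_instance

/-- The centred comparison of two marks. -/
def markSign (x y : ℝ) : ℝ := (if x ≤ y then 1 else 0) - 1 / 2

lemma abs_markSign_le (x y : ℝ) : |markSign x y| ≤ 1 := by
  rw [markSign, abs_le]
  split_ifs <;> constructor <;> norm_num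

lemma markSign_swap {x y : ℝ} (h : x ≠ y) : markSign y x = -markSign x y := by
  rcases lt_or_gt_of_ne h with h | h
  · rw [markSign, markSign, if_pos h.le, if_neg h.not_ge]; norm_num
  · rw [markSign, markSign, if_pos h.le, if_neg h.not_ge]; norm_num

lemma measurable_markSign (i j : Fin n × Fin n) :
    Measurable fun u : Fin n × Fin n → ℝ => markSign (u i) (u j) := by
  unfold markSign
  exact (Measurable.ite (measurableSet_le (measurable_pi_apply i) (measurable_pi_apply j))
    measurable_const measurable_const).sub measurable_const

lemma ae_marks_mem (n : ℕ) : ∀ᵐ u ∂(marksLaw n), ∀ i, u i ∈ Set.Ico (0 : ℝ) 1 := by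
  rw [ae_all_iff]
  intro i
  exact (measurePreserving_eval (fun _ : Fin n × Fin n => volume.restrict (Set.Ico (0 : ℝ) 1))
    i).quasiMeasurePreserving.ae (ae_restrict_mem measurableSet_Ico)

lemma ae_marks_ne {i j : Fin n × Fin n} (hij : i ≠ j) : ∀ᵐ u ∂(marksLaw n), u i ≠ u j := by
  set ν := volume.restrict (Set.Ico (0 : ℝ) 1)
  have hind : iIndepFun (fun (i : Fin n × Fin n) (u : Fin n × Fin n → ℝ) => u i) (marksLaw n) :=
    iIndepFun_pi (μ := fun _ : Fin n × Fin n => ν) (X := fun _ x => x) fun _ => aemeasurable_id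
  have hmap := (indepFun_iff_map_prod_eq_prod_map_map (measurable_pi_apply i).aemeasurable
    (measurable_pi_apply j).aemeasurable).1 (hind.indepFun hij)
  have hi : ∀ i, (marksLaw n).map (fun u => u i) = ν := fun i =>
    (measurePreserving_eval (fun _ : Fin n × Fin n => ν) i).map_eq
  rw [hi i, hi j] at hmap
  have hdiag : MeasurableSet (Set.diagonal ℝ) := measurableSet_diagonal
  have h0 : (ν.prod ν) (Set.diagonal ℝ) = 0 := by
    rw [Measure.measure_prod_null hdiag]
    refine Eventually.of_forall fun x => ?_
    have : Prod.mk x ⁻¹' Set.diagonal ℝ = {x} := by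
      ext y; simp [eq_comm]
    simp [this, ν]
  rw [← hmap, Measure.map_apply ((measurable_pi_apply i).prodMk (measurable_pi_apply j)) hdiag]
    at h0
  rw [ae_iff]
  refine (congrArg _ ?_).trans h0
  ext u
  simp

lemma measurePreserving_swap (i j : Fin n × Fin n) :
    MeasurePreserving (fun u : Fin n × Fin n → ℝ => u ∘ Equiv.swap i j) (marksLaw n)
      (marksLaw n) := by
  have h := measurePreserving_piCongrLeft
    (fun _ : Fin n × Fin n => volume.restrict (Set.Ico (0 : ℝ) 1)) (Equiv.swap i j)
  have heq : ⇑(MeasurableEquiv.piCongrLeft (fun _ : Fin n × Fin n => ℝ) (Equiv.swap i j)) =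
      fun u : Fin n × Fin n → ℝ => u ∘ Equiv.swap i j := by
    ext u x
    obtain ⟨y, rfl⟩ := (Equiv.swap i j).surjective x
    rw [MeasurableEquiv.coe_piCongrLeft, Equiv.piCongrLeft_apply_apply]
    simp
  rw [heq] at h
  exact h

/-- Comparisons of disjoint pairs of marks are uncorrelated. -/
lemma integral_markSign_mul_eq_zero {i j i' j' : Fin n × Fin n} (hij : i ≠ j) (h₁ : i' ≠ i)
    (h₂ : i' ≠ j) (h₃ : j' ≠ i) (h₄ : j' ≠ j) :
    ∫ u, markSign (u i) (u j) * markSign (u i') (u j') ∂(marksLaw n) = 0 := by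
  set F : (Fin n × Fin n → ℝ) → ℝ := fun u =>
    markSign (u i) (u j) * markSign (u i') (u j') with hF
  have hmeas : Measurable F := (measurable_markSign i j).mul (measurable_markSign i' j')
  have h1 : ∫ u, F (u ∘ Equiv.swap i j) ∂(marksLaw n) = ∫ u, F u ∂(marksLaw n) := by
    have h := integral_map (μ := marksLaw n) (measurePreserving_swap i j).measurable.aemeasurable
      (f := F) hmeas.aestronglyMeasurable
    rw [(measurePreserving_swap i j).map_eq] at h
    exact h.symm
  -- Exchanging the marks at `i` and `j` preserves their law, flips the first factor almost surely
  -- and leaves the second alone; the integral thus equals its own negative.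
  have h2 : ∫ u, F (u ∘ Equiv.swap i j) ∂(marksLaw n) = ∫ u, -F u ∂(marksLaw n) := by
    refine integral_congr_ae ?_
    filter_upwards [ae_marks_ne hij] with u hu
    simp only [hF, Function.comp_apply, Equiv.swap_apply_left, Equiv.swap_apply_right,
      Equiv.swap_apply_of_ne_of_ne h₁ h₂, Equiv.swap_apply_of_ne_of_ne h₃ h₄, markSign_swap hu]
    ring
  rw [integral_neg, h1] at h2
  linarith

/-- The deviation of the random rank from the average rank comes from the ties. -/
lemma randomRank_sub_averageRank (E : Edges n) (a : Fin n × Fin n → ℕ) {u : Fin n × Fin n → ℝ}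
    (hu : ∀ i, u i ∈ Set.Ico (0 : ℝ) 1) {e : Fin n × Fin n} (he : e ∈ E) :
    randomRank E a u e - averageRank E a e =
      ∑ f ∈ E.erase e, if a e = a f then markSign (u e) (u f) else 0 := by
  have hterm : ∀ f, (if (a f : ℝ) + u f ≥ (a e : ℝ) + u e then (1 : ℝ) else 0) -
      ((if a f > a e then 1 else 0) + 1 / 2 * (if a f = a e then 1 else 0)) =
      if a e = a f then markSign (u e) (u f) else 0 := by
    intro f
    obtain ⟨h1, h2⟩ := hu e
    obtain ⟨h3, h4⟩ := hu f
    rcases lt_trichotomy (a e) (a f) with h | h | h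
    · have h' : (a e : ℝ) + 1 ≤ a f := by exact_mod_cast h
      rw [if_pos (by linarith), if_pos h, if_neg h.ne', if_neg h.ne]
      norm_num
    · rw [if_neg (by omega : ¬ a f > a e), if_pos h.symm, if_pos h, markSign]
      simp only [h, ge_iff_le, add_le_add_iff_left]
      ring
    · have h' : (a f : ℝ) + 1 ≤ a e := by exact_mod_cast h
      rw [if_neg (by linarith), if_neg h.not_gt, if_neg h.ne, if_neg h.ne']
      norm_num
  -- The term `f = e` contributes 1 - 1/2, which is exactly the constant 1/2 in the average rank;
  -- only ties with other edges survive.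
  have hsum := Finset.sum_congr (rfl : E = E) fun f _ => hterm f
  rw [Finset.sum_sub_distrib, ← Finset.add_sum_erase E (fun f =>
    if a e = a f then markSign (u e) (u f) else 0) he] at hsum
  simp only [if_true, markSign, le_refl] at hsum
  simp only [randomRank, averageRank, markSign]
  linarith

lemma measurable_randomRank (E : Edges n) (a : Fin n × Fin n → ℕ) (e : Fin n × Fin n) :
    Measurable fun u => randomRank E a u e := by
  unfold randomRank
  refine Finset.measurable_sum _ fun f _ => Measurable.ite ?_ measurable_const measurable_const
  exact measurableSet_le (measurable_const.add (measurable_pi_apply e))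
    (measurable_const.add (measurable_pi_apply f))

lemma abs_randomRank_le (E : Edges n) (a : Fin n × Fin n → ℕ) (u : Fin n × Fin n → ℝ)
    (e : Fin n × Fin n) : |randomRank E a u e| ≤ E.card := by
  rw [randomRank, abs_of_nonneg (Finset.sum_nonneg fun f _ => by split_ifs <;> norm_num)]
  calc _ ≤ ∑ f ∈ E, (1 : ℝ) := Finset.sum_le_sum fun f _ => by split_ifs <;> norm_num
    _ = _ := by simp

/-- A pair of edges shares an edge with at most `4 m ^ 3` pairs. -/
lemma card_filter_not_disjoint_le (E : Edges n) :
    ((E.offDiag ×ˢ E.offDiag).filter fun q => ¬ (q.2.1 ≠ q.1.1 ∧ q.2.1 ≠ q.1.2 ∧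
      q.2.2 ≠ q.1.1 ∧ q.2.2 ≠ q.1.2)).card ≤ 4 * E.card ^ 3 := by
  let T := E ×ˢ E ×ˢ E
  have hT : T.card = E.card ^ 3 := by simp only [T, Finset.card_product]; ring
  have hsub : ((E.offDiag ×ˢ E.offDiag).filter fun q => ¬ (q.2.1 ≠ q.1.1 ∧ q.2.1 ≠ q.1.2 ∧
      q.2.2 ≠ q.1.1 ∧ q.2.2 ≠ q.1.2)) ⊆
      ((T.image fun t => ((t.1, t.2.1), (t.1, t.2.2))) ∪
        (T.image fun t => ((t.1, t.2.1), (t.2.1, t.2.2)))) ∪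
      ((T.image fun t => ((t.1, t.2.1), (t.2.2, t.1))) ∪
        (T.image fun t => ((t.1, t.2.1), (t.2.2, t.2.1)))) := by
    rintro ⟨⟨i, j⟩, ⟨i', j'⟩⟩ hq
    simp only [Finset.mem_filter, Finset.mem_product, Finset.mem_offDiag] at hq
    obtain ⟨⟨⟨hi, hj, -⟩, ⟨hi', hj', -⟩⟩, hq⟩ := hq
    have hcases : i' = i ∨ i' = j ∨ j' = i ∨ j' = j := by tauto
    simp only [Finset.mem_union, Finset.mem_image, T, Finset.mem_product]
    rcases hcases with rfl | rfl | rfl | rfl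
    · exact Or.inl (Or.inl ⟨(i', j, j'), ⟨hi, hj, hj'⟩, rfl⟩)
    · exact Or.inl (Or.inr ⟨(i, i', j'), ⟨hi, hj, hj'⟩, rfl⟩)
    · exact Or.inr (Or.inl ⟨(j', j, i'), ⟨hi, hj, hi'⟩, rfl⟩)
    · exact Or.inr (Or.inr ⟨(i, j', i'), ⟨hi, hj, hi'⟩, rfl⟩)
  have h1 := Finset.card_le_card hsub
  have h2 := Finset.card_union_le
    ((T.image fun t => ((t.1, t.2.1), (t.1, t.2.2))) ∪
        (T.image fun t => ((t.1, t.2.1), (t.2.1, t.2.2))))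
      ((T.image fun t => ((t.1, t.2.1), (t.2.2, t.1))) ∪
        (T.image fun t => ((t.1, t.2.1), (t.2.2, t.2.1))))
  have h3 := Finset.card_union_le (T.image fun t => ((t.1, t.2.1), (t.1, t.2.2)))
        (T.image fun t => ((t.1, t.2.1), (t.2.1, t.2.2)))
  have h4 := Finset.card_union_le (T.image fun t => ((t.1, t.2.1), (t.2.2, t.1)))
        (T.image fun t => ((t.1, t.2.1), (t.2.2, t.2.1)))
  have c1 := Finset.card_image_le (s := T) (f := fun t => ((t.1, t.2.1), (t.1, t.2.2)))
  have c2 := Finset.card_image_le (s := T) (f := fun t => ((t.1, t.2.1), (t.2.1, t.2.2)))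
  have c3 := Finset.card_image_le (s := T) (f := fun t => ((t.1, t.2.1), (t.2.2, t.1)))
  have c4 := Finset.card_image_le (s := T) (f := fun t => ((t.1, t.2.1), (t.2.2, t.2.1)))
  omega

/-- Among roughly m⁴ pairs of ordered pairs of edges only those sharing an edge, at most 4m³,
contribute, and each contributes at most C². For weights of order m this is m⁵, below the squared
normalization of order m⁶. -/
lemma integral_sq_sum_rank_le (E : Edges n) (a : Fin n × Fin n → ℕ) (c : Fin n × Fin n → ℝ)
    {C : ℝ} (hC : ∀ e, |c e| ≤ C) :
    ∫ u, (∑ e ∈ E, c e * (randomRank E a u e - averageRank E a e)) ^ 2 ∂(marksLaw n) ≤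
      4 * (E.card : ℝ) ^ 3 * C ^ 2 := by
  let w : (Fin n × Fin n) × (Fin n × Fin n) → ℝ := fun p => if a p.1 = a p.2 then c p.1 else 0
  have hw : ∀ p, |w p| ≤ C := by
    intro p
    simp only [w]
    split_ifs
    · exact hC _
    · simpa using (abs_nonneg _).trans (hC p.1)
  let g : (Fin n × Fin n) × (Fin n × Fin n) → (Fin n × Fin n → ℝ) → ℝ :=
    fun p u => markSign (u p.1) (u p.2)
  have hrepr : ∀ᵐ u ∂(marksLaw n),
      (∑ e ∈ E, c e * (randomRank E a u e - averageRank E a e)) ^ 2 =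
      ∑ q ∈ E.offDiag ×ˢ E.offDiag, w q.1 * w q.2 * (g q.1 u * g q.2 u) := by
    filter_upwards [ae_marks_mem n] with u hu
    have h1 : ∑ e ∈ E, c e * (randomRank E a u e - averageRank E a e) =
        ∑ p ∈ E.offDiag, w p * g p u := by
      rw [Finset.sum_congr rfl fun e he => by rw [randomRank_sub_averageRank E a hu he]]
      rw [Finset.sum_congr rfl fun e _ => Finset.mul_sum _ _ _, Finset.sum_sigma']
      refine Finset.sum_bij (fun x _ => (x.1, x.2)) ?_ ?_ ?_ ?_
      · rintro ⟨e, f⟩ h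
        simp only [Finset.mem_sigma, Finset.mem_erase] at h
        simp only [Finset.mem_offDiag]
        exact ⟨h.1, h.2.2, h.2.1.symm⟩
      · rintro ⟨e, f⟩ _ ⟨e', f'⟩ _ h
        simp only [Prod.mk.injEq] at h
        rw [h.1, h.2]
      · rintro ⟨e, f⟩ h
        simp only [Finset.mem_offDiag] at h
        exact ⟨⟨e, f⟩, by simp [h.1, h.2.1, Ne.symm h.2.2], rfl⟩
      · rintro ⟨e, f⟩ _
        simp only [w, g]
        split_ifs <;> simp
    rw [h1, pow_two, Finset.sum_mul_sum, ← Finset.sum_product']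
    exact Finset.sum_congr rfl fun q _ => by ring
  have hgg : ∀ q : _ × _, Measurable fun u => g q.1 u * g q.2 u := fun q =>
    (measurable_markSign _ _).mul (measurable_markSign _ _)
  have hgle : ∀ (q : _ × _) u, |g q.1 u * g q.2 u| ≤ 1 := fun q u => by
    rw [abs_mul]
    exact mul_le_one₀ (abs_markSign_le _ _) (abs_nonneg _) (abs_markSign_le _ _)
  have hint : ∀ q : _ × _, Integrable (fun u => g q.1 u * g q.2 u) (marksLaw n) := fun q =>
    Integrable.of_bound (hgg q).aestronglyMeasurable 1 (Eventually.of_forall fun u => hgle q u)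
  rw [integral_congr_ae hrepr, integral_finsetSum _ fun q _ => (hint q).const_mul _]
  simp_rw [integral_const_mul]
  rw [← Finset.sum_filter_add_sum_filter_not (E.offDiag ×ˢ E.offDiag) (fun q =>
    q.2.1 ≠ q.1.1 ∧ q.2.1 ≠ q.1.2 ∧ q.2.2 ≠ q.1.1 ∧ q.2.2 ≠ q.1.2)]
  have hzero : ∑ q ∈ (E.offDiag ×ˢ E.offDiag).filter (fun q =>
      q.2.1 ≠ q.1.1 ∧ q.2.1 ≠ q.1.2 ∧ q.2.2 ≠ q.1.1 ∧ q.2.2 ≠ q.1.2),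
      w q.1 * w q.2 * ∫ u, g q.1 u * g q.2 u ∂(marksLaw n) = 0 := by
    refine Finset.sum_eq_zero fun q hq => ?_
    simp only [Finset.mem_filter, Finset.mem_product, Finset.mem_offDiag] at hq
    simp only [g]
    rw [integral_markSign_mul_eq_zero hq.1.1.2.2 hq.2.1 hq.2.2.1 hq.2.2.2.1 hq.2.2.2.2, mul_zero]
  rw [hzero, zero_add]
  have hbound : ∀ q : _ × _, w q.1 * w q.2 * ∫ u, g q.1 u * g q.2 u ∂(marksLaw n) ≤ C ^ 2 := by
    intro q
    refine (le_abs_self _).trans ?_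
    rw [abs_mul, abs_mul]
    have h1 : |∫ u, g q.1 u * g q.2 u ∂(marksLaw n)| ≤ 1 := by
      have := norm_integral_le_of_norm_le_const (μ := marksLaw n)
        (f := fun u => g q.1 u * g q.2 u) (C := 1) (Eventually.of_forall fun u => hgle q u)
      simpa using this
    have h2 : |w q.1| * |w q.2| ≤ C * C :=
      mul_le_mul (hw _) (hw _) (abs_nonneg _) ((abs_nonneg _).trans (hw q.1))
    calc |w q.1| * |w q.2| * |∫ u, g q.1 u * g q.2 u ∂(marksLaw n)| ≤ C * C * 1 :=
          mul_le_mul h2 h1 (abs_nonneg _) ((by positivity : 0 ≤ |w q.1| * |w q.2|).trans h2)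
      _ = C ^ 2 := by ring
  refine (Finset.sum_le_card_nsmul _ _ _ fun q _ => hbound q).trans ?_
  rw [nsmul_eq_mul]
  refine mul_le_mul_of_nonneg_right ?_ (sq_nonneg _)
  exact_mod_cast card_filter_not_disjoint_le E

lemma marksLaw_abs_sum_rank_ge_le (E : Edges n) (a : Fin n × Fin n → ℕ) (c : Fin n × Fin n → ℝ)
    {C ε : ℝ} (hC : ∀ e, |c e| ≤ C) (hε : 0 < ε) :
    marksLaw n {u | ε ≤ |∑ e ∈ E, c e * (randomRank E a u e - averageRank E a e)|} ≤
      ENNReal.ofReal (4 * (E.card : ℝ) ^ 3 * C ^ 2 / ε ^ 2) := by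
  have hmeas : Measurable fun u => ∑ e ∈ E, c e * (randomRank E a u e - averageRank E a e) :=
    Finset.measurable_sum _ fun e _ =>
      ((measurable_randomRank E a e).sub measurable_const).const_mul _
  have hbd : ∀ u, |∑ e ∈ E, c e * (randomRank E a u e - averageRank E a e)| ≤
      ∑ e ∈ E, |c e| * (E.card + |averageRank E a e|) := by
    intro u
    refine (Finset.abs_sum_le_sum_abs _ _).trans (Finset.sum_le_sum fun e _ => ?_)
    rw [abs_mul]
    gcongr
    exact (abs_sub _ _).trans (add_le_add_left (abs_randomRank_le E a u e) _)
  have hint : Integrable (fun u =>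
      (∑ e ∈ E, c e * (randomRank E a u e - averageRank E a e)) ^ 2) (marksLaw n) := by
    refine Integrable.of_bound (hmeas.pow_const 2).aestronglyMeasurable
      ((∑ e ∈ E, |c e| * (E.card + |averageRank E a e|)) ^ 2) (Eventually.of_forall fun u => ?_)
    rw [norm_pow]
    exact pow_le_pow_left₀ (norm_nonneg _) (hbd u) 2
  have h := mul_meas_ge_le_integral_of_nonneg (μ := marksLaw n)
    (Eventually.of_forall fun u => sq_nonneg _) hint (ε ^ 2)
  have hset : {u | ε ≤ |∑ e ∈ E, c e * (randomRank E a u e - averageRank E a e)|} =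
      {u | ε ^ 2 ≤ (∑ e ∈ E, c e * (randomRank E a u e - averageRank E a e)) ^ 2} := by
    ext u
    simp only [Set.mem_ofPred_eq]
    rw [← sq_abs (∑ e ∈ E, _), sq_le_sq₀ hε.le (abs_nonneg _)]
  rw [hset, ← ENNReal.ofReal_toReal (measure_ne_top (marksLaw n) _)]
  refine ENNReal.ofReal_le_ofReal ?_
  rw [le_div_iff₀ (by positivity), mul_comm]
  exact h.trans (integral_sq_sum_rank_le E a c hC)

lemma measurable_spearman (α β : DegType) (E : Edges n) :
    Measurable fun p : (Fin n × Fin n → ℝ) × (Fin n × Fin n → ℝ) => spearman α β E p.1 p.2 := by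
  unfold spearman
  refine Measurable.div_const (Measurable.sub_const (Measurable.const_mul ?_ _) _) _
  exact Finset.measurable_sum _ fun e _ => ((measurable_randomRank E _ e).comp measurable_fst).mul
    ((measurable_randomRank E _ e).comp measurable_snd)

/-- Given a graph with many edges, Spearman's rho with random ranks is close to its mean. -/
lemma marksLaw_prod_abs_spearman_sub_ge_le (α β : DegType) (E : Edges n) (hE : 2 ≤ E.card)
    {ε : ℝ} (hε : 0 < ε) :
    ((marksLaw n).prod (marksLaw n)) {p | ε ≤ |spearman α β E p.1 p.2 - meanSpearman α β E|} ≤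
      ENNReal.ofReal (80000 / (ε ^ 2 * E.card)) := by
  set m : ℝ := (E.card : ℝ) with hm
  have hm2 : (2 : ℝ) ≤ m := by rw [hm]; exact_mod_cast hE
  have hden : m ^ 3 / 2 ≤ m ^ 3 - m := by
    nlinarith [mul_nonneg (by linarith : 0 ≤ m) (by nlinarith : 0 ≤ m ^ 2 - 4)]
  have hm3 : 0 < m ^ 3 := by positivity
  -- If both sums below are smaller than t, then 12 · 2t = εm³ / 2 ≤ ε(m³ - m) contradicts the
  -- deviation ε.
  set t := ε * m ^ 3 / 48 with ht
  have ht0 : 0 < t := by positivity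
  let R := fun (u : Fin n × Fin n → ℝ) e => randomRank E (srcDegree E α) u e
  let R' := fun (w : Fin n × Fin n → ℝ) e => randomRank E (tgtDegree E β) w e
  let Q := averageRank E (srcDegree E α)
  let Q' := averageRank E (tgtDegree E β)
  have hsub : {p : (Fin n × Fin n → ℝ) × (Fin n × Fin n → ℝ) |
      ε ≤ |spearman α β E p.1 p.2 - meanSpearman α β E|} ⊆
      {p | t ≤ |∑ e ∈ E, R' p.2 e * (R p.1 e - Q e)|} ∪
      {p | t ≤ |∑ e ∈ E, Q e * (R' p.2 e - Q' e)|} := by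
    rintro ⟨u, w⟩ hp
    simp only [Set.mem_union, Set.mem_ofPred_eq] at hp ⊢
    by_contra! hcon
    -- Telescoping R R' - Q Q' = R'(R - Q) + Q(R' - Q') leaves one random centred factor in each sum
    -- once the other vector of marks is fixed.
    have hdecomp : spearman α β E u w - meanSpearman α β E =
        12 * (∑ e ∈ E, R' w e * (R u e - Q e) + ∑ e ∈ E, Q e * (R' w e - Q' e)) /
          (m ^ 3 - m) := by
      rw [spearman, meanSpearman, ← sub_div]
      congr 1
      rw [sub_sub_sub_cancel_right, ← mul_sub, ← Finset.sum_sub_distrib, ← Finset.sum_add_distrib]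
      congr 1
      exact Finset.sum_congr rfl fun e _ => by simp only [R, R', Q, Q']; ring
    rw [hdecomp, abs_div, abs_of_pos (by linarith : 0 < m ^ 3 - m), le_div_iff₀ (by linarith),
      abs_mul, abs_of_pos (by norm_num : (0 : ℝ) < 12)] at hp
    have h1 := abs_add_le (∑ e ∈ E, R' w e * (R u e - Q e)) (∑ e ∈ E, Q e * (R' w e - Q' e))
    have h2 : ε * (m ^ 3 / 2) ≤ ε * (m ^ 3 - m) := by gcongr
    have h3 : t * 48 = ε * m ^ 3 := by rw [ht]; ring
    linarith [hcon.1, hcon.2]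
  have hval : 4 * m ^ 3 * (2 * m) ^ 2 / t ^ 2 ≤ 40000 / (ε ^ 2 * m) := by
    rw [div_le_div_iff₀ (by positivity) (by positivity), ht]
    have : 0 < ε ^ 2 * m ^ 6 := by positivity
    calc 4 * m ^ 3 * (2 * m) ^ 2 * (ε ^ 2 * m) = 16 * (ε ^ 2 * m ^ 6) := by ring
      _ ≤ 40000 / 2304 * (ε ^ 2 * m ^ 6) := by gcongr; norm_num
      _ = _ := by ring
  have hmR : ∀ e, Measurable fun p : (Fin n × Fin n → ℝ) × (Fin n × Fin n → ℝ) => R p.1 e :=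
    fun e => (measurable_randomRank E _ e).comp measurable_fst
  have hmR' : ∀ e, Measurable fun p : (Fin n × Fin n → ℝ) × (Fin n × Fin n → ℝ) => R' p.2 e :=
    fun e => (measurable_randomRank E _ e).comp measurable_snd
  have hQ : ∀ e, |Q e| ≤ 2 * m := by
    intro e
    have := averageRank_mem E (srcDegree E α) e
    rw [abs_le]
    constructor <;> simp only [Q] <;> linarith
  refine (measure_mono hsub).trans ((measure_union_le _ _).trans ?_)
  have h80 : (80000 : ℝ) / (ε ^ 2 * m) = 40000 / (ε ^ 2 * m) + 40000 / (ε ^ 2 * m) := by ring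
  rw [h80, ENNReal.ofReal_add (by positivity) (by positivity)]
  refine add_le_add ?_ ?_
  · have hms : MeasurableSet {p : (Fin n × Fin n → ℝ) × (Fin n × Fin n → ℝ) |
        t ≤ |∑ e ∈ E, R' p.2 e * (R p.1 e - Q e)|} :=
      measurableSet_le measurable_const (Finset.measurable_sum _ fun e _ =>
        (hmR' e).mul ((hmR e).sub_const _)).abs
    -- Integrating over the source marks for fixed `w` makes the weights `R' w` deterministic.
    rw [Measure.prod_apply_symm hms]
    refine (lintegral_mono (g := fun _ => ENNReal.ofReal (40000 / (ε ^ 2 * m))) fun w => ?_).trans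
      (by simp)
    refine (marksLaw_abs_sum_rank_ge_le E (srcDegree E α) (R' w) (C := 2 * m) (fun e => ?_)
      ht0).trans (ENNReal.ofReal_le_ofReal hval)
    exact (abs_randomRank_le E _ w e).trans (by linarith)
  · have hms : MeasurableSet {p : (Fin n × Fin n → ℝ) × (Fin n × Fin n → ℝ) |
        t ≤ |∑ e ∈ E, Q e * (R' p.2 e - Q' e)|} :=
      measurableSet_le measurable_const (Finset.measurable_sum _ fun e _ =>
        ((hmR' e).sub_const _).const_mul _).abs
    rw [Measure.prod_apply hms]
    refine (lintegral_mono (g := fun _ => ENNReal.ofReal (40000 / (ε ^ 2 * m))) fun u => ?_).trans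
      (by simp)
    exact (marksLaw_abs_sum_rank_ge_le E (tgtDegree E β) Q (C := 2 * m) hQ
      ht0).trans (ENNReal.ofReal_le_ofReal hval)

end Marks

/-! ### Kendall's tau as a quadratic form in the empirical joint distribution. -/

section Kendall

variable {n : ℕ}

/-- The sign of the difference of two natural numbers. -/
def diffSign (a b : ℕ) : ℝ := ((Int.sign ((a : ℤ) - b) : ℤ) : ℝ)

lemma diffSign_swap (a b : ℕ) : diffSign b a = -diffSign a b := by
  rw [diffSign, diffSign, ← neg_sub, Int.sign_neg]
  push_cast
  rfl

lemma abs_diffSign_le (a b : ℕ) : |diffSign a b| ≤ 1 := by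
  rw [diffSign]
  rcases lt_trichotomy ((a : ℤ) - b) 0 with h | h | h
  · simp [Int.sign_eq_neg_one_of_neg h]
  · simp [h]
  · simp [Int.sign_eq_one_of_pos h]

/-- The sign of a product is the product of the signs; the factor 2 cancels the halves from counting
ordered pairs, and tied pairs contribute zero. -/
lemma kendall_eq (α β : DegType) (E : Edges n) :
    kendall α β E = (∑ p ∈ E ×ˢ E, diffSign (srcDegree E α p.1) (srcDegree E α p.2) *
      diffSign (tgtDegree E β p.1) (tgtDegree E β p.2)) / ((E.card : ℝ) * ((E.card : ℝ) - 1)) := by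
  rw [kendall, concordantPairs, discordantPairs]
  congr 1
  rw [Finset.card_filter, Finset.card_filter]
  push_cast
  rw [← sub_div, mul_div_cancel₀ _ two_ne_zero, ← Finset.sum_sub_distrib]
  refine Finset.sum_congr rfl fun p _ => ?_
  rw [diffSign, diffSign, ← Int.cast_mul, ← Int.sign_mul]
  change _ = ((Int.sign (concordance α β E p) : ℤ) : ℝ)
  rcases lt_trichotomy (concordance α β E p) 0 with h | h | h
  · simp [Int.sign_eq_neg_one_of_neg h, h, h.le]
  · simp [h]
  · simp [Int.sign_eq_one_of_pos h, h, h.le]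

/-- A bounded quadratic form that vanishes at `r` is small near `r`. -/
lemma abs_sum_sum_mul_le {I : Type*} (s : Finset I) (φ : I → I → ℝ) (x r : I → ℝ) {η : ℝ}
    (hφ : ∀ i j, |φ i j| ≤ 1) (hx : ∀ i, 0 ≤ x i) (hr : ∀ i, 0 ≤ r i) (hx1 : ∑ i ∈ s, x i ≤ 1)
    (hr1 : ∑ i ∈ s, r i ≤ 1) (hxr : ∀ i ∈ s, |x i - r i| ≤ η)
    (h0 : ∑ i ∈ s, ∑ j ∈ s, φ i j * (r i * r j) = 0) :
    |∑ i ∈ s, ∑ j ∈ s, φ i j * (x i * x j)| ≤ 2 * (s.card * η) := by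
  have h1 : ∑ i ∈ s, ∑ j ∈ s, φ i j * (x i * x j) =
      ∑ i ∈ s, ∑ j ∈ s, φ i j * ((x i - r i) * x j + r i * (x j - r j)) := by
    rw [← sub_eq_zero, ← h0, ← Finset.sum_sub_distrib]
    refine Finset.sum_congr rfl fun i _ => ?_
    rw [← Finset.sum_sub_distrib]
    exact Finset.sum_congr rfl fun j _ => by ring
  have hd : ∑ i ∈ s, |x i - r i| ≤ s.card * η := by
    rw [← nsmul_eq_mul]
    exact Finset.sum_le_card_nsmul _ _ _ hxr
  have hd0 : 0 ≤ ∑ i ∈ s, |x i - r i| := Finset.sum_nonneg fun _ _ => abs_nonneg _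
  rw [h1]
  calc |∑ i ∈ s, ∑ j ∈ s, φ i j * ((x i - r i) * x j + r i * (x j - r j))|
      ≤ ∑ i ∈ s, ∑ j ∈ s, (|x i - r i| * x j + r i * |x j - r j|) := by
        refine (Finset.abs_sum_le_sum_abs _ _).trans (Finset.sum_le_sum fun i _ => ?_)
        refine (Finset.abs_sum_le_sum_abs _ _).trans (Finset.sum_le_sum fun j _ => ?_)
        rw [abs_mul]
        have h2 := abs_add_le ((x i - r i) * x j) (r i * (x j - r j))
        rw [abs_mul, abs_mul, abs_of_nonneg (hx j), abs_of_nonneg (hr i)] at h2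
        exact (mul_le_of_le_one_left (abs_nonneg _) (hφ i j)).trans h2
    _ = (∑ i ∈ s, |x i - r i|) * ∑ j ∈ s, x j + (∑ i ∈ s, r i) * ∑ j ∈ s, |x j - r j| := by
        simp only [Finset.sum_add_distrib, Finset.sum_mul_sum]
    _ ≤ (∑ i ∈ s, |x i - r i|) * 1 + 1 * ∑ j ∈ s, |x j - r j| := by gcongr
    _ ≤ _ := by linarith

/-- An antisymmetric kernel against symmetric weights: two independent draws from one distribution
have no preferred order. -/
lemma sum_sum_diffSign_mul (s : Finset ℕ) (p : ℕ → ℝ) :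
    ∑ i ∈ s, ∑ j ∈ s, diffSign i j * (p i * p j) = 0 := by
  have h : ∑ i ∈ s, ∑ j ∈ s, diffSign i j * (p i * p j) =
      ∑ i ∈ s, ∑ j ∈ s, -(diffSign i j * (p i * p j)) := by
    rw [Finset.sum_comm]
    refine Finset.sum_congr rfl fun i _ => Finset.sum_congr rfl fun j _ => ?_
    rw [diffSign_swap]; ring
  simp only [Finset.sum_neg_distrib] at h
  linarith

lemma sum_filter_degrees (α β : DegType) (E : Edges n) (K : ℕ) (F : ℕ → ℕ → ℝ) :
    ∑ e ∈ E.filter (fun e => srcDegree E α e < K ∧ tgtDegree E β e < K),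
      F (srcDegree E α e) (tgtDegree E β e) =
    ∑ i ∈ Finset.range K ×ˢ Finset.range K,
      (E.filter fun e => srcDegree E α e = i.1 ∧ tgtDegree E β e = i.2).card * F i.1 i.2 := by
  rw [← Finset.sum_fiberwise_of_maps_to (t := Finset.range K ×ˢ Finset.range K)
    (g := fun e => (srcDegree E α e, tgtDegree E β e))]
  · refine Finset.sum_congr rfl fun i hi => ?_
    simp only [Finset.mem_product, Finset.mem_range] at hi
    rw [Finset.sum_congr rfl (g := fun _ => F i.1 i.2), Finset.sum_const, nsmul_eq_mul,
      Finset.filter_filter]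
    · congr 2
      congr 1
      refine Finset.filter_congr fun e _ => ?_
      rw [Prod.ext_iff]
      constructor
      · rintro ⟨-, h⟩; exact h
      · rintro h
        have h1 : srcDegree E α e = i.1 := h.1
        have h2 : tgtDegree E β e = i.2 := h.2
        exact ⟨by omega, h⟩
    · intro e he
      have := (Finset.mem_filter.1 he).2
      subst this
      rfl
  · intro e he
    simpa using (Finset.mem_filter.1 he).2

/-- Kendall's tau is small if the empirical joint distribution is close to a product. -/
lemma abs_kendall_le (α β : DegType) (E : Edges n) (hE : 2 ≤ E.card) (K : ℕ) (p q : ℕ → ℝ)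
    (hp : ∀ k, 0 ≤ p k) (hq : ∀ l, 0 ≤ q l) {η ε : ℝ}
    (hpq : 1 - ε ≤ (∑ k ∈ Finset.range K, p k) * ∑ l ∈ Finset.range K, q l)
    (hpq1 : (∑ k ∈ Finset.range K, p k) * ∑ l ∈ Finset.range K, q l ≤ 1)
    (h : ∀ k < K, ∀ l < K, |empiricalJoint α β k l E - p k * q l| ≤ η) :
    |kendall α β E| ≤ 8 * ((K : ℝ) ^ 2 * η) + 4 * ε := by
  set m : ℝ := (E.card : ℝ) with hm
  have hm2 : (2 : ℝ) ≤ m := by rw [hm]; exact_mod_cast hE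
  have hm0 : 0 < m := by linarith
  let I := Finset.range K ×ˢ Finset.range K
  let G := E.filter fun e => srcDegree E α e < K ∧ tgtDegree E β e < K
  let x : ℕ × ℕ → ℝ := fun i => empiricalJoint α β i.1 i.2 E
  let r : ℕ × ℕ → ℝ := fun i => p i.1 * q i.2
  let φ : ℕ × ℕ → ℕ × ℕ → ℝ := fun i j => diffSign i.1 j.1 * diffSign i.2 j.2
  have hI : (I.card : ℝ) = (K : ℝ) ^ 2 := by simp [I, pow_two]
  have hφ : ∀ i j, |φ i j| ≤ 1 := fun i j => by
    rw [abs_mul]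
    exact mul_le_one₀ (abs_diffSign_le _ _) (abs_nonneg _) (abs_diffSign_le _ _)
  have hx : ∀ i, 0 ≤ x i := fun i => by simp only [x, empiricalJoint]; positivity
  have hN : ∀ i : ℕ × ℕ, ((E.filter fun e => srcDegree E α e = i.1 ∧
      tgtDegree E β e = i.2).card : ℝ) = m * x i := fun i => by
    simp only [x, empiricalJoint, ← hm]
    field_simp
  have hG : (G.card : ℝ) = m * ∑ i ∈ I, x i := by
    have := sum_filter_degrees α β E K (fun _ _ => 1)
    simp only [Finset.sum_const, nsmul_eq_mul, mul_one, hN, ← Finset.mul_sum] at this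
    exact this
  have hGm : (G.card : ℝ) ≤ m := by
    rw [hm]; exact_mod_cast Finset.card_le_card (Finset.filter_subset _ _)
  have hx1 : ∑ i ∈ I, x i ≤ 1 := by
    rw [hG] at hGm
    nlinarith
  have hrsum : ∑ i ∈ I, r i = (∑ k ∈ Finset.range K, p k) * ∑ l ∈ Finset.range K, q l := by
    rw [Finset.sum_mul_sum, ← Finset.sum_product']
  have hxr : ∀ i ∈ I, |x i - r i| ≤ η := by
    intro i hi
    simp only [I, Finset.mem_product, Finset.mem_range] at hi
    exact h _ hi.1 _ hi.2
  -- At a product law the form factors into a source form and a target form, each of which vanishes.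
  have h0 : ∑ i ∈ I, ∑ j ∈ I, φ i j * (r i * r j) = 0 := by
    have : ∑ i ∈ I, ∑ j ∈ I, φ i j * (r i * r j) =
        (∑ k ∈ Finset.range K, ∑ k' ∈ Finset.range K, diffSign k k' * (p k * p k')) *
        ∑ l ∈ Finset.range K, ∑ l' ∈ Finset.range K, diffSign l l' * (q l * q l') := by
      simp only [I, Finset.sum_product, φ, r]
      rw [Finset.sum_mul_sum]
      refine Finset.sum_congr rfl fun k _ => Finset.sum_congr rfl fun l _ => ?_
      rw [Finset.sum_mul_sum]
      refine Finset.sum_congr rfl fun k' _ => Finset.sum_congr rfl fun l' _ => ?_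
      ring
    rw [this, sum_sum_diffSign_mul, zero_mul]
  have hquad := abs_sum_sum_mul_le I φ x r hφ hx (fun i => mul_nonneg (hp _) (hq _)) hx1
    (hrsum ▸ hpq1) hxr h0
  rw [hI] at hquad
  let ψ : (Fin n × Fin n) × (Fin n × Fin n) → ℝ := fun p =>
    diffSign (srcDegree E α p.1) (srcDegree E α p.2) *
      diffSign (tgtDegree E β p.1) (tgtDegree E β p.2)
  have hψ : ∀ p, |ψ p| ≤ 1 := fun p => hφ (_, _) (_, _)
  have hGG : ∑ p ∈ G ×ˢ G, ψ p = m ^ 2 * ∑ i ∈ I, ∑ j ∈ I, φ i j * (x i * x j) := by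
    rw [Finset.sum_product]
    have h1 : ∀ e, ∑ f ∈ G, ψ (e, f) =
        ∑ j ∈ I, m * x j * φ (srcDegree E α e, tgtDegree E β e) j := by
      intro e
      have := sum_filter_degrees α β E K (fun a b =>
        diffSign (srcDegree E α e) a * diffSign (tgtDegree E β e) b)
      simp only [hN] at this
      exact this
    simp only [h1]
    have := sum_filter_degrees α β E K (fun a b => ∑ j ∈ I, m * x j * φ (a, b) j)
    simp only [hN] at this
    rw [this, Finset.mul_sum]
    refine Finset.sum_congr rfl fun i _ => ?_
    rw [Finset.mul_sum, Finset.mul_sum]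
    exact Finset.sum_congr rfl fun j _ => by ring
  have hsub : G ×ˢ G ⊆ E ×ˢ E :=
    Finset.product_subset_product (Finset.filter_subset _ _) (Finset.filter_subset _ _)
  -- Pairs outside `G ×ˢ G` involve a degree of at least K. They are bounded by their number, which
  -- is small because nearly all the mass of the product law lies below K.
  have hrest : |∑ p ∈ (E ×ˢ E) \ (G ×ˢ G), ψ p| ≤ m ^ 2 - (G.card : ℝ) ^ 2 := by
    refine (Finset.abs_sum_le_sum_abs _ _).trans
      ((Finset.sum_le_card_nsmul _ _ 1 fun p _ => hψ p).trans (le_of_eq ?_))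
    rw [nsmul_eq_mul, mul_one, Finset.card_sdiff_of_subset hsub,
      Nat.cast_sub (Finset.card_le_card hsub), Finset.card_product, Finset.card_product]
    push_cast
    ring
  have htotal : |∑ p ∈ E ×ˢ E, ψ p| ≤
      m ^ 2 * (2 * ((K : ℝ) ^ 2 * η)) + (m ^ 2 - (G.card : ℝ) ^ 2) := by
    rw [← Finset.sum_sdiff hsub, hGG, add_comm (∑ p ∈ _, _)]
    refine (abs_add_le _ _).trans (add_le_add ?_ hrest)
    rw [abs_mul, abs_of_nonneg (sq_nonneg m)]
    gcongr
  have hGlow : m * (1 - ε - (K : ℝ) ^ 2 * η) ≤ G.card := by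
    rw [hG]
    refine mul_le_mul_of_nonneg_left ?_ hm0.le
    have h1 : ∑ i ∈ I, (r i - η) ≤ ∑ i ∈ I, x i :=
      Finset.sum_le_sum fun i hi => by linarith [(abs_le.1 (hxr i hi)).1]
    rw [Finset.sum_sub_distrib, Finset.sum_const, nsmul_eq_mul, hI, hrsum] at h1
    linarith
  have hsq : m ^ 2 - (G.card : ℝ) ^ 2 ≤ m ^ 2 * (2 * (ε + (K : ℝ) ^ 2 * η)) := by
    have hg0 : (0 : ℝ) ≤ G.card := Nat.cast_nonneg _
    have h1 : m - G.card ≤ m * (ε + (K : ℝ) ^ 2 * η) := by linarith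
    have h2 : m + G.card ≤ 2 * m := by linarith
    calc m ^ 2 - (G.card : ℝ) ^ 2 = (m - G.card) * (m + G.card) := by ring
      _ ≤ (m - G.card) * (2 * m) := mul_le_mul_of_nonneg_left h2 (by linarith)
      _ ≤ m * (ε + (K : ℝ) ^ 2 * η) * (2 * m) := mul_le_mul_of_nonneg_right h1 (by linarith)
      _ = _ := by ring
  -- The total is at most m²(4K²η + 2ε); dividing by m(m - 1) ≥ m² / 2 doubles the constants.
  have hden : m ^ 2 / 2 ≤ m * (m - 1) := by nlinarith
  have hc : 0 ≤ 4 * ((K : ℝ) ^ 2 * η) + 2 * ε := by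
    have := (abs_nonneg _).trans (htotal.trans (add_le_add_right hsq _))
    have hm' : 0 < m ^ 2 := by positivity
    have h3 : 0 ≤ m ^ 2 * (4 * ((K : ℝ) ^ 2 * η) + 2 * ε) := by linarith
    exact nonneg_of_mul_nonneg_right h3 hm'
  rw [kendall_eq, ← hm, abs_div, abs_of_pos (by nlinarith : 0 < m * (m - 1)),
    div_le_iff₀ (by nlinarith)]
  refine htotal.trans ?_
  calc m ^ 2 * (2 * ((K : ℝ) ^ 2 * η)) + (m ^ 2 - (G.card : ℝ) ^ 2)
      ≤ m ^ 2 / 2 * (2 * (4 * ((K : ℝ) ^ 2 * η) + 2 * ε)) := by linarith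
    _ ≤ m * (m - 1) * (2 * (4 * ((K : ℝ) ^ 2 * η) + 2 * ε)) := by gcongr
    _ = _ := by ring

end Kendall

/-! ### The limiting degree laws have total mass one; convergence of Kendall's tau. -/

section Limits

variable {Fminus Fplus : Measure ℕ}

lemma hasSum_measureReal_mul (F : Measure ℕ) [IsProbabilityMeasure F] {f : ℕ → ℝ}
    (hf : Integrable f F) : HasSum (fun k => F.real {k} * f k) (∫ k, f k ∂F) := by
  have h := hasSum_integral_iUnion (μ := F) (f := f) (s := fun k : ℕ => {k})
    (fun k => MeasurableSet.of_discrete) (fun i j hij => by simpa using hij)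
    hf.integrableOn
  rw [Set.iUnion_of_singleton, setIntegral_univ] at h
  simpa [integral_singleton, measureReal_def] using h

lemma hasSum_measureReal (F : Measure ℕ) [IsProbabilityMeasure F] :
    HasSum (fun k => F.real {k}) 1 := by
  simpa using hasSum_measureReal_mul F (integrable_const (1 : ℝ))

lemma hasSum_sizeBiased (F : Measure ℕ) [IsProbabilityMeasure F]
    (hF : Integrable (fun k : ℕ => (k : ℝ) ^ 2) F) (hpos : 0 < mean F) :
    HasSum (fun k : ℕ => (k : ℝ) * F.real {k} / mean F) 1 := by
  have h := (hasSum_measureReal_mul F ((memLp_natCast hF).integrable (by norm_num))).div_const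
    (mean F)
  rw [← mean, div_self hpos.ne'] at h
  simpa only [mul_comm] using h

lemma hasSum_srcLimit [IsProbabilityMeasure Fminus] [IsProbabilityMeasure Fplus]
    (hplus : Integrable (fun k : ℕ => (k : ℝ) ^ 2) Fplus) (hpos : 0 < mean Fplus) (α : DegType) :
    HasSum (srcLimit Fminus Fplus α) 1 := by
  cases α
  · exact hasSum_sizeBiased Fplus hplus hpos
  · exact hasSum_measureReal Fminus

lemma hasSum_tgtLimit [IsProbabilityMeasure Fminus] [IsProbabilityMeasure Fplus]
    (hminus : Integrable (fun k : ℕ => (k : ℝ) ^ 2) Fminus) (hpos : 0 < mean Fminus)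
    (β : DegType) : HasSum (tgtLimit Fminus Fplus β) 1 := by
  cases β
  · exact hasSum_measureReal Fplus
  · exact hasSum_sizeBiased Fminus hminus hpos

variable [IsProbabilityMeasure Fminus] [IsProbabilityMeasure Fplus] {κ δ : ℝ}

/-- Because the limit laws have total mass one, a finite K captures almost all of it, and pointwise
convergence of finitely many joint frequencies is enough. -/
lemma tendsto_rcmLaw_kendall (hminus : Integrable (fun k : ℕ => (k : ℝ) ^ 2) Fminus)
    (hplus : Integrable (fun k : ℕ => (k : ℝ) ^ 2) Fplus)
    (hmean : mean Fminus = mean Fplus) (hpos : 0 < mean Fminus)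
    (hκ : κ ≤ 1 / 2) (hδ : 0 < δ) (hδκ : δ < κ) (α β : DegType) {ε : ℝ} (hε : 0 < ε) :
    Tendsto (fun n => rcmLaw Fminus Fplus κ δ n {E | ε ≤ |kendall α β E|}) atTop (𝓝 0) := by
  have hp0 : ∀ k, 0 ≤ srcLimit Fminus Fplus α k := srcLimit_nonneg hmean hpos α
  have hq0 : ∀ l, 0 ≤ tgtLimit Fminus Fplus β l := tgtLimit_nonneg hpos β
  have hp := hasSum_srcLimit (Fminus := Fminus) hplus (hmean ▸ hpos) α
  have hq := hasSum_tgtLimit (Fplus := Fplus) hminus hpos β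
  have hjoint : ∀ k l (η : ℝ), 0 < η → Tendsto (fun n => rcmLaw Fminus Fplus κ δ n
      {E | η ≤ |empiricalJoint α β k l E - srcLimit Fminus Fplus α k *
        tgtLimit Fminus Fplus β l|}) atTop (𝓝 0) := fun k l η hη =>
    tendsto_rcmLaw_empiricalJoint hminus hplus hmean hpos hκ hδ hδκ α β k l hη
  generalize srcLimit Fminus Fplus α = p at *
  generalize tgtLimit Fminus Fplus β = q at *
  have hlim := hp.tendsto_sum_nat.mul hq.tendsto_sum_nat
  rw [mul_one] at hlim
  obtain ⟨K, hK⟩ := (hlim.eventually_const_le (show 1 - ε / 16 < 1 by linarith)).exists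
  have hK1 : (∑ k ∈ Finset.range K, p k) * ∑ l ∈ Finset.range K, q l ≤ 1 :=
    mul_le_one₀ (sum_le_hasSum _ (fun k _ => hp0 k) hp) (Finset.sum_nonneg fun l _ => hq0 l)
      (sum_le_hasSum _ (fun l _ => hq0 l) hq)
  -- The bound for tau becomes 8 · ε/32 + 4 · ε/16 = ε/2; the added 1 guards against K = 0.
  set η := ε / (32 * ((K : ℝ) ^ 2 + 1)) with hη
  have hη0 : 0 < η := by positivity
  have hKη : (K : ℝ) ^ 2 * η ≤ ε / 32 := by
    rw [hη, ← mul_div_assoc, div_le_div_iff₀ (by positivity) (by positivity)]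
    nlinarith [sq_nonneg (K : ℝ)]
  have h1 : Tendsto (fun n => ∑ i ∈ Finset.range K ×ˢ Finset.range K, rcmLaw Fminus Fplus κ δ n
      {E | η ≤ |empiricalJoint α β i.1 i.2 E - p i.1 * q i.2|}) atTop
      (𝓝 (∑ i ∈ Finset.range K ×ˢ Finset.range K, 0)) :=
    tendsto_finsetSum _ fun i _ => hjoint i.1 i.2 η hη0
  have h2 := (tendsto_rcmLaw_card_lt hminus hplus hmean hpos hκ hδ hδκ 2).add h1
  rw [Finset.sum_const_zero, add_zero] at h2
  have hsub : ∀ n, {E : Edges n | ε ≤ |kendall α β E|} ⊆ {E | E.card < 2} ∪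
      ⋃ i ∈ Finset.range K ×ˢ Finset.range K,
        {E | η ≤ |empiricalJoint α β i.1 i.2 E - p i.1 * q i.2|} := by
    intro n E hE
    by_cases hc : E.card < 2
    · exact Or.inl hc
    refine Or.inr ?_
    by_contra hcon
    have hsmall : ∀ k < K, ∀ l < K, |empiricalJoint α β k l E - p k * q l| ≤ η := by
      intro k hk l hl
      by_contra hlt
      refine hcon (Set.mem_biUnion (x := (k, l)) ?_ (not_le.1 hlt).le)
      exact Finset.mem_coe.2 (Finset.mem_product.2 ⟨Finset.mem_range.2 hk, Finset.mem_range.2 hl⟩)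
    have h3 := abs_kendall_le α β E (not_lt.1 hc) K p q hp0 hq0 hK hK1 hsmall
    have h4 : ε ≤ |kendall α β E| := hE
    linarith
  have hle : ∀ n, rcmLaw Fminus Fplus κ δ n {E | ε ≤ |kendall α β E|} ≤
      rcmLaw Fminus Fplus κ δ n {E | E.card < 2} +
      ∑ i ∈ Finset.range K ×ˢ Finset.range K, rcmLaw Fminus Fplus κ δ n
        {E | η ≤ |empiricalJoint α β i.1 i.2 E - p i.1 * q i.2|} := by
    intro n
    refine (measure_mono (hsub n)).trans ((measure_union_le _ _).trans ?_)
    gcongr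
    exact measure_biUnion_finset_le _ _
  exact tendsto_of_tendsto_of_tendsto_of_le_of_le tendsto_const_nhds h2 (fun _ => zero_le) hle

end Limits

/-! ### Spearman's rho with random ranks, and passage to random variables. -/

section Main

variable {Fminus Fplus : Measure ℕ} [IsProbabilityMeasure Fminus] [IsProbabilityMeasure Fplus]
  {κ δ : ℝ}

lemma measurable_spearman_prod {n : ℕ} (α β : DegType) :
    Measurable fun x : Edges n × (Fin n × Fin n → ℝ) × (Fin n × Fin n → ℝ) =>
      spearman α β x.1 x.2.1 x.2.2 :=
  measurable_from_prod_countable_right fun E => measurable_spearman α β E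

/-- Spearman's rho is small if there are many edges and its mean over the marks is small. -/
lemma prod_marksLaw_abs_spearman_ge_le {n : ℕ} (μ : Measure (Edges n)) [IsProbabilityMeasure μ]
    (α β : DegType) {M : ℕ} (hM : 2 ≤ M) {ε : ℝ} (hε : 0 < ε) :
    (μ.prod ((marksLaw n).prod (marksLaw n))) {x | ε ≤ |spearman α β x.1 x.2.1 x.2.2|} ≤
      ENNReal.ofReal (80000 / ((ε / 2) ^ 2 * M)) +
        (μ {E | E.card < M} + μ {E | ε / 2 ≤ |meanSpearman α β E|}) := by
  have hms : MeasurableSet {x : Edges n × (Fin n × Fin n → ℝ) × (Fin n × Fin n → ℝ) |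
      ε ≤ |spearman α β x.1 x.2.1 x.2.2|} :=
    measurableSet_le measurable_const (measurable_spearman_prod α β).abs
  set B : Set (Edges n) := {E | E.card < M} ∪ {E | ε / 2 ≤ |meanSpearman α β E|} with hB
  have hB' : μ B ≤ μ {E | E.card < M} + μ {E | ε / 2 ≤ |meanSpearman α β E|} :=
    measure_union_le _ _
  refine le_trans ?_ (add_le_add_right hB' _)
  rw [Measure.prod_apply hms]
  refine (lintegral_mono (g := fun E => ENNReal.ofReal (80000 / ((ε / 2) ^ 2 * M)) +
    Set.indicator B (fun _ => 1) E) fun E => ?_).trans ?_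
  · by_cases hE : E ∈ B
    · simp only [Set.indicator_of_mem hE]
      exact prob_le_one.trans le_add_self
    · refine le_trans ?_ le_self_add
      simp only [hB, Set.mem_union, Set.mem_ofPred_eq, not_or, not_lt, not_le] at hE
      refine (measure_mono ?_).trans ((marksLaw_prod_abs_spearman_sub_ge_le α β E
        (hM.trans hE.1) (half_pos hε)).trans (ENNReal.ofReal_le_ofReal ?_))
      · intro p hp
        have h1 : ε ≤ |spearman α β E p.1 p.2| := hp
        have h2 := abs_sub_abs_le_abs_sub (spearman α β E p.1 p.2) (meanSpearman α β E)
        simp only [Set.mem_ofPred_eq]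
        linarith [hE.2]
      · have h3 : (M : ℝ) ≤ E.card := by exact_mod_cast hE.1
        have h4 : (0 : ℝ) < M := by exact_mod_cast (by omega : 0 < M)
        gcongr
  · rw [lintegral_add_left measurable_const, lintegral_indicator_const MeasurableSet.of_discrete,
      lintegral_const, measure_univ, mul_one, one_mul]

lemma tendsto_prod_marksLaw_spearman (hminus : Integrable (fun k : ℕ => (k : ℝ) ^ 2) Fminus)
    (hplus : Integrable (fun k : ℕ => (k : ℝ) ^ 2) Fplus)
    (hmean : mean Fminus = mean Fplus) (hpos : 0 < mean Fminus)
    (hκ : κ ≤ 1 / 2) (hδ : 0 < δ) (hδκ : δ < κ) (α β : DegType) {ε : ℝ} (hε : 0 < ε) :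
    Tendsto (fun n => ((rcmLaw Fminus Fplus κ δ n).prod ((marksLaw n).prod (marksLaw n)))
      {x | ε ≤ |spearman α β x.1 x.2.1 x.2.2|}) atTop (𝓝 0) := by
  have hprob := eventually_isProbabilityMeasure_rcmLaw hδκ
    (whp_rawLaw_accepted hminus hplus hmean hκ hδ)
    (whp_graphical hminus hplus hmean hpos hκ hδ hδκ)
  have hM0 : Tendsto (fun M : ℕ => ENNReal.ofReal (80000 / ((ε / 2) ^ 2 * M))) atTop (𝓝 0) := by
    rw [← ENNReal.ofReal_zero]
    refine ENNReal.tendsto_ofReal ?_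
    simp only [← div_div]
    exact tendsto_const_div_atTop_nhds_zero_nat _
  rw [ENNReal.tendsto_nhds_zero]
  intro ε' hε'
  have hhalf : 0 < ε' / 2 := ENNReal.half_pos hε'.ne'
  -- M is fixed before n: it makes the fluctuation from the marks small, after which having fewer
  -- than M edges becomes unlikely.
  obtain ⟨M, hM1, hM2⟩ := ((ENNReal.tendsto_nhds_zero.1 hM0 _ hhalf).and
    (eventually_ge_atTop 2)).exists
  have h2 := (tendsto_rcmLaw_card_lt hminus hplus hmean hpos hκ hδ hδκ M).add
    (tendsto_rcmLaw_meanSpearman hminus hplus hmean hpos hκ hδ hδκ α β (half_pos hε))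
  rw [add_zero] at h2
  filter_upwards [hprob, ENNReal.tendsto_nhds_zero.1 h2 _ hhalf] with n hn hn2
  calc _ ≤ _ := prod_marksLaw_abs_spearman_ge_le _ α β hM2 hε
    _ ≤ ε' / 2 + ε' / 2 := add_le_add hM1 hn2
    _ = ε' := ENNReal.add_halves _

/-- Convergence to a constant involves only the law at each n, so nothing is needed about the joint
behaviour for different n. The push-forward inequality used holds for arbitrary sets, so `f n` need
not be measurable. -/
lemma tendstoInMeasure_of_law {Ω : Type*} [MeasurableSpace Ω] {P : Measure Ω}
    {X : ℕ → Type*} [∀ n, MeasurableSpace (X n)] {ν : ∀ n, Measure (X n)} {Z : ∀ n, Ω → X n}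
    (hZ : ∀ᶠ n in atTop, HasLaw (Z n) (ν n) P) (f : ∀ n, X n → ℝ) (c : ℝ)
    (h : ∀ ε : ℝ, 0 < ε → Tendsto (fun n => ν n {x | ε ≤ |f n x - c|}) atTop (𝓝 0)) :
    TendstoInMeasure P (fun n ω => f n (Z n ω)) atTop (fun _ => c) := by
  rw [tendstoInMeasure_iff_norm]
  intro ε hε
  refine tendsto_of_tendsto_of_tendsto_of_le_of_le' tendsto_const_nhds (h ε hε)
    (Eventually.of_forall fun _ => zero_le) ?_
  filter_upwards [hZ] with n hn
  rw [← hn.map_eq]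
  exact Measure.le_map_apply hn.aemeasurable {x | ε ≤ |f n x - c|}

end Main

end RCM

end

theorem mainTheorem4 (Fminus Fplus : Measure ℕ) [IsProbabilityMeasure Fminus]
    [IsProbabilityMeasure Fplus]
    (hminus : Integrable (fun k : ℕ => (k : ℝ) ^ 2) Fminus)
    (hplus : Integrable (fun k : ℕ => (k : ℝ) ^ 2) Fplus)
    (hmean : RCM.mean Fminus = RCM.mean Fplus) (hpos : 0 < RCM.mean Fminus)
    (κ δ : ℝ) (hκ : κ ≤ 1 / 2) (hδ : 0 < δ) (hδκ : δ < κ) :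
    (∀ᶠ n in atTop, IsProbabilityMeasure (RCM.rcmLaw Fminus Fplus κ δ n)) ∧
    ∀ (Ω : Type*) [MeasurableSpace Ω] (P : Measure Ω) [IsProbabilityMeasure P]
      (G : ∀ n : ℕ, Ω → RCM.Edges n) (U W : ∀ n : ℕ, Ω → (Fin n × Fin n → ℝ)),
      (∀ᶠ n in atTop, HasLaw (fun ω => (G n ω, U n ω, W n ω))
        ((RCM.rcmLaw Fminus Fplus κ δ n).prod ((RCM.marksLaw n).prod (RCM.marksLaw n))) P) →
      ∀ α β : RCM.DegType,
        TendstoInMeasure P (fun n ω => RCM.spearman α β (G n ω) (U n ω) (W n ω)) atTop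
          (fun _ => (0 : ℝ)) ∧
        TendstoInMeasure P (fun n ω => RCM.spearmanAverage α β (G n ω)) atTop
          (fun _ => (0 : ℝ)) ∧
        TendstoInMeasure P (fun n ω => RCM.kendall α β (G n ω)) atTop (fun _ => (0 : ℝ)) ∧
        ∀ k l : ℕ, TendstoInMeasure P (fun n ω => RCM.empiricalJoint α β k l (G n ω)) atTop
          (fun _ => RCM.srcLimit Fminus Fplus α k * RCM.tgtLimit Fminus Fplus β l) := by

  have hacc := RCM.whp_rawLaw_accepted hminus hplus hmean hκ hδ
  have hprob := RCM.eventually_isProbabilityMeasure_rcmLaw hδκ hacc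
    (RCM.whp_graphical hminus hplus hmean hpos hκ hδ hδκ)
  refine ⟨hprob, fun Ω _ P _ G U W hlaw α β => ?_⟩
  have hG : ∀ᶠ n in atTop, HasLaw (G n) (RCM.rcmLaw Fminus Fplus κ δ n) P := by
    filter_upwards [hlaw, hprob] with n hn hp
    have hfst : HasLaw Prod.fst (RCM.rcmLaw Fminus Fplus κ δ n)
        ((RCM.rcmLaw Fminus Fplus κ δ n).prod ((RCM.marksLaw n).prod (RCM.marksLaw n))) :=
      ⟨measurable_fst.aemeasurable, measurePreserving_fst.map_eq⟩
    exact hfst.comp hn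
  refine ⟨?_, ?_, ?_, fun k l => ?_⟩
  · refine RCM.tendstoInMeasure_of_law hlaw
      (fun n x => RCM.spearman α β x.1 x.2.1 x.2.2) 0 fun ε hε => ?_
    simp only [sub_zero]
    exact RCM.tendsto_prod_marksLaw_spearman hminus hplus hmean hpos hκ hδ hδκ α β hε
  · refine RCM.tendstoInMeasure_of_law hG (fun n => RCM.spearmanAverage α β) 0 fun ε hε => ?_
    simp only [sub_zero]
    exact RCM.tendsto_rcmLaw_spearmanAverage hminus hplus hmean hpos hκ hδ hδκ α β hε
  · refine RCM.tendstoInMeasure_of_law hG (fun n => RCM.kendall α β) 0 fun ε hε => ?_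
    simp only [sub_zero]
    exact RCM.tendsto_rcmLaw_kendall hminus hplus hmean hpos hκ hδ hδκ α β hε
  · exact RCM.tendstoInMeasure_of_law hG (fun n => RCM.empiricalJoint α β k l) _ fun ε hε =>
      RCM.tendsto_rcmLaw_empiricalJoint hminus hplus hmean hpos hκ hδ hδκ α β k l hε
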